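/- Let $n\in\mathbb N$ and $1<p<n$, let $p'$ be defined by $1/p+1/p'=1$, and let $\alpha,\beta,\sigma,\rho\in\mathbb R$ satisfy $$\alpha+\sigma=\beta+\rho,\qquad 0<\alpha<\frac n{p'},\qquad 0<\sigma<n,\qquad -\frac np<\rho-\sigma,\qquad \rho<\frac n{p'} .$$ For $s>0$ and a Schwartz function $\varphi\in\mathcal S(\mathbb R^n)$ (complex valued), $(-\Delta)^{s/2}\varphi$ is the function whose Fourier transform is $(2\pi|\xi|)^s\hat\varphi(\xi)$, where $\hat\varphi(\xi)=\int_{\mathbb R^n}e^{-2\pi i x\cdot\xi}\varphi(x)\,dx$. For locally integrable $g,T$ on $\mathbb R^n$, $T=(-\Delta)^{s/2}g$ means that $\int_{\mathbb R^n} T\varphi\,dx=\int_{\mathbb R^n} g\,(-\Delta)^{s/2}\varphi\,dx$ for every $\varphi\in\mathcal S(\mathbb R^n)$, both integrals being absolutely convergent; this determines $T$ almost everywhere. Then for every $h\in\mathcal S(\mathbb R^n)$ the expression $(-\Delta)^{\sigma/2}\big(|x|^\beta(-\Delta)^{\alpha/2}h\big)$ is, in this sense, a well-defined locally integrable function, its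 product with $|x|^\rho$ lies in $L^p(\mathbb R^n)$, and $$\|h\|_{L^p(\mathbb R^n)}\le C\,\big\|\,|x|^\rho(-\Delta)^{\sigma/2}|x|^\beta(-\Delta)^{\alpha/2}h\big\|_{L^p(\mathbb R^n)},$$ $$C=2^{-(\alpha+\sigma)}\left[\frac{\Gamma\big(\frac n{2p}\big)\,\Gamma\big(\frac n{2p'}-\frac\alpha2\big)\,\Gamma\big(\frac n{2p'}-\frac\rho2\big)\,\Gamma\big(\frac n{2p}+\frac\rho2-\frac\sigma2\big)}{\Gamma\big(\frac n{2p'}\big)\,\Gamma\big(\frac n{2p}+\frac\alpha2\big)\,\Gamma\big(\frac n{2p}+\frac\rho2\big)\,\Gamma\big(\frac n{2p'}-\frac\rho2+\frac\sigma2\big)}\right].$$ -/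

import Mathlib

open MeasureTheory
open scoped SchwartzMap FourierTransform

noncomputable section

/-- The fractional Laplacian `(-Δ)^{s/2} φ` of a Schwartz function `φ` on `ℝⁿ` (`s > 0`): the
function with Fourier transform `(2π|ξ|)^s 𝓕φ(ξ)`, for the normalization
`𝓕φ(ξ) = ∫ e^{-2πi⟨x,ξ⟩} φ(x) dx`. -/
def fracLaplacian {n : ℕ} (s : ℝ) (φ : 𝓢(EuclideanSpace ℝ (Fin n), ℂ)) :
    EuclideanSpace ℝ (Fin n) → ℂ :=
  𝓕⁻ (fun ξ : EuclideanSpace ℝ (Fin n) =>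
    (((2 * Real.pi * ‖ξ‖) ^ s : ℝ) : ℂ) * 𝓕 (φ : EuclideanSpace ℝ (Fin n) → ℂ) ξ)

/-- Multiplication of a function on `ℝⁿ` by the power weight `|x|^a`. -/
def powerWeight {n : ℕ} (a : ℝ) (u : EuclideanSpace ℝ (Fin n) → ℂ) :
    EuclideanSpace ℝ (Fin n) → ℂ :=
  fun x => ((‖x‖ ^ a : ℝ) : ℂ) * u x

/-- `T = (-Δ)^{s/2} g` in the sense of tempered distributions, for locally integrable functions
`g` and `T`: one has `⟨T, φ⟩ = ⟨g, (-Δ)^{s/2} φ⟩` for every Schwartz function `φ`, both pairings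
being absolutely convergent integrals. This determines `T` almost everywhere. -/
structure IsFracLaplacian {n : ℕ} (s : ℝ) (g T : EuclideanSpace ℝ (Fin n) → ℂ) : Prop where
  locallyIntegrable_left : LocallyIntegrable g volume
  locallyIntegrable_right : LocallyIntegrable T volume
  integrable_left : ∀ φ : 𝓢(EuclideanSpace ℝ (Fin n), ℂ),
    Integrable (fun x => g x * fracLaplacian s φ x) volume
  integrable_right : ∀ φ : 𝓢(EuclideanSpace ℝ (Fin n), ℂ),
    Integrable (fun x => T x * φ x) volume
  integral_eq : ∀ φ : 𝓢(EuclideanSpace ℝ (Fin n), ℂ),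
    ∫ x, T x * φ x = ∫ x, g x * fracLaplacian s φ x

end

/-! The inequality is a composition of two weighted bounds for Riesz potentials. Write
`g = (-Δ)^{α/2} h` and `f = |x|^β g`, and let `I_s` be convolution with `|x|^{s-n} / rieszConst n s`,
the inverse of `(-Δ)^{s/2}`. Then `h = I_α g` and `f = I_σ T` for `T = (-Δ)^{σ/2} f`, and since
`α - β = ρ - σ`,

  `‖h‖_p ≤ C₁ ‖|x|^α g‖_p = C₁ ‖|x|^{ρ-σ} f‖_p ≤ C₁ C₂ ‖|x|^ρ T‖_p`.

Both steps are the Stein–Weiss inequality `‖|x|^{τ-s} I_s u‖_p ≤ C ‖|x|^τ u‖_p`, whose kernel is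
positive and homogeneous of degree `-n`. It satisfies Schur's test with powers of the norm as weights
(`lintegral_rpow_lintegral_steinWeiss_le`), the test integrals being convolutions of two powers of
the norm, which have a closed form (`lintegral_rpow_norm_sub_mul_rpow_norm`).

The remaining work is to give a meaning to `T` and to prove `f = I_σ T`. The function `f` is neither
smooth nor rapidly decaying, but it is of symbol type (`IsSymbol`): smooth off the origin, with the
derivatives of order `k` bounded by `|x|^{-b-k}`, for every `b` in an interval. This comes from the
fact that `G = (2π|ξ|)^α 𝓕 h` is a rapidly decaying symbol of order `α`, so that its inverse Fourier
transform `g` decays like `|x|^{-n-α}` (`IsSymbol.fourierInv`). For symbols, `(-Δ)^{σ/2}` is, up to a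
constant, the absolutely convergent hypersingular integral `∫ |y|^{-σ-n} δ_y f(x) dy` of central
differences `δ_y` of order `2l > σ`. It is of size `|x|^{-b-σ}`; letting `b` vary on both sides of the
critical exponent puts `|x|^ρ T` in `L^p`. It is symmetric (`integral_hypersingular_mul`) and agrees
with the Fourier multiplier on Schwartz functions (`exists_integral_centralDiff_fourierInv`), so that
`T` is `(-Δ)^{σ/2} f` in the sense of distributions (`IsSymbol.isFracLaplacian`).

For `f = I_σ T` (`IsSymbol.rieszPotential_hypersingular_ae_eq`), the difference `u` of the two sides
is `O(|x|^{-b})`. By symmetry of the two operators it annihilates `𝓕⁻ F` for every rapidly decaying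
symbol `F` of order `2l`, because `(2π|ξ|)^{-σ} F` is then again a rapidly decaying symbol of
nonnegative order. The central differences of order `2l` of a Schwartz function `θ` have this form;
as their step tends to infinity only the central term survives in the pairing with `u`, and
`∫ u θ = 0` (`ae_eq_zero_of_integral_mul_fourierInv_eq_zero`). -/

/-! ### Gamma integrals, Gaussians and the composition of two power kernels -/

lemma lintegral_rpow_mul_exp_neg_mul_Ioi {a r : ℝ} (ha : 0 < a) (hr : 0 < r) :
    ∫⁻ t in Set.Ioi (0 : ℝ), ENNReal.ofReal (t ^ (a - 1) * Real.exp (-(r * t))) =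
      ENNReal.ofReal (r ^ (-a) * Real.Gamma a) := by
  have h := Real.integral_rpow_mul_exp_neg_mul_Ioi ha hr
  have hpos : 0 < (1 / r) ^ a * Real.Gamma a :=
    mul_pos (Real.rpow_pos_of_pos (by positivity) _) (Real.Gamma_pos_of_pos ha)
  have hint : IntegrableOn (fun t : ℝ => t ^ (a - 1) * Real.exp (-(r * t))) (Set.Ioi 0) := by
    by_contra hc
    rw [integral_undef hc] at h
    exact hpos.ne h
  rw [← ofReal_integral_eq_lintegral_ofReal hint, h, Real.rpow_neg hr.le, one_div,
    Real.inv_rpow hr.le]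
  refine (ae_restrict_iff' measurableSet_Ioi).2 (Filter.Eventually.of_forall fun t ht => ?_)
  have : (0 : ℝ) < t := ht
  positivity

/-- The substitution `t ↦ t⁻¹` turns the Gamma integral into this one. -/
lemma lintegral_rpow_mul_exp_neg_div_Ioi {a r : ℝ} (ha : 0 < a) (hr : 0 < r) :
    ∫⁻ t in Set.Ioi (0 : ℝ), ENNReal.ofReal (t ^ (-a - 1) * Real.exp (-(r / t))) =
      ENNReal.ofReal (r ^ (-a) * Real.Gamma a) := by
  rw [← lintegral_rpow_mul_exp_neg_mul_Ioi ha hr]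
  have himg : (fun t : ℝ => t⁻¹) '' Set.Ioi 0 = Set.Ioi 0 := by
    ext x
    constructor
    · rintro ⟨y, hy, rfl⟩
      exact inv_pos.2 (Set.mem_Ioi.1 hy)
    · intro hx
      exact ⟨x⁻¹, inv_pos.2 (Set.mem_Ioi.1 hx), inv_inv x⟩
  conv_rhs => rw [← himg]
  rw [lintegral_image_eq_lintegral_abs_deriv_mul (f' := fun t => -(t ^ 2)⁻¹) measurableSet_Ioi
    (fun x hx => (hasDerivAt_inv (Set.mem_Ioi.1 hx).ne').hasDerivWithinAt)
    inv_injective.injOn]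
  refine setLIntegral_congr_fun measurableSet_Ioi fun t ht => ?_
  have ht : (0 : ℝ) < t := ht
  rw [← ENNReal.ofReal_mul (abs_nonneg _), abs_neg, abs_of_pos (by positivity), ← mul_assoc,
    div_eq_mul_inv]
  congr 2
  rw [Real.inv_rpow ht.le, ← Real.rpow_neg ht.le, ← Real.rpow_natCast, ← Real.rpow_neg ht.le,
    ← Real.rpow_add ht]
  congr 1
  push_cast
  ring

lemma lintegral_comp_mul_left_Ioi {t : ℝ} (ht : 0 < t) (g : ℝ → ENNReal) :
    ∫⁻ s in Set.Ioi (0 : ℝ), g s = ∫⁻ u in Set.Ioi (0 : ℝ), ENNReal.ofReal t * g (t * u) := by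
  have himg : (fun u : ℝ => t * u) '' Set.Ioi 0 = Set.Ioi 0 := by
    rw [Set.image_mul_left_Ioi ht, mul_zero]
  conv_lhs => rw [← himg]
  rw [lintegral_image_eq_lintegral_abs_deriv_mul (f' := fun _ => t) measurableSet_Ioi
    (fun x _ => by simpa using ((hasDerivAt_id x).const_mul t).hasDerivWithinAt)
    (mul_right_injective₀ ht.ne').injOn, abs_of_pos ht]

/-- Euler's Beta integral over the half-line. -/
lemma lintegral_beta_Ioi {p q : ℝ} (hp : 0 < p) (hq : 0 < q) :
    ∫⁻ u in Set.Ioi (0 : ℝ), ENNReal.ofReal (u ^ (p - 1) * (1 + u) ^ (-(p + q))) =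
      ENNReal.ofReal (Real.Gamma p * Real.Gamma q / Real.Gamma (p + q)) := by
  have hG : 0 < Real.Gamma (p + q) := Real.Gamma_pos_of_pos (by positivity)
  have hGp : 0 < Real.Gamma p := Real.Gamma_pos_of_pos (by positivity)
  have h1 : ∫⁻ u in Set.Ioi (0 : ℝ), ENNReal.ofReal (u ^ (p - 1) * (1 + u) ^ (-(p + q)))
      * ENNReal.ofReal (Real.Gamma (p + q)) =
      ∫⁻ u in Set.Ioi (0 : ℝ), ∫⁻ w in Set.Ioi (0 : ℝ),
        ENNReal.ofReal (u ^ (p - 1) * (w ^ (p + q - 1) * Real.exp (-((1 + u) * w)))) := by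
    refine setLIntegral_congr_fun measurableSet_Ioi fun u hu => ?_
    have hu : (0 : ℝ) < u := hu
    simp_rw [ENNReal.ofReal_mul (Real.rpow_nonneg hu.le (p - 1))]
    rw [lintegral_const_mul' _ _ ENNReal.ofReal_ne_top,
      lintegral_rpow_mul_exp_neg_mul_Ioi (by positivity) (by positivity : 0 < 1 + u), mul_assoc,
      ENNReal.ofReal_mul (by positivity : (0 : ℝ) ≤ (1 + u) ^ (-(p + q)))]
  have h2 : ∫⁻ u in Set.Ioi (0 : ℝ), ∫⁻ w in Set.Ioi (0 : ℝ),
        ENNReal.ofReal (u ^ (p - 1) * (w ^ (p + q - 1) * Real.exp (-((1 + u) * w)))) =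
      ∫⁻ w in Set.Ioi (0 : ℝ), ENNReal.ofReal (Real.Gamma p) *
        ENNReal.ofReal (w ^ (q - 1) * Real.exp (-(1 * w))) := by
    rw [lintegral_lintegral_swap (by fun_prop)]
    refine setLIntegral_congr_fun measurableSet_Ioi fun w hw => ?_
    have hw : (0 : ℝ) < w := hw
    have : ∀ u : ℝ, u ^ (p - 1) * (w ^ (p + q - 1) * Real.exp (-((1 + u) * w))) =
        (w ^ (p + q - 1) * Real.exp (-(1 * w))) * (u ^ (p - 1) * Real.exp (-(w * u))) := by
      intro u
      rw [show -((1 + u) * w) = -(1 * w) + -(w * u) by ring, Real.exp_add]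
      ring
    simp_rw [this, ENNReal.ofReal_mul (by positivity : (0 : ℝ) ≤
      w ^ (p + q - 1) * Real.exp (-(1 * w)))]
    rw [lintegral_const_mul' _ _ (by finiteness), lintegral_rpow_mul_exp_neg_mul_Ioi hp hw,
      ← ENNReal.ofReal_mul (by positivity), ← ENNReal.ofReal_mul (by positivity)]
    congr 1
    rw [show p + q - 1 = (q - 1) + p by ring, Real.rpow_add hw, Real.rpow_neg hw.le]
    field_simp
  rw [lintegral_mul_const' _ _ ENNReal.ofReal_ne_top, h2,
    lintegral_const_mul' _ _ ENNReal.ofReal_ne_top,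
    lintegral_rpow_mul_exp_neg_mul_Ioi hq one_pos, Real.one_rpow, one_mul,
    ← ENNReal.ofReal_mul hGp.le] at h1
  rw [ENNReal.ofReal_div_of_pos hG, ← h1, ENNReal.mul_div_cancel_right]
  · simpa using hG
  · exact ENNReal.ofReal_ne_top

section PowerKernels

variable {n : ℕ}

lemma lintegral_exp_neg_mul_norm_sq {b : ℝ} (hb : 0 < b) :
    ∫⁻ v : EuclideanSpace ℝ (Fin n), ENNReal.ofReal (Real.exp (-b * ‖v‖ ^ 2)) =
      ENNReal.ofReal ((Real.pi / b) ^ ((n : ℝ) / 2)) := by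
  have h := GaussianFourier.integral_rexp_neg_mul_sq_norm (V := EuclideanSpace ℝ (Fin n)) hb
  rw [finrank_euclideanSpace_fin] at h
  have hpos : 0 < (Real.pi / b) ^ ((n : ℝ) / 2) := by positivity
  rw [← h, ofReal_integral_eq_lintegral_ofReal]
  · by_contra hc
    rw [integral_undef hc] at h
    exact hpos.ne h
  · exact Filter.Eventually.of_forall fun v => by positivity

/-- The convolution of two Gaussians, by completing the square. -/
lemma lintegral_exp_mul_exp {s t : ℝ} (hs : 0 < s) (ht : 0 < t)
    (x : EuclideanSpace ℝ (Fin n)) :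
    ∫⁻ y : EuclideanSpace ℝ (Fin n),
        ENNReal.ofReal (Real.exp (-(‖x - y‖ ^ 2 * t)) * Real.exp (-(‖y‖ ^ 2 * s))) =
      ENNReal.ofReal ((Real.pi / (s + t)) ^ ((n : ℝ) / 2) *
        Real.exp (-(s * t / (s + t) * ‖x‖ ^ 2))) := by
  have key : ∀ y : EuclideanSpace ℝ (Fin n),
      Real.exp (-(‖x - y‖ ^ 2 * t)) * Real.exp (-(‖y‖ ^ 2 * s)) =
        Real.exp (-(s * t / (s + t) * ‖x‖ ^ 2)) *
          Real.exp (-(s + t) * ‖y - (t / (s + t)) • x‖ ^ 2) := by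
    intro y
    rw [← Real.exp_add, ← Real.exp_add, norm_sub_sq_real, norm_sub_sq_real, norm_smul,
      real_inner_smul_right, real_inner_comm y x, mul_pow, Real.norm_eq_abs, sq_abs]
    congr 1
    field_simp
    ring
  simp_rw [key, ENNReal.ofReal_mul (Real.exp_nonneg (-(s * t / (s + t) * ‖x‖ ^ 2)))]
  rw [lintegral_const_mul' _ _ ENNReal.ofReal_ne_top, lintegral_sub_right_eq_self
    (fun y : EuclideanSpace ℝ (Fin n) => ENNReal.ofReal (Real.exp (-(s + t) * ‖y‖ ^ 2))),
    lintegral_exp_neg_mul_norm_sq (by positivity), mul_comm,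
    ← ENNReal.ofReal_mul (by positivity)]

/-- The Gamma integral writes a negative power of the norm as a superposition of Gaussians. -/
lemma lintegral_rpow_mul_exp_neg_norm_sq {A : ℝ} (hA : 0 < A)
    {x : EuclideanSpace ℝ (Fin n)} (hx : x ≠ 0) :
    ∫⁻ t in Set.Ioi (0 : ℝ), ENNReal.ofReal (t ^ (A - 1) * Real.exp (-(‖x‖ ^ 2 * t))) =
      ENNReal.ofReal (‖x‖ ^ (-(2 * A)) * Real.Gamma A) := by
  have : 0 < ‖x‖ := norm_pos_iff.2 hx
  rw [lintegral_rpow_mul_exp_neg_mul_Ioi hA (by positivity), ← Real.rpow_natCast,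
    ← Real.rpow_mul this.le]
  push_cast
  ring_nf

/-- The convolution of the powers `|x|^{a-n}` and `|x|^{b-n}`. Both are superpositions of Gaussians;
the convolution of two Gaussians is explicit, and a Beta integral remains. -/
lemma lintegral_rpow_norm_sub_mul_rpow_norm [NeZero n] {a b : ℝ} (ha : 0 < a) (hb : 0 < b)
    (hab : a + b < n) {x : EuclideanSpace ℝ (Fin n)} (hx : x ≠ 0) :
    ∫⁻ y : EuclideanSpace ℝ (Fin n), ENNReal.ofReal (‖x - y‖ ^ (a - n) * ‖y‖ ^ (b - n)) =
      ENNReal.ofReal (Real.pi ^ ((n : ℝ) / 2) *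
        (Real.Gamma ((n - a - b) / 2) * Real.Gamma (a / 2) * Real.Gamma (b / 2)) /
        (Real.Gamma ((n - a) / 2) * Real.Gamma ((n - b) / 2) * Real.Gamma ((a + b) / 2)) *
        ‖x‖ ^ (a + b - n)) := by
  set A : ℝ := (n - a) / 2 with hA
  set B : ℝ := (n - b) / 2 with hB
  have hA0 : 0 < A := by rw [hA]; linarith
  have hB0 : 0 < B := by rw [hB]; linarith
  have hC0 : 0 < A + B - n / 2 := by rw [hA, hB]; linarith
  have hGA := Real.Gamma_pos_of_pos hA0
  have hGB := Real.Gamma_pos_of_pos hB0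
  have hxn : 0 < ‖x‖ := norm_pos_iff.2 hx
  have hGab : 0 < Real.Gamma ((a + b) / 2) := Real.Gamma_pos_of_pos (by linarith)
  have hGa : 0 < Real.Gamma (a / 2) := Real.Gamma_pos_of_pos (by linarith)
  have hGb : 0 < Real.Gamma (b / 2) := Real.Gamma_pos_of_pos (by linarith)
  -- both powers as superpositions of Gaussians with parameters `t` and `s`
  have h1 : (∫⁻ y : EuclideanSpace ℝ (Fin n),
        ENNReal.ofReal (‖x - y‖ ^ (a - n) * ‖y‖ ^ (b - n))) *
        ENNReal.ofReal (Real.Gamma A * Real.Gamma B) =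
      ∫⁻ y : EuclideanSpace ℝ (Fin n), ∫⁻ t in Set.Ioi (0 : ℝ), ∫⁻ s in Set.Ioi (0 : ℝ),
        ENNReal.ofReal (t ^ (A - 1) * Real.exp (-(‖x - y‖ ^ 2 * t))) *
        ENNReal.ofReal (s ^ (B - 1) * Real.exp (-(‖y‖ ^ 2 * s))) := by
    rw [← lintegral_mul_const' _ _ ENNReal.ofReal_ne_top]
    have hne : ∀ᵐ y : EuclideanSpace ℝ (Fin n), y ≠ 0 ∧ y ≠ x := by
      filter_upwards [compl_mem_ae_iff.2 (measure_singleton (0 : EuclideanSpace ℝ (Fin n))),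
        compl_mem_ae_iff.2 (measure_singleton x)] with y h0 hx using ⟨h0, hx⟩
    refine lintegral_congr_ae (hne.mono fun y hy => ?_)
    have hy0 : y ≠ 0 := hy.1
    have hxy : x - y ≠ 0 := sub_ne_zero.2 hy.2.symm
    have e1 : ∀ t : ℝ, ∫⁻ s in Set.Ioi (0 : ℝ),
        ENNReal.ofReal (t ^ (A - 1) * Real.exp (-(‖x - y‖ ^ 2 * t))) *
        ENNReal.ofReal (s ^ (B - 1) * Real.exp (-(‖y‖ ^ 2 * s))) =
        ENNReal.ofReal (t ^ (A - 1) * Real.exp (-(‖x - y‖ ^ 2 * t))) *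
          ENNReal.ofReal (‖y‖ ^ (-(2 * B)) * Real.Gamma B) := fun t => by
      rw [lintegral_const_mul' _ _ ENNReal.ofReal_ne_top, lintegral_rpow_mul_exp_neg_norm_sq hB0 hy0]
    simp_rw [e1]
    rw [lintegral_mul_const' _ _ ENNReal.ofReal_ne_top,
      lintegral_rpow_mul_exp_neg_norm_sq hA0 hxy, ← ENNReal.ofReal_mul (by positivity),
      ← ENNReal.ofReal_mul (by positivity), show -(2 * A) = a - n by rw [hA]; ring,
      show -(2 * B) = b - n by rw [hB]; ring]
    congr 1
    ring
  have h2 : (∫⁻ y : EuclideanSpace ℝ (Fin n), ∫⁻ t in Set.Ioi (0 : ℝ), ∫⁻ s in Set.Ioi (0 : ℝ),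
        ENNReal.ofReal (t ^ (A - 1) * Real.exp (-(‖x - y‖ ^ 2 * t))) *
        ENNReal.ofReal (s ^ (B - 1) * Real.exp (-(‖y‖ ^ 2 * s)))) =
      ∫⁻ t in Set.Ioi (0 : ℝ), ∫⁻ s in Set.Ioi (0 : ℝ),
        ENNReal.ofReal (t ^ (A - 1) * s ^ (B - 1) * ((Real.pi / (s + t)) ^ ((n : ℝ) / 2) *
        Real.exp (-(s * t / (s + t) * ‖x‖ ^ 2)))) := by
    rw [lintegral_lintegral_swap]
    · refine setLIntegral_congr_fun measurableSet_Ioi fun t ht => ?_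
      have ht : (0 : ℝ) < t := ht
      rw [lintegral_lintegral_swap (by fun_prop)]
      refine setLIntegral_congr_fun measurableSet_Ioi fun s hs => ?_
      have hs : (0 : ℝ) < s := hs
      have : ∀ y : EuclideanSpace ℝ (Fin n),
          ENNReal.ofReal (t ^ (A - 1) * Real.exp (-(‖x - y‖ ^ 2 * t))) *
            ENNReal.ofReal (s ^ (B - 1) * Real.exp (-(‖y‖ ^ 2 * s))) =
          ENNReal.ofReal (t ^ (A - 1) * s ^ (B - 1)) *
            ENNReal.ofReal (Real.exp (-(‖x - y‖ ^ 2 * t)) * Real.exp (-(‖y‖ ^ 2 * s))) := by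
        intro y
        rw [← ENNReal.ofReal_mul (by positivity), ← ENNReal.ofReal_mul (by positivity)]
        congr 1
        ring
      simp_rw [this]
      rw [lintegral_const_mul' _ _ ENNReal.ofReal_ne_top, lintegral_exp_mul_exp hs ht,
        ← ENNReal.ofReal_mul (by positivity)]
    · refine Measurable.aemeasurable ?_
      refine Measurable.lintegral_prod_right' (f := fun z : (EuclideanSpace ℝ (Fin n) × ℝ) × ℝ =>
        ENNReal.ofReal (z.1.2 ^ (A - 1) * Real.exp (-(‖x - z.1.1‖ ^ 2 * z.1.2))) *
        ENNReal.ofReal (z.2 ^ (B - 1) * Real.exp (-(‖z.1.1‖ ^ 2 * z.2)))) ?_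
      fun_prop
  -- the substitution `s = t u` separates the variables `t` and `u`
  have h3 : (∫⁻ t in Set.Ioi (0 : ℝ), ∫⁻ s in Set.Ioi (0 : ℝ),
        ENNReal.ofReal (t ^ (A - 1) * s ^ (B - 1) * ((Real.pi / (s + t)) ^ ((n : ℝ) / 2) *
        Real.exp (-(s * t / (s + t) * ‖x‖ ^ 2))))) =
      ∫⁻ u in Set.Ioi (0 : ℝ), ∫⁻ t in Set.Ioi (0 : ℝ),
        ENNReal.ofReal (Real.pi ^ ((n : ℝ) / 2) * (u ^ (B - 1) * (1 + u) ^ (-((n : ℝ) / 2)))) *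
        ENNReal.ofReal (t ^ (A + B - n / 2 - 1) *
          Real.exp (-((u / (1 + u) * ‖x‖ ^ 2) * t))) := by
    conv_rhs => rw [lintegral_lintegral_swap (by fun_prop)]
    refine setLIntegral_congr_fun measurableSet_Ioi fun t ht => ?_
    have ht : (0 : ℝ) < t := ht
    rw [lintegral_comp_mul_left_Ioi ht]
    refine setLIntegral_congr_fun measurableSet_Ioi fun u hu => ?_
    have hu : (0 : ℝ) < u := hu
    rw [← ENNReal.ofReal_mul (by positivity), ← ENNReal.ofReal_mul (by positivity)]
    congr 1
    have e1 : t * u + t = t * (1 + u) := by ring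
    have e2 : t * u * t / (t * (1 + u)) * ‖x‖ ^ 2 = u / (1 + u) * ‖x‖ ^ 2 * t := by
      field_simp
    have e3 : t ^ (A + B - n / 2 - 1) =
        t * t ^ (A - 1) * t ^ (B - 1) / t ^ ((n : ℝ) / 2) := by
      rw [← Real.rpow_one_add' ht.le (by linarith), ← Real.rpow_add ht, ← Real.rpow_sub ht]
      ring_nf
    rw [e1, e2, Real.div_rpow Real.pi_pos.le (by positivity), Real.mul_rpow ht.le hu.le,
      Real.mul_rpow ht.le (by positivity), Real.rpow_neg (by positivity),
      e3]
    field_simp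
  have h4 : (∫⁻ u in Set.Ioi (0 : ℝ), ∫⁻ t in Set.Ioi (0 : ℝ),
        ENNReal.ofReal (Real.pi ^ ((n : ℝ) / 2) * (u ^ (B - 1) * (1 + u) ^ (-((n : ℝ) / 2)))) *
        ENNReal.ofReal (t ^ (A + B - n / 2 - 1) *
          Real.exp (-((u / (1 + u) * ‖x‖ ^ 2) * t)))) =
      ENNReal.ofReal (Real.pi ^ ((n : ℝ) / 2) *
          (‖x‖ ^ (a + b - n) * Real.Gamma (A + B - n / 2))) *
        ENNReal.ofReal
          (Real.Gamma (a / 2) * Real.Gamma (b / 2) / Real.Gamma (a / 2 + b / 2)) := by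
    rw [← lintegral_beta_Ioi (half_pos ha) (half_pos hb),
      ← lintegral_const_mul' _ _ ENNReal.ofReal_ne_top]
    refine setLIntegral_congr_fun measurableSet_Ioi fun u hu => ?_
    have hu : (0 : ℝ) < u := hu
    have hG : 0 < Real.Gamma (A + B - n / 2) := Real.Gamma_pos_of_pos hC0
    rw [lintegral_const_mul' _ _ ENNReal.ofReal_ne_top,
      lintegral_rpow_mul_exp_neg_mul_Ioi hC0 (by positivity),
      ← ENNReal.ofReal_mul (by positivity), ← ENNReal.ofReal_mul (by positivity)]
    congr 1
    have e1 : (‖x‖ ^ 2) ^ (-(A + B - n / 2)) = ‖x‖ ^ (a + b - n) := by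
      rw [← Real.rpow_natCast, ← Real.rpow_mul hxn.le]
      congr 1
      rw [hA, hB]; push_cast; ring
    rw [Real.mul_rpow (by positivity) (by positivity), e1, Real.div_rpow hu.le (by positivity),
      show a / 2 - 1 = (B - 1) + -(A + B - n / 2) by rw [hA, hB]; ring, Real.rpow_add hu,
      show -(a / 2 + b / 2) = -((n : ℝ) / 2) - -(A + B - n / 2) by rw [hA, hB]; ring,
      Real.rpow_sub (by positivity : 0 < 1 + u)]
    ring
  rw [h2, h3, h4] at h1
  have hne : ENNReal.ofReal (Real.Gamma A * Real.Gamma B) ≠ 0 := by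
    simpa using mul_pos hGA hGB
  rw [ENNReal.eq_div_iff hne ENNReal.ofReal_ne_top |>.2 ((mul_comm _ _).trans h1),
    ← ENNReal.ofReal_mul (mul_nonneg (by positivity)
      (mul_nonneg (by positivity) (Real.Gamma_pos_of_pos hC0).le)),
    ← ENNReal.ofReal_div_of_pos (by positivity)]
  congr 1
  rw [show A + B - n / 2 = (n - a - b) / 2 by rw [hA, hB]; ring, ← add_div]
  field_simp

lemma exists_lintegral_rpow_norm_sub_mul_rpow_norm [NeZero n] {a b : ℝ} (ha : 0 < a) (hb : 0 < b)
    (hab : a + b < n) :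
    ∃ K : ℝ, 0 ≤ K ∧ ∀ x : EuclideanSpace ℝ (Fin n), x ≠ 0 →
      ∫⁻ y : EuclideanSpace ℝ (Fin n), ENNReal.ofReal (‖x - y‖ ^ (a - n) * ‖y‖ ^ (b - n)) =
        ENNReal.ofReal (K * ‖x‖ ^ (a + b - n)) := by
  refine ⟨_, ?_, fun x hx => lintegral_rpow_norm_sub_mul_rpow_norm ha hb hab hx⟩
  have h1 := Real.Gamma_pos_of_pos (show 0 < (n - a - b) / 2 by linarith)
  have h2 := Real.Gamma_pos_of_pos (half_pos ha)
  have h3 := Real.Gamma_pos_of_pos (half_pos hb)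
  have h4 := Real.Gamma_pos_of_pos (show 0 < (n - a) / 2 by linarith)
  have h5 := Real.Gamma_pos_of_pos (show 0 < (n - b) / 2 by linarith)
  have h6 := Real.Gamma_pos_of_pos (show 0 < (a + b) / 2 by linarith)
  positivity

end PowerKernels

/-! ### Radial integrals -/

section Radial

variable {n : ℕ} [NeZero n]

lemma lintegral_ofReal_comp_norm {f : ℝ → ℝ} (hf : ∀ r, 0 ≤ f r)
    (hint : IntegrableOn (fun r : ℝ => r ^ (n - 1) * f r) (Set.Ioi 0)) :
    ∫⁻ x : EuclideanSpace ℝ (Fin n), ENNReal.ofReal (f ‖x‖) =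
      ENNReal.ofReal (n * volume.real (Metric.ball (0 : EuclideanSpace ℝ (Fin n)) 1) *
        ∫ r in Set.Ioi (0 : ℝ), r ^ (n - 1) * f r) := by
  have h1 : Integrable (fun x : EuclideanSpace ℝ (Fin n) => f ‖x‖) := by
    rw [integrable_fun_norm_addHaar (volume : Measure (EuclideanSpace ℝ (Fin n)))]
    simpa using hint
  rw [← ofReal_integral_eq_lintegral_ofReal h1 (Filter.Eventually.of_forall fun x => hf _),
    integral_fun_norm_addHaar]
  simp [mul_assoc]

lemma exists_setLIntegral_closedBall_rpow_norm_le {t : ℝ} (ht : 0 < t) :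
    ∃ C : ℝ, 0 ≤ C ∧ ∀ R : ℝ, 0 < R →
      ∫⁻ x in Metric.closedBall (0 : EuclideanSpace ℝ (Fin n)) R,
        ENNReal.ofReal (‖x‖ ^ (t - n)) ≤ ENNReal.ofReal (C * R ^ t) := by
  refine ⟨n * volume.real (Metric.ball (0 : EuclideanSpace ℝ (Fin n)) 1) * t⁻¹, by positivity,
    fun R hR => ?_⟩
  set f : ℝ → ℝ := (Set.Icc 0 R).indicator fun r => r ^ (t - n) with hf
  have hf0 : ∀ r, 0 ≤ f r := fun r =>
    Set.indicator_nonneg (fun r hr => Real.rpow_nonneg hr.1 _) r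
  have e1 : ∀ r ∈ Set.Ioi (0 : ℝ), r ^ (n - 1) * f r =
      (Set.Ioc 0 R).indicator (fun r => r ^ (t - 1)) r := by
    intro r hr
    have hr : 0 < r := hr
    by_cases h : r ≤ R
    · rw [hf, Set.indicator_of_mem (show r ∈ Set.Icc 0 R from ⟨hr.le, h⟩),
        Set.indicator_of_mem (show r ∈ Set.Ioc 0 R from ⟨hr, h⟩), ← Real.rpow_natCast, ← Real.rpow_add hr,
        Nat.cast_sub (NeZero.one_le)]
      congr 1
      push_cast; ring
    · rw [hf, Set.indicator_of_notMem (fun h' => h h'.2), Set.indicator_of_notMem (fun h' => h h'.2),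
        mul_zero]
  have hI : IntegrableOn (fun r : ℝ => r ^ (t - 1)) (Set.Ioc 0 R) := by
    rw [← intervalIntegrable_iff_integrableOn_Ioc_of_le hR.le]
    exact intervalIntegral.intervalIntegrable_rpow' (by linarith)
  have hint : IntegrableOn (fun r : ℝ => r ^ (n - 1) * f r) (Set.Ioi 0) := by
    rw [integrableOn_congr_fun e1 measurableSet_Ioi]
    exact (hI.integrable_indicator measurableSet_Ioc).integrableOn
  have e2 : ∫ r in Set.Ioi (0 : ℝ), r ^ (n - 1) * f r = t⁻¹ * R ^ t := by
    rw [setIntegral_congr_fun measurableSet_Ioi e1, setIntegral_indicator measurableSet_Ioc,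
      Set.inter_eq_right.2 (fun r hr => hr.1), ← intervalIntegral.integral_of_le hR.le,
      integral_rpow (Or.inl (by linarith)), sub_add_cancel, Real.zero_rpow ht.ne']
    ring
  rw [mul_assoc, ← e2, ← lintegral_ofReal_comp_norm hf0 hint,
    ← lintegral_indicator Metric.isClosed_closedBall.measurableSet]
  refine lintegral_mono fun x => ?_
  by_cases hx : ‖x‖ ≤ R
  · rw [Set.indicator_of_mem (by simpa using hx), hf,
      Set.indicator_of_mem (show ‖x‖ ∈ Set.Icc 0 R from ⟨norm_nonneg x, hx⟩)]
  · rw [Set.indicator_of_notMem (by simpa using hx)]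
    exact zero_le

lemma exists_setLIntegral_compl_closedBall_rpow_norm_le {t : ℝ} (ht : 0 < t) :
    ∃ C : ℝ, 0 ≤ C ∧ ∀ R : ℝ, 0 < R →
      ∫⁻ x in (Metric.closedBall (0 : EuclideanSpace ℝ (Fin n)) R)ᶜ,
        ENNReal.ofReal (‖x‖ ^ (-t - n)) ≤ ENNReal.ofReal (C * R ^ (-t)) := by
  refine ⟨n * volume.real (Metric.ball (0 : EuclideanSpace ℝ (Fin n)) 1) * t⁻¹, by positivity,
    fun R hR => ?_⟩
  set f : ℝ → ℝ := (Set.Ioi R).indicator fun r => r ^ (-t - n) with hf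
  have hf0 : ∀ r, 0 ≤ f r := fun r =>
    Set.indicator_nonneg (fun r hr => Real.rpow_nonneg (hR.trans hr).le _) r
  have e1 : ∀ r ∈ Set.Ioi (0 : ℝ), r ^ (n - 1) * f r =
      (Set.Ioi R).indicator (fun r => r ^ (-t - 1)) r := by
    intro r hr
    have hr : 0 < r := hr
    by_cases h : R < r
    · rw [hf, Set.indicator_of_mem (Set.mem_Ioi.2 h), Set.indicator_of_mem (Set.mem_Ioi.2 h),
        ← Real.rpow_natCast, ← Real.rpow_add hr, Nat.cast_sub (NeZero.one_le)]
      congr 1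
      push_cast; ring
    · rw [hf, Set.indicator_of_notMem (show r ∉ Set.Ioi R from h),
        Set.indicator_of_notMem (show r ∉ Set.Ioi R from h), mul_zero]
  have hint : IntegrableOn (fun r : ℝ => r ^ (n - 1) * f r) (Set.Ioi 0) := by
    rw [integrableOn_congr_fun e1 measurableSet_Ioi]
    exact ((integrableOn_Ioi_rpow_of_lt (by linarith) hR).integrable_indicator
      measurableSet_Ioi).integrableOn
  have e2 : ∫ r in Set.Ioi (0 : ℝ), r ^ (n - 1) * f r = t⁻¹ * R ^ (-t) := by
    rw [setIntegral_congr_fun measurableSet_Ioi e1, setIntegral_indicator measurableSet_Ioi,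
      Set.inter_eq_right.2 (Set.Ioi_subset_Ioi hR.le), integral_Ioi_rpow_of_lt (by linarith) hR,
      sub_add_cancel]
    field_simp
  rw [mul_assoc, ← e2, ← lintegral_ofReal_comp_norm hf0 hint,
    ← lintegral_indicator Metric.isClosed_closedBall.measurableSet.compl]
  refine lintegral_mono fun x => ?_
  by_cases hx : R < ‖x‖
  · rw [Set.indicator_of_mem (by simpa using hx), hf,
      Set.indicator_of_mem (Set.mem_Ioi.2 hx)]
  · rw [Set.indicator_of_notMem (by simpa using hx)]
    exact zero_le

/-- A function dominated near the origin by an integrable power and near infinity by another one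
is integrable. -/
lemma lintegral_lt_top_of_le_rpow_norm {g : EuclideanSpace ℝ (Fin n) → ENNReal}
    {C s t : ℝ} (hs : -n < s) (ht : t < -n)
    (hg0 : ∀ x, x ≠ 0 → g x ≤ ENNReal.ofReal (C * ‖x‖ ^ s))
    (hg1 : ∀ x, x ≠ 0 → g x ≤ ENNReal.ofReal (C * ‖x‖ ^ t)) :
    ∫⁻ x, g x < ⊤ := by
  obtain ⟨A, hA, hA'⟩ := exists_setLIntegral_closedBall_rpow_norm_le (n := n) (t := s + n)
    (by linarith)
  obtain ⟨B, hB, hB'⟩ := exists_setLIntegral_compl_closedBall_rpow_norm_le (n := n) (t := -t - n)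
    (by linarith)
  have hne : ∀ᵐ x : EuclideanSpace ℝ (Fin n), x ≠ 0 :=
    compl_mem_ae_iff.2 (measure_singleton 0)
  rw [← lintegral_add_compl g (Metric.isClosed_closedBall.measurableSet :
    MeasurableSet (Metric.closedBall (0 : EuclideanSpace ℝ (Fin n)) 1))]
  refine ENNReal.add_lt_top.2 ⟨?_, ?_⟩
  · calc _ ≤ ∫⁻ x in Metric.closedBall (0 : EuclideanSpace ℝ (Fin n)) 1,
          ENNReal.ofReal |C| * ENNReal.ofReal (‖x‖ ^ (s + n - n)) := by
          refine lintegral_mono_ae (ae_restrict_of_ae (hne.mono fun x hx => ?_))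
          rw [← ENNReal.ofReal_mul (abs_nonneg _), add_sub_cancel_right]
          refine (hg0 x hx).trans (ENNReal.ofReal_le_ofReal ?_)
          gcongr
          exact le_abs_self C
      _ = ENNReal.ofReal |C| * ∫⁻ x in Metric.closedBall (0 : EuclideanSpace ℝ (Fin n)) 1,
          ENNReal.ofReal (‖x‖ ^ (s + n - n)) := lintegral_const_mul' _ _ ENNReal.ofReal_ne_top
      _ < ⊤ := ENNReal.mul_lt_top ENNReal.ofReal_lt_top
          ((hA' 1 one_pos).trans_lt ENNReal.ofReal_lt_top)
  · calc _ ≤ ∫⁻ x in (Metric.closedBall (0 : EuclideanSpace ℝ (Fin n)) 1)ᶜ,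
          ENNReal.ofReal |C| * ENNReal.ofReal (‖x‖ ^ (-(-t - n) - n)) := by
          refine lintegral_mono_ae (ae_restrict_of_ae (hne.mono fun x hx => ?_))
          rw [← ENNReal.ofReal_mul (abs_nonneg _), show -(-t - n) - (n : ℝ) = t by ring]
          refine (hg1 x hx).trans (ENNReal.ofReal_le_ofReal ?_)
          gcongr
          exact le_abs_self C
      _ = ENNReal.ofReal |C| * ∫⁻ x in (Metric.closedBall (0 : EuclideanSpace ℝ (Fin n)) 1)ᶜ,
          ENNReal.ofReal (‖x‖ ^ (-(-t - n) - n)) := lintegral_const_mul' _ _ ENNReal.ofReal_ne_top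
      _ < ⊤ := ENNReal.mul_lt_top ENNReal.ofReal_lt_top
          ((hB' 1 one_pos).trans_lt ENNReal.ofReal_lt_top)

end Radial

/-! ### Functions of symbol type -/

/-- A function on `ℝⁿ` is of symbol type of order `s` if it is smooth away from the origin and its
derivatives of order `k` are bounded by a multiple of `|x|^{s-k}` there. -/
structure IsSymbol {n : ℕ} (s : ℝ) (φ : EuclideanSpace ℝ (Fin n) → ℂ) : Prop where
  contDiffOn : ContDiffOn ℝ (⊤ : ℕ∞) φ {0}ᶜ
  bound : ∀ k : ℕ, ∃ C : ℝ, 0 ≤ C ∧ ∀ x, x ≠ 0 →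
    ‖iteratedFDerivWithin ℝ k φ {0}ᶜ x‖ ≤ C * ‖x‖ ^ (s - k)

lemma rpow_neg_le_of_le_of_le {r c d : ℝ} (hr : 0 < r) (hc : 0 ≤ c) (hcd : c ≤ d) :
    min 1 (r ^ (-d)) ≤ r ^ (-c) := by
  rcases le_total r 1 with h | h
  · exact (min_le_left _ _).trans (Real.one_le_rpow_of_pos_of_le_one_of_nonpos hr h (by linarith))
  · exact (min_le_right _ _).trans (Real.rpow_le_rpow_of_exponent_le h (by linarith))

namespace IsSymbol

variable {n : ℕ} {s t : ℝ} {φ ψ : EuclideanSpace ℝ (Fin n) → ℂ}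

lemma norm_le (h : IsSymbol s φ) : ∃ C : ℝ, 0 ≤ C ∧ ∀ x, x ≠ 0 → ‖φ x‖ ≤ C * ‖x‖ ^ s := by
  obtain ⟨C, hC, h⟩ := h.bound 0
  exact ⟨C, hC, fun x hx => by simpa using h x hx⟩

lemma continuousOn (h : IsSymbol s φ) : ContinuousOn φ {0}ᶜ := h.contDiffOn.continuousOn

lemma aestronglyMeasurable [NeZero n] (h : IsSymbol s φ) : AEStronglyMeasurable φ volume := by
  have := h.continuousOn.aestronglyMeasurable (μ := volume) (measurableSet_singleton 0).compl
  rwa [restrict_compl_singleton] at this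

lemma mul (hφ : IsSymbol s φ) (hψ : IsSymbol t ψ) : IsSymbol (s + t) (fun x => φ x * ψ x) := by
  refine ⟨hφ.contDiffOn.mul hψ.contDiffOn, fun k => ?_⟩
  choose A hA hA' using hφ.bound
  choose B hB hB' using hψ.bound
  refine ⟨∑ i ∈ Finset.range (k + 1), (k.choose i : ℝ) * A i * B (k - i),
    Finset.sum_nonneg fun i _ => by have := hA i; have := hB (k - i); positivity, fun x hx => ?_⟩
  have hxn : 0 < ‖x‖ := norm_pos_iff.2 hx
  refine (norm_iteratedFDerivWithin_mul_le hφ.contDiffOn hψ.contDiffOn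
    isOpen_compl_singleton.uniqueDiffOn hx (n := k) (by exact_mod_cast le_top)).trans ?_
  rw [Finset.sum_mul]
  refine Finset.sum_le_sum fun i hi => ?_
  have hik : i ≤ k := Nat.lt_succ_iff.1 (Finset.mem_range.1 hi)
  calc _ ≤ (k.choose i : ℝ) * (A i * ‖x‖ ^ (s - i)) * (B (k - i) * ‖x‖ ^ (t - (k - i : ℕ))) := by
        have := hA i
        gcongr
        · exact hA' i x hx
        · exact hB' (k - i) x hx
    _ = _ := by
        rw [Nat.cast_sub hik, show s + t - (k : ℝ) = (s - i) + (t - (k - i)) by ring,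
          Real.rpow_add hxn]
        ring

/-- Functions that are smooth off the origin and positively homogeneous. -/
lemma of_homogeneous (hφ : ContDiffOn ℝ (⊤ : ℕ∞) φ {0}ᶜ)
    (hom : ∀ (c : ℝ) (x : EuclideanSpace ℝ (Fin n)), 0 < c → x ≠ 0 →
      φ (c • x) = ((c ^ s : ℝ) : ℂ) * φ x) : IsSymbol s φ := by
  refine ⟨hφ, fun k => ?_⟩
  have hU : UniqueDiffOn ℝ ({0}ᶜ : Set (EuclideanSpace ℝ (Fin n))) :=
    isOpen_compl_singleton.uniqueDiffOn
  have hcont : ContinuousOn (iteratedFDerivWithin ℝ k φ {0}ᶜ)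
      (Metric.sphere (0 : EuclideanSpace ℝ (Fin n)) 1) :=
    (hφ.continuousOn_iteratedFDerivWithin (by exact_mod_cast le_top) hU).mono fun x hx h0 => by
      rw [Set.mem_singleton_iff.1 h0] at hx
      simp at hx
  obtain ⟨C, hC⟩ := (isCompact_sphere (0 : EuclideanSpace ℝ (Fin n)) 1).exists_bound_of_continuousOn
    hcont
  refine ⟨|C|, abs_nonneg _, fun x hx => ?_⟩
  have hxn : 0 < ‖x‖ := norm_pos_iff.2 hx
  set c : ℝ := ‖x‖⁻¹ with hc
  have hc0 : 0 < c := inv_pos.2 hxn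
  set g : EuclideanSpace ℝ (Fin n) →L[ℝ] EuclideanSpace ℝ (Fin n) :=
    c • ContinuousLinearMap.id ℝ _ with hg
  have hgx : ∀ y, g y = c • y := fun y => rfl
  have hpre : g ⁻¹' {0}ᶜ = {0}ᶜ := by
    ext y
    simp [hgx, hc0.ne']
  have h1 := g.iteratedFDerivWithin_comp_right (i := k) hφ hU (by rw [hpre]; exact hU)
    (x := x) (by simp [hgx, hc0.ne', hx]) (by exact_mod_cast le_top)
  rw [hpre] at h1
  have h2 : Set.EqOn (φ ∘ g) ((c ^ s : ℝ) • φ) {0}ᶜ := fun y hy => by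
    simp only [Function.comp_apply, hgx, Pi.smul_apply]
    rw [hom c y hc0 hy, Complex.real_smul]
  rw [iteratedFDerivWithin_congr h2 (by exact hx)] at h1
  have h3 : iteratedFDerivWithin ℝ k ((c ^ s : ℝ) • φ) {0}ᶜ x =
      (c ^ s : ℝ) • iteratedFDerivWithin ℝ k φ {0}ᶜ x :=
    iteratedFDerivWithin_const_smul_apply ((hφ.contDiffWithinAt hx).of_le
      (by exact_mod_cast le_top)) hU hx
  rw [h3] at h1
  have h4 : ‖iteratedFDerivWithin ℝ k φ {0}ᶜ (g x)‖ ≤ |C| :=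
    (hC (g x) (by simp [hgx, norm_smul, hc, hxn.ne'])).trans (le_abs_self C)
  have h5 : ‖(iteratedFDerivWithin ℝ k φ {0}ᶜ (g x)).compContinuousLinearMap fun _ => g‖ ≤
      |C| * c ^ k := by
    refine (ContinuousMultilinearMap.norm_compContinuousLinearMap_le _ _).trans ?_
    have hgn : ‖g‖ ≤ c := by
      rw [hg, norm_smul, Real.norm_eq_abs, abs_of_pos hc0]
      exact mul_le_of_le_one_right hc0.le ContinuousLinearMap.norm_id_le
    rw [Finset.prod_const, Finset.card_univ, Fintype.card_fin]
    gcongr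
  rw [← h1, norm_smul, Real.norm_eq_abs, abs_of_pos (by positivity)] at h5
  have h6 : c ^ s = ‖x‖ ^ (-s) := by rw [hc, Real.inv_rpow hxn.le, Real.rpow_neg hxn.le]
  have h7 : c ^ k = ‖x‖ ^ (-(k : ℝ)) := by
    rw [hc, inv_pow, Real.rpow_neg hxn.le, Real.rpow_natCast]
  rw [h6, h7] at h5
  calc _ = ‖x‖ ^ s * (‖x‖ ^ (-s) * ‖iteratedFDerivWithin ℝ k φ {0}ᶜ x‖) := by
        rw [← mul_assoc, ← Real.rpow_add hxn, add_neg_cancel, Real.rpow_zero, one_mul]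
    _ ≤ ‖x‖ ^ s * (|C| * ‖x‖ ^ (-(k : ℝ))) := by gcongr
    _ = _ := by rw [sub_eq_add_neg, Real.rpow_add hxn]; ring

lemma norm_rpow (s : ℝ) : IsSymbol s fun x : EuclideanSpace ℝ (Fin n) => ((‖x‖ ^ s : ℝ) : ℂ) := by
  refine of_homogeneous (fun x hx => ?_) fun c x hc _ => ?_
  · have h1 : ContDiffAt ℝ (⊤ : ℕ∞) (fun x : EuclideanSpace ℝ (Fin n) => ‖x‖ ^ s) x :=
      (contDiffAt_norm ℝ hx).rpow_const_of_ne (norm_ne_zero_iff.2 hx)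
    exact (Complex.ofRealCLM.contDiff.contDiffAt.comp x h1).contDiffWithinAt
  · rw [norm_smul, Real.norm_eq_abs, abs_of_pos hc, Real.mul_rpow hc.le (norm_nonneg _)]
    push_cast
    rfl

lemma inner_left (v : EuclideanSpace ℝ (Fin n)) :
    IsSymbol 1 fun x : EuclideanSpace ℝ (Fin n) => ((inner ℝ x v : ℝ) : ℂ) := by
  refine of_homogeneous (ContDiff.contDiffOn ?_) fun c x hc _ => ?_
  · exact Complex.ofRealCLM.contDiff.comp (contDiff_id.inner ℝ contDiff_const)
  · rw [real_inner_smul_left, Real.rpow_one]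
    push_cast
    rfl

lemma const (c : ℂ) : IsSymbol 0 fun _ : EuclideanSpace ℝ (Fin n) => c :=
  of_homogeneous contDiffOn_const fun r x hr _ => by simp

lemma prod_inner {k : ℕ} (v : Fin k → EuclideanSpace ℝ (Fin n)) :
    IsSymbol k fun x : EuclideanSpace ℝ (Fin n) => ∏ i, ((inner ℝ x (v i) : ℝ) : ℂ) := by
  induction k with
  | zero => simpa using const (n := n) 1
  | succ k ih =>
    simp_rw [Fin.prod_univ_succ]
    have := (inner_left (v 0)).mul (ih fun i => v i.succ)
    rwa [add_comm, ← Nat.cast_succ] at this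

/-- A smooth function with bounded derivatives that decays, with its derivatives, like a symbol of
order `-d`, is a symbol of every order between `-d` and `0`. -/
lemma of_decay (hφ : ContDiff ℝ (⊤ : ℕ∞) φ) {c d : ℝ} (hc : 0 ≤ c) (hcd : c ≤ d)
    (h0 : ∀ k : ℕ, ∃ C : ℝ, ∀ x, ‖iteratedFDeriv ℝ k φ x‖ ≤ C)
    (h1 : ∀ k : ℕ, ∃ C : ℝ, ∀ x, x ≠ 0 → ‖iteratedFDeriv ℝ k φ x‖ ≤ C * ‖x‖ ^ (-d - k)) :
    IsSymbol (-c) φ := by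
  refine ⟨hφ.contDiffOn, fun k => ?_⟩
  obtain ⟨A, hA⟩ := h0 k
  obtain ⟨B, hB⟩ := h1 k
  refine ⟨max |A| |B|, by positivity, fun x hx => ?_⟩
  have hxn : 0 < ‖x‖ := norm_pos_iff.2 hx
  rw [iteratedFDerivWithin_of_isOpen k isOpen_compl_singleton hx]
  have h2 : ‖iteratedFDeriv ℝ k φ x‖ ≤ max |A| |B| * min 1 (‖x‖ ^ (-(d + k))) := by
    rcases min_choice 1 (‖x‖ ^ (-(d + k))) with h | h
    · rw [h, mul_one]
      exact (hA x).trans ((le_abs_self A).trans (le_max_left _ _))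
    · rw [h, show -(d + k) = -d - (k : ℝ) by ring]
      refine (hB x hx).trans ?_
      gcongr
      exact (le_abs_self B).trans (le_max_right _ _)
  refine h2.trans ?_
  rw [show -c - (k : ℝ) = -(c + k) by ring]
  gcongr
  exact rpow_neg_le_of_le_of_le hxn (by positivity) (by linarith)

lemma of_schwartz (φ : 𝓢(EuclideanSpace ℝ (Fin n), ℂ)) {c : ℝ} (hc : 0 ≤ c) : IsSymbol (-c) φ := by
  obtain ⟨N, hN⟩ := exists_nat_ge c
  refine of_decay (φ.smooth _) hc hN (fun k => ?_) fun k => ?_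
  · obtain ⟨C, hC⟩ := φ.decay 0 k
    exact ⟨C, fun x => by simpa using hC.2 x⟩
  · obtain ⟨C, hC⟩ := φ.decay (N + k) k
    refine ⟨C, fun x hx => ?_⟩
    have hxn : 0 < ‖x‖ := norm_pos_iff.2 hx
    rw [show -(N : ℝ) - k = -((N + k : ℕ) : ℝ) by push_cast; ring, Real.rpow_neg hxn.le,
      Real.rpow_natCast, ← div_eq_mul_inv, le_div_iff₀ (by positivity), mul_comm]
    exact hC.2 x

end IsSymbol

/-! ### Central differences -/

/-- The central difference of order `2l` and step `y`:
`∑ₖ (-1)ᵏ (2l choose k) φ(x + (k - l) y)`. -/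
noncomputable def centralDiff {n : ℕ} (l : ℕ) (y : EuclideanSpace ℝ (Fin n))
    (φ : EuclideanSpace ℝ (Fin n) → ℂ) (x : EuclideanSpace ℝ (Fin n)) : ℂ :=
  ∑ k ∈ Finset.range (2 * l + 1),
    ((-1 : ℂ) ^ k * ((2 * l).choose k : ℂ)) * φ (x + ((k : ℝ) - l) • y)

/-- Iterated differences of a function of one variable are bounded by its highest derivative; the
sequence `Q` lists the successive derivatives. -/
lemma norm_fwdDiff_iter_le {m : ℕ} {a M : ℝ} {Q : ℕ → ℝ → ℂ}
    (hQ : ∀ k < m, ∀ t ∈ Set.Icc a (a + m), HasDerivAt (Q k) (Q (k + 1) t) t)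
    (hM : ∀ t ∈ Set.Icc a (a + m), ‖Q m t‖ ≤ M) :
    ‖(fwdDiff (1 : ℝ))^[m] (Q 0) a‖ ≤ M := by
  induction m generalizing Q with
  | zero => simpa using hM a (by simp)
  | succ m ih =>
    have hsub : ∀ t ∈ Set.Icc a (a + m), t ∈ Set.Icc a (a + (m + 1 : ℕ)) ∧
        t + 1 ∈ Set.Icc a (a + (m + 1 : ℕ)) := fun t ht => by
      push_cast
      exact ⟨⟨ht.1, by linarith [ht.2]⟩, by linarith [ht.1], by linarith [ht.2]⟩
    rw [Function.iterate_succ_apply]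
    refine ih (Q := fun k => fwdDiff (1 : ℝ) (Q k)) (fun k hk t ht => ?_) fun t ht => ?_
    · have h1 := hQ k (by omega) t (hsub t ht).1
      have h2 := hQ k (by omega) (t + 1) (hsub t ht).2
      exact (h2.comp_add_const t 1).sub h1
    · have h3 := norm_image_sub_le_of_norm_deriv_le_segment' (f := Q m) (f' := Q (m + 1)) (C := M)
        (a := t) (b := t + 1) (fun z hz => (hQ m (by omega) z
          ⟨(hsub t ht).1.1.trans hz.1, hz.2.trans (hsub t ht).2.2⟩).hasDerivWithinAt)
        (fun z hz => hM z ⟨(hsub t ht).1.1.trans hz.1, hz.2.le.trans (hsub t ht).2.2⟩) (t + 1)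
        (Set.right_mem_Icc.2 (by linarith))
      simpa [fwdDiff] using h3

lemma rpow_le_two_rpow_abs_mul {r R e : ℝ} (hR : 0 < R) (h1 : R / 2 ≤ r) (h2 : r ≤ 2 * R) :
    r ^ e ≤ 2 ^ |e| * R ^ e := by
  have hr : 0 < r := (half_pos hR).trans_le h1
  rcases le_total 0 e with he | he
  · rw [abs_of_nonneg he, ← Real.mul_rpow (by norm_num) hR.le]
    exact Real.rpow_le_rpow hr.le h2 he
  · rw [abs_of_nonpos he, Real.rpow_neg (by norm_num), ← Real.inv_rpow (by norm_num),
      ← Real.mul_rpow (by norm_num) hR.le]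
    exact Real.rpow_le_rpow_of_nonpos (by positivity) (by linarith) he

section

variable {n : ℕ} {s : ℝ} {φ : EuclideanSpace ℝ (Fin n) → ℂ}

lemma centralDiff_eq_fwdDiff_iter (l : ℕ) (y x : EuclideanSpace ℝ (Fin n)) :
    centralDiff l y φ x = (fwdDiff (1 : ℝ))^[2 * l] (fun t : ℝ => φ (x + t • y)) (-l) := by
  rw [fwdDiff_iter_eq_sum_shift, centralDiff]
  refine Finset.sum_congr rfl fun k hk => ?_
  have hk : k ≤ 2 * l := Nat.lt_succ_iff.1 (Finset.mem_range.1 hk)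
  have h1 : (-1 : ℤ) ^ (2 * l - k) = (-1) ^ k := by
    rcases Nat.even_or_odd k with h | h
    · rw [h.neg_one_pow, Even.neg_one_pow (by grind)]
    · rw [h.neg_one_pow, Odd.neg_one_pow (by grind)]
  rw [h1, zsmul_eq_mul]
  push_cast
  congr 3
  simp
  ring_nf

/-- As long as the difference stays away from the origin, it is controlled by the derivative of order
`2l` on the segment it samples. -/
lemma IsSymbol.exists_norm_centralDiff_le (h : IsSymbol s φ) (l : ℕ) :
    ∃ C : ℝ, 0 ≤ C ∧ ∀ x y : EuclideanSpace ℝ (Fin n), x ≠ 0 → 2 * l * ‖y‖ ≤ ‖x‖ →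
      ‖centralDiff l y φ x‖ ≤ C * ‖y‖ ^ (2 * l) * ‖x‖ ^ (s - (2 * l : ℕ)) := by
  obtain ⟨C, hC, hC'⟩ := h.bound (2 * l)
  refine ⟨C * 2 ^ |s - (2 * l : ℕ)|, by positivity, fun x y hx hxy => ?_⟩
  have hxn : 0 < ‖x‖ := norm_pos_iff.2 hx
  set U : Set (EuclideanSpace ℝ (Fin n)) := {0}ᶜ with hU
  have hUo : IsOpen U := isOpen_compl_singleton
  rw [centralDiff_eq_fwdDiff_iter]
  have hseg : ∀ t ∈ Set.Icc (-(l : ℝ)) (-l + (2 * l : ℕ)),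
      ‖x‖ / 2 ≤ ‖x + t • y‖ ∧ ‖x + t • y‖ ≤ 2 * ‖x‖ := by
    intro t ht
    have ht' : |t| ≤ l := abs_le.2 ⟨ht.1, by have := ht.2; push_cast at this; linarith⟩
    have h1 : ‖t • y‖ ≤ ‖x‖ / 2 := by
      rw [norm_smul, Real.norm_eq_abs]
      have : |t| * ‖y‖ ≤ l * ‖y‖ := by gcongr
      linarith
    have h2 := norm_sub_le (x + t • y) (t • y)
    rw [add_sub_cancel_right] at h2
    exact ⟨by linarith, by linarith [norm_add_le x (t • y)]⟩
  have hmem : ∀ t ∈ Set.Icc (-(l : ℝ)) (-l + (2 * l : ℕ)), x + t • y ∈ U := fun t ht h0 => by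
    have := (hseg t ht).1
    rw [Set.mem_singleton_iff.1 h0, norm_zero] at this
    linarith
  have key := norm_fwdDiff_iter_le (m := 2 * l) (a := -(l : ℝ))
    (Q := fun k t => iteratedFDerivWithin ℝ k φ U (x + t • y) fun _ => y)
    (M := C * 2 ^ |s - (2 * l : ℕ)| * ‖y‖ ^ (2 * l) * ‖x‖ ^ (s - (2 * l : ℕ))) ?_ ?_
  · simpa using key
  · intro k hk t ht
    have hm := hmem t ht
    have h1 : DifferentiableAt ℝ (iteratedFDerivWithin ℝ k φ U) (x + t • y) :=
      ((h.contDiffOn.differentiableOn_iteratedFDerivWithin (m := k)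
        (by exact_mod_cast WithTop.coe_lt_top k) hUo.uniqueDiffOn) _ hm).differentiableAt
        (hUo.mem_nhds hm)
    have h2 : HasDerivAt (fun t : ℝ => x + t • y) y t := by
      simpa using ((hasDerivAt_id t).smul_const y).const_add x
    have h3 := h1.hasFDerivAt.comp_hasDerivAt t h2
    have h4 := (ContinuousMultilinearMap.apply ℝ
      (fun _ : Fin k => EuclideanSpace ℝ (Fin n)) ℂ (fun _ => y)).hasFDerivAt.comp_hasDerivAt t h3
    refine h4.congr_deriv ?_
    rw [iteratedFDerivWithin_succ_apply_left, fderivWithin_of_isOpen hUo hm]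
    rfl
  · intro t ht
    refine (ContinuousMultilinearMap.le_opNorm _ _).trans ?_
    rw [Finset.prod_const, Finset.card_univ, Fintype.card_fin]
    calc _ ≤ C * ‖x + t • y‖ ^ (s - (2 * l : ℕ)) * ‖y‖ ^ (2 * l) := by
          gcongr
          exact hC' _ (hmem t ht)
      _ ≤ C * (2 ^ |s - (2 * l : ℕ)| * ‖x‖ ^ (s - (2 * l : ℕ))) * ‖y‖ ^ (2 * l) := by
          gcongr
          exact rpow_le_two_rpow_abs_mul hxn (hseg t ht).1 (hseg t ht).2
      _ = _ := by ring

lemma enorm_centralDiff_le (l : ℕ) (y x : EuclideanSpace ℝ (Fin n)) :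
    ‖centralDiff l y φ x‖ₑ ≤ ∑ k ∈ Finset.range (2 * l + 1),
      ((2 * l).choose k : ENNReal) * ‖φ (x + ((k : ℝ) - l) • y)‖ₑ := by
  refine (enorm_sum_le _ _).trans (Finset.sum_le_sum fun k _ => ?_)
  rw [enorm_mul, enorm_mul]
  gcongr
  rw [← ofReal_norm, ← ofReal_norm, norm_pow, norm_neg, norm_one, one_pow,
    ENNReal.ofReal_one, one_mul, Complex.norm_natCast, ENNReal.ofReal_natCast]

/-- The Fourier multiplier of a central difference. -/
lemma sum_choose_mul_exp (l : ℕ) (θ : ℝ) :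
    ∑ k ∈ Finset.range (2 * l + 1), ((-1 : ℂ) ^ k * ((2 * l).choose k : ℂ)) *
      (Real.fourierChar (((k : ℝ) - l) * θ) : ℂ) =
      (-1 : ℂ) ^ l * (((2 * Real.sin (Real.pi * θ)) ^ (2 * l) : ℝ) : ℂ) := by
  set z : ℂ := Complex.exp (Real.pi * θ * Complex.I) with hz
  set w : ℂ := Complex.exp (-(Real.pi * θ * Complex.I)) with hw
  have hzw : z * w = 1 := by rw [hz, hw, ← Complex.exp_add, add_neg_cancel, Complex.exp_zero]
  have h1 : (z + -w) ^ (2 * l) = ∑ k ∈ Finset.range (2 * l + 1),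
      ((-1 : ℂ) ^ k * ((2 * l).choose k : ℂ)) * (Real.fourierChar (((k : ℝ) - l) * θ) : ℂ) := by
    rw [add_pow]
    refine Finset.sum_congr rfl fun k hk => ?_
    have hk : k ≤ 2 * l := Nat.lt_succ_iff.1 (Finset.mem_range.1 hk)
    have h2 : (-w) ^ (2 * l - k) = (-1) ^ k * w ^ (2 * l - k) := by
      rcases Nat.even_or_odd k with h | h
      · rw [h.neg_one_pow, Even.neg_pow (by grind), one_mul]
      · rw [h.neg_one_pow, Odd.neg_pow (by grind), neg_one_mul]
    have h3 : z ^ k * w ^ (2 * l - k) = (Real.fourierChar (((k : ℝ) - l) * θ) : ℂ) := by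
      rw [Real.fourierChar_apply, hz, hw, ← Complex.exp_nat_mul, ← Complex.exp_nat_mul,
        ← Complex.exp_add, Nat.cast_sub hk]
      congr 1
      push_cast
      ring
    rw [h2, ← h3]
    ring
  rw [← h1]
  have h4 : z + -w = 2 * Complex.sin (Real.pi * θ) * Complex.I := by
    rw [Complex.sin, neg_mul, hz, hw]
    linear_combination (-(Complex.exp (-(Real.pi * θ * Complex.I)) -
      Complex.exp (Real.pi * θ * Complex.I))) * Complex.I_mul_I
  rw [h4, mul_pow, pow_mul Complex.I, Complex.I_sq]
  push_cast
  ring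

end

/-! ### Decay of the Fourier transform of a symbol -/

section

variable {n : ℕ} {s : ℝ} {G : EuclideanSpace ℝ (Fin n) → ℂ}

lemma fourier_centralDiff (hG : Integrable G) (l : ℕ) (y x : EuclideanSpace ℝ (Fin n)) :
    𝓕 (centralDiff l y G) x =
      (-1 : ℂ) ^ l * (((2 * Real.sin (Real.pi * inner ℝ y x)) ^ (2 * l) : ℝ) : ℂ) * 𝓕 G x := by
  have h1 : ∀ c : ℝ, ∫ v, (Real.fourierChar (-inner ℝ v x) : ℂ) * G (v + c • y) =
      (Real.fourierChar (c * inner ℝ y x) : ℂ) * 𝓕 G x := by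
    intro c
    have h2 := congrFun (VectorFourier.fourierIntegral_comp_add_right Real.fourierChar volume
      (innerₗ (EuclideanSpace ℝ (Fin n))) G (c • y)) x
    simp only [innerₗ_apply_apply, real_inner_smul_left] at h2
    exact h2
  have hI : ∀ c : ℝ, Integrable fun v => (Real.fourierChar (-inner ℝ v x) : ℂ) * G (v + c • y) :=
    fun c => (Real.fourierIntegral_convergent_iff x).2 (hG.comp_add_right (c • y))
  rw [← sum_choose_mul_exp, Real.fourier_eq, Finset.sum_mul]
  simp_rw [Circle.smul_def, smul_eq_mul, centralDiff, Finset.mul_sum]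
  rw [integral_finsetSum]
  · refine Finset.sum_congr rfl fun k _ => ?_
    rw [mul_assoc, ← h1, ← integral_const_mul]
    refine integral_congr_ae (Filter.Eventually.of_forall fun v => ?_)
    simp only
    ring
  · intro k _
    refine ((hI ((k : ℝ) - l)).const_mul ((-1 : ℂ) ^ k * ((2 * l).choose k : ℂ))).congr
      (Filter.Eventually.of_forall fun v => ?_)
    simp only
    ring

lemma setLIntegral_closedBall_comp_add_le (g : EuclideanSpace ℝ (Fin n) → ENNReal) (R : ℝ)
    (v : EuclideanSpace ℝ (Fin n)) :
    ∫⁻ x in Metric.closedBall 0 R, g (x + v) ≤ ∫⁻ x in Metric.closedBall 0 (R + ‖v‖), g x := by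
  rw [← lintegral_indicator Metric.isClosed_closedBall.measurableSet,
    ← lintegral_indicator Metric.isClosed_closedBall.measurableSet,
    ← lintegral_add_right_eq_self ((Metric.closedBall 0 (R + ‖v‖)).indicator g) v]
  refine lintegral_mono fun x => ?_
  by_cases hx : x ∈ Metric.closedBall 0 R
  · rw [Set.indicator_of_mem hx, Set.indicator_of_mem]
    rw [mem_closedBall_zero_iff] at hx ⊢
    exact (norm_add_le x v).trans (by gcongr)
  · rw [Set.indicator_of_notMem hx]
    exact zero_le

lemma IsSymbol.exists_setLIntegral_enorm_le [NeZero n] (h : IsSymbol s G) (hs : -n < s) :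
    ∃ C : ℝ, 0 ≤ C ∧ ∀ R : ℝ, 0 < R →
      ∫⁻ x in Metric.closedBall (0 : EuclideanSpace ℝ (Fin n)) R, ‖G x‖ₑ ≤
        ENNReal.ofReal (C * R ^ (s + n)) := by
  obtain ⟨A, hA, hA'⟩ := h.norm_le
  obtain ⟨B, hB, hB'⟩ := exists_setLIntegral_closedBall_rpow_norm_le (n := n) (t := s + n)
    (by linarith)
  have hne : ∀ᵐ x : EuclideanSpace ℝ (Fin n), x ≠ 0 :=
    compl_mem_ae_iff.2 (measure_singleton 0)
  refine ⟨A * B, by positivity, fun R hR => ?_⟩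
  calc _ ≤ ∫⁻ x in Metric.closedBall (0 : EuclideanSpace ℝ (Fin n)) R,
        ENNReal.ofReal A * ENNReal.ofReal (‖x‖ ^ (s + n - n)) := by
        refine lintegral_mono_ae (ae_restrict_of_ae (hne.mono fun x hx => ?_))
        rw [← ENNReal.ofReal_mul hA, add_sub_cancel_right, ← ofReal_norm]
        exact ENNReal.ofReal_le_ofReal (hA' x hx)
    _ ≤ ENNReal.ofReal A * ENNReal.ofReal (B * R ^ (s + n)) := by
        rw [lintegral_const_mul' _ _ ENNReal.ofReal_ne_top]
        gcongr
        exact hB' R hR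
    _ = _ := by rw [← ENNReal.ofReal_mul hA, mul_assoc]

lemma setLIntegral_centralDiff_le [NeZero n] (h : IsSymbol s G) (R : ℝ) (l : ℕ)
    (y : EuclideanSpace ℝ (Fin n)) :
    ∫⁻ x in Metric.closedBall (0 : EuclideanSpace ℝ (Fin n)) R, ‖centralDiff l y G x‖ₑ ≤
      (2 ^ (2 * l) : ℕ) * ∫⁻ x in Metric.closedBall (0 : EuclideanSpace ℝ (Fin n)) (R + l * ‖y‖),
        ‖G x‖ₑ := by
  refine (lintegral_mono fun x => enorm_centralDiff_le l y x).trans ?_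
  rw [lintegral_finsetSum' _ fun k _ => ?_]
  · rw [← Nat.sum_range_choose, Nat.cast_sum, Finset.sum_mul]
    refine Finset.sum_le_sum fun k hk => ?_
    have hk : k ≤ 2 * l := Nat.lt_succ_iff.1 (Finset.mem_range.1 hk)
    rw [lintegral_const_mul' _ _ (by finiteness)]
    refine mul_le_mul' le_rfl ?_
    refine (setLIntegral_closedBall_comp_add_le (fun x => ‖G x‖ₑ) R _).trans
      (lintegral_mono_set (Metric.closedBall_subset_closedBall ?_))
    rw [norm_smul, Real.norm_eq_abs]
    have hk' : (k : ℝ) ≤ 2 * l := by exact_mod_cast hk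
    have : |(k : ℝ) - l| ≤ l := abs_le.2 ⟨by linarith [Nat.cast_nonneg (α := ℝ) k], by linarith⟩
    gcongr
  · exact ((h.aestronglyMeasurable.comp_quasiMeasurePreserving
      (measurePreserving_add_right volume _).quasiMeasurePreserving).enorm.const_mul _).restrict

/-- The `L¹` norm of a central difference of a symbol: inside a ball of radius comparable to the
step the size of the symbol is used, outside of it the bound by derivatives. -/
lemma IsSymbol.exists_lintegral_centralDiff_le [NeZero n] (h : IsSymbol s G) (hs : -n < s) {l : ℕ}
    (hl : s + n < 2 * l) :
    ∃ C : ℝ, 0 ≤ C ∧ ∀ y : EuclideanSpace ℝ (Fin n), y ≠ 0 →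
      ∫⁻ x, ‖centralDiff l y G x‖ₑ ≤ ENNReal.ofReal (C * ‖y‖ ^ (s + n)) := by
  obtain ⟨A, hA, hA'⟩ := h.exists_setLIntegral_enorm_le hs
  obtain ⟨B, hB, hB'⟩ := h.exists_norm_centralDiff_le l
  obtain ⟨D, hD, hD'⟩ := exists_setLIntegral_compl_closedBall_rpow_norm_le (n := n)
    (t := 2 * l - s - n) (by linarith)
  have hl0 : (0 : ℝ) < l := by linarith
  have hne : ∀ᵐ x : EuclideanSpace ℝ (Fin n), x ≠ 0 :=
    compl_mem_ae_iff.2 (measure_singleton 0)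
  refine ⟨2 ^ (2 * l) * (A * (3 * l) ^ (s + n)) + B * D * (2 * l) ^ (s + n - 2 * l), by positivity,
    fun y hy => ?_⟩
  have hyn : 0 < ‖y‖ := norm_pos_iff.2 hy
  set R : ℝ := 2 * l * ‖y‖ with hR
  have hR0 : 0 < R := by positivity
  rw [← lintegral_add_compl _ (Metric.isClosed_closedBall.measurableSet :
    MeasurableSet (Metric.closedBall (0 : EuclideanSpace ℝ (Fin n)) R)), add_mul,
    ENNReal.ofReal_add (by positivity) (by positivity)]
  refine add_le_add ?_ ?_
  · refine (setLIntegral_centralDiff_le h R l y).trans ?_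
    calc _ ≤ ((2 ^ (2 * l) : ℕ) : ENNReal) * ENNReal.ofReal (A * (R + l * ‖y‖) ^ (s + n)) := by
          gcongr
          exact hA' _ (by positivity)
      _ = _ := by
          rw [← ENNReal.ofReal_natCast, ← ENNReal.ofReal_mul (by positivity), hR,
            show 2 * l * ‖y‖ + l * ‖y‖ = 3 * l * ‖y‖ by ring,
            Real.mul_rpow (by positivity) hyn.le]
          push_cast
          ring_nf
  · calc _ ≤ ∫⁻ x in (Metric.closedBall (0 : EuclideanSpace ℝ (Fin n)) R)ᶜ,
          ENNReal.ofReal (B * ‖y‖ ^ (2 * l)) * ENNReal.ofReal (‖x‖ ^ (-(2 * l - s - n) - n)) := by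
          refine setLIntegral_mono' Metric.isClosed_closedBall.measurableSet.compl fun x hx => ?_
          have hx' : R < ‖x‖ := by simpa using hx
          rw [← ENNReal.ofReal_mul (by positivity), ← ofReal_norm]
          refine ENNReal.ofReal_le_ofReal ((hB' x y (norm_pos_iff.1 (hR0.trans hx')) hx'.le).trans
            (le_of_eq ?_))
          congr 2
          push_cast
          ring
      _ ≤ ENNReal.ofReal (B * ‖y‖ ^ (2 * l)) * ENNReal.ofReal (D * R ^ (-(2 * l - s - n))) := by
          rw [lintegral_const_mul' _ _ ENNReal.ofReal_ne_top]
          gcongr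
          exact hD' R hR0
      _ = _ := by
          rw [← ENNReal.ofReal_mul (by positivity), hR, Real.mul_rpow (by positivity) hyn.le,
            show -(2 * l - s - n) = s + n - 2 * l by ring]
          congr 1
          have : ‖y‖ ^ (2 * l) * ‖y‖ ^ (s + n - 2 * l) = ‖y‖ ^ (s + n) := by
            rw [← Real.rpow_natCast, ← Real.rpow_add hyn]
            congr 1
            push_cast
            ring
          rw [← this]
          ring

/-- The Fourier transform of an integrable symbol of order `s > -n` is `O(|x|^{-n-s})`. The
difference of `G` with step `x / (2|x|²)` has Fourier transform `± 4ˡ 𝓕 G` at `x`. -/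
lemma IsSymbol.exists_norm_fourier_le [NeZero n] (h : IsSymbol s G) (hs : -n < s)
    (hG : Integrable G) :
    ∃ C : ℝ, 0 ≤ C ∧ ∀ x, x ≠ 0 → ‖𝓕 G x‖ ≤ C * ‖x‖ ^ (-n - s) := by
  obtain ⟨l, hl⟩ := exists_nat_gt (s + n)
  obtain ⟨C, hC, hC'⟩ := h.exists_lintegral_centralDiff_le hs (l := l)
    (by linarith [Nat.cast_nonneg (α := ℝ) l])
  refine ⟨C * (1 / 2) ^ (s + n), by positivity, fun x hx => ?_⟩
  have hxn : 0 < ‖x‖ := norm_pos_iff.2 hx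
  set y : EuclideanSpace ℝ (Fin n) := (1 / (2 * ‖x‖ ^ 2)) • x with hy
  have hy0 : y ≠ 0 := smul_ne_zero (by positivity) hx
  have hyx : inner ℝ y x = 1 / 2 := by
    rw [hy, real_inner_smul_left, real_inner_self_eq_norm_sq]
    field_simp
  have hyn : ‖y‖ = 1 / 2 * ‖x‖⁻¹ := by
    rw [hy, norm_smul, Real.norm_eq_abs, abs_of_pos (by positivity)]
    field_simp
  have h1 := fourier_centralDiff hG l y x
  rw [hyx, mul_one_div, Real.sin_pi_div_two] at h1
  have h2 : ‖𝓕 (centralDiff l y G) x‖ = 4 ^ l * ‖𝓕 G x‖ := by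
    rw [h1, norm_mul, norm_mul, norm_pow, norm_neg, norm_one, one_pow, one_mul, mul_one, pow_mul]
    norm_num
  have h3 : ‖𝓕 (centralDiff l y G) x‖ₑ ≤ ENNReal.ofReal (C * ‖y‖ ^ (s + n)) := by
    refine le_trans ?_ (hC' y hy0)
    refine (enorm_integral_le_lintegral_enorm _).trans (le_of_eq ?_)
    refine lintegral_congr fun v => ?_
    rw [Circle.smul_def, enorm_smul, ← ofReal_norm, Circle.norm_coe, ENNReal.ofReal_one, one_mul]
  rw [← ofReal_norm, ENNReal.ofReal_le_ofReal_iff (by positivity), h2] at h3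
  have h4 : ‖𝓕 G x‖ ≤ 4 ^ l * ‖𝓕 G x‖ :=
    le_mul_of_one_le_left (norm_nonneg _) (one_le_pow₀ (by norm_num))
  refine h4.trans (h3.trans (le_of_eq ?_))
  rw [hyn, Real.mul_rpow (by norm_num) (by positivity), Real.inv_rpow hxn.le, ← Real.rpow_neg hxn.le,
    show -(n : ℝ) - s = -(s + n) by ring, mul_assoc]

end

section

variable {n : ℕ} {s : ℝ} {G : EuclideanSpace ℝ (Fin n) → ℂ}

lemma norm_continuousMultilinearMap_le_sum {k : ℕ}
    (A : ContinuousMultilinearMap ℝ (fun _ : Fin k => EuclideanSpace ℝ (Fin n)) ℂ) :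
    ‖A‖ ≤ ∑ r : Fin k → Fin n, ‖A fun i => EuclideanSpace.basisFun (Fin n) ℝ (r i)‖ := by
  refine A.opNorm_le_bound (Finset.sum_nonneg fun r _ => norm_nonneg _) fun v => ?_
  have h1 : v = fun i => ∑ j, (v i) j • EuclideanSpace.basisFun (Fin n) ℝ j := by
    funext i
    simpa using ((EuclideanSpace.basisFun (Fin n) ℝ).sum_repr (v i)).symm
  conv_lhs => rw [h1]
  rw [A.map_sum, Finset.sum_mul]
  refine (norm_sum_le _ _).trans (Finset.sum_le_sum fun r _ => ?_)
  rw [A.map_smul_univ, norm_smul, mul_comm, norm_prod]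
  gcongr with i
  exact PiLp.norm_apply_le (v i) (r i)

lemma iteratedFDeriv_fourier_apply (hm : ∀ k : ℕ, Integrable fun ξ => ‖ξ‖ ^ k * ‖G ξ‖)
    (hG : AEStronglyMeasurable G volume) {k : ℕ} (v : Fin k → EuclideanSpace ℝ (Fin n))
    (x : EuclideanSpace ℝ (Fin n)) :
    iteratedFDeriv ℝ k (𝓕 G) x v =
      𝓕 (fun ξ => (-(2 * Real.pi * Complex.I)) ^ k * (∏ i, ((inner ℝ ξ (v i) : ℝ) : ℂ)) * G ξ) x := by
  rw [Real.iteratedFDeriv_fourier (N := ⊤) (fun k _ => hm k) hG (by exact_mod_cast le_top),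
    Real.fourier_continuousMultilinearMap_apply]
  · refine congrArg (fun f : EuclideanSpace ℝ (Fin n) → ℂ => 𝓕 f x) (funext fun ξ => ?_)
    rw [VectorFourier.fourierPowSMulRight_apply]
    simp only [smul_eq_mul, Complex.real_smul, Complex.ofReal_prod, mul_assoc]
    rfl
  · exact VectorFourier.integrable_fourierPowSMulRight _ (hm k) hG

/-- The inverse Fourier transform of a symbol of order `s > -n` with finite moments is a symbol of
every order between `-n-s` and `0`. -/
lemma IsSymbol.fourierInv [NeZero n] (h : IsSymbol s G) (hs : -n < s)
    (hm : ∀ k : ℕ, Integrable fun ξ => ‖ξ‖ ^ k * ‖G ξ‖) {c : ℝ} (hc : 0 ≤ c) (hc' : c ≤ n + s) :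
    IsSymbol (-c) (𝓕⁻ G) := by
  have hG := h.aestronglyMeasurable
  have hF : ContDiff ℝ (⊤ : ℕ∞) (𝓕 G) := Real.contDiff_fourier fun k _ => hm k
  have hneg : 𝓕⁻ G = 𝓕 G ∘ LinearIsometryEquiv.neg ℝ := by
    funext x
    exact Real.fourierInv_eq_fourier_neg G x
  have hsym : ∀ {k : ℕ} (v : Fin k → EuclideanSpace ℝ (Fin n)), IsSymbol (s + k) fun ξ =>
      (-(2 * Real.pi * Complex.I)) ^ k * (∏ i, ((inner ℝ ξ (v i) : ℝ) : ℂ)) * G ξ := by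
    intro k v
    have := ((IsSymbol.const (n := n) ((-(2 * Real.pi * Complex.I)) ^ k)).mul
      (IsSymbol.prod_inner v)).mul h
    rwa [zero_add, add_comm] at this
  have hint : ∀ {k : ℕ} (v : Fin k → EuclideanSpace ℝ (Fin n)), Integrable fun ξ =>
      (-(2 * Real.pi * Complex.I)) ^ k * (∏ i, ((inner ℝ ξ (v i) : ℝ) : ℂ)) * G ξ := by
    intro k v
    refine ((hm k).const_mul (‖(-(2 * Real.pi * Complex.I)) ^ k‖ * ∏ i, ‖v i‖)).mono'
      (hsym v).aestronglyMeasurable (Filter.Eventually.of_forall fun ξ => ?_)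
    rw [norm_mul, norm_mul, norm_prod]
    have : ∏ i, ‖((inner ℝ ξ (v i) : ℝ) : ℂ)‖ ≤ ∏ i, (‖ξ‖ * ‖v i‖) := by
      gcongr with i
      rw [Complex.norm_real]
      exact norm_inner_le_norm _ _
    rw [Finset.prod_mul_distrib, Finset.prod_const, Finset.card_univ, Fintype.card_fin] at this
    calc _ ≤ ‖(-(2 * Real.pi * Complex.I)) ^ k‖ * (‖ξ‖ ^ k * ∏ i, ‖v i‖) * ‖G ξ‖ := by gcongr
      _ = _ := by ring
  rw [hneg]
  refine IsSymbol.of_decay (d := n + s) (hF.comp (LinearIsometryEquiv.contDiff _)) hc hc'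
    (fun k => ?_) fun k => ?_
  · refine ⟨∑ r : Fin k → Fin n, ∫ ξ, ‖(-(2 * Real.pi * Complex.I)) ^ k * (∏ i,
      ((inner ℝ ξ (EuclideanSpace.basisFun (Fin n) ℝ (r i)) : ℝ) : ℂ)) * G ξ‖, fun x => ?_⟩
    rw [LinearIsometryEquiv.norm_iteratedFDeriv_comp_right]
    refine (norm_continuousMultilinearMap_le_sum _).trans (Finset.sum_le_sum fun r _ => ?_)
    rw [iteratedFDeriv_fourier_apply hm hG]
    exact VectorFourier.norm_fourierIntegral_le_integral_norm _ _ _ _ _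
  · choose C hC hC' using fun r : Fin k → Fin n =>
      (hsym fun i => EuclideanSpace.basisFun (Fin n) ℝ (r i)).exists_norm_fourier_le
        (by linarith [Nat.cast_nonneg (α := ℝ) k]) (hint _)
    refine ⟨∑ r, C r, fun x hx => ?_⟩
    rw [LinearIsometryEquiv.norm_iteratedFDeriv_comp_right, Finset.sum_mul]
    refine (norm_continuousMultilinearMap_le_sum _).trans (Finset.sum_le_sum fun r _ => ?_)
    rw [iteratedFDeriv_fourier_apply hm hG]
    refine (hC' r _ (by simpa using hx)).trans (le_of_eq ?_)
    rw [LinearIsometryEquiv.norm_map]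
    ring_nf

end

/-! ### Hypersingular integrals of central differences -/

section

variable {n : ℕ} [NeZero n] {s b σ : ℝ} {φ : EuclideanSpace ℝ (Fin n) → ℂ}

/-- The contribution of large steps to one term of the hypersingular integral. -/
lemma IsSymbol.exists_setLIntegral_compl_ball_le (h : IsSymbol (-b) φ) (hb : 0 < b) (hbn : b < n)
    (hσ : 0 < σ) {L : ℝ} (hL : 0 < L) (c : ℝ) :
    ∃ C : ℝ, 0 ≤ C ∧ ∀ x : EuclideanSpace ℝ (Fin n), x ≠ 0 →
      ∫⁻ y in (Metric.closedBall (0 : EuclideanSpace ℝ (Fin n)) (‖x‖ / L))ᶜ,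
        ‖φ (x + c • y)‖ₑ * ENNReal.ofReal (‖y‖ ^ (-σ - n)) ≤
        ENNReal.ofReal (C * ‖x‖ ^ (-b - σ)) := by
  obtain ⟨A, hA, hA'⟩ := h.norm_le
  rcases eq_or_ne c 0 with rfl | hc
  · obtain ⟨D, hD, hD'⟩ := exists_setLIntegral_compl_closedBall_rpow_norm_le (n := n) hσ
    refine ⟨A * D * L ^ σ, by positivity, fun x hx => ?_⟩
    have hxn : 0 < ‖x‖ := norm_pos_iff.2 hx
    simp_rw [zero_smul, add_zero]
    rw [lintegral_const_mul' _ _ enorm_ne_top, ← ofReal_norm]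
    calc _ ≤ ENNReal.ofReal (A * ‖x‖ ^ (-b)) * ENNReal.ofReal (D * (‖x‖ / L) ^ (-σ)) := by
          gcongr
          · exact hA' x hx
          · exact hD' _ (by positivity)
      _ = _ := by
          rw [← ENNReal.ofReal_mul (by positivity), Real.div_rpow hxn.le hL.le,
            Real.rpow_neg hL.le, sub_eq_add_neg, Real.rpow_add hxn]
          congr 1
          field_simp
  · -- trading the power `σ + ε` of the step, which is at least `‖x‖ / L`, leaves a convolution of two
    -- powers of the norm; any `0 < ε < b` will do
    set ε : ℝ := b / 2 with hε
    have hε0 : 0 < ε := by positivity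
    obtain ⟨K, hK0, hcomp⟩ := exists_lintegral_rpow_norm_sub_mul_rpow_norm (n := n) (a := n - b)
      (b := ε) (by linarith) hε0 (by rw [hε]; linarith)
    refine ⟨A * |c| ^ (-b) * K * |c|⁻¹ ^ (ε - b) * L ^ (σ + ε), by positivity, fun x hx => ?_⟩
    have hxn : 0 < ‖x‖ := norm_pos_iff.2 hx
    have hc0 : 0 < |c| := abs_pos.2 hc
    set z : EuclideanSpace ℝ (Fin n) := (-c⁻¹) • x with hz
    have hz0 : z ≠ 0 := smul_ne_zero (neg_ne_zero.2 (inv_ne_zero hc)) hx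
    have hzn : ‖z‖ = |c|⁻¹ * ‖x‖ := by rw [hz, norm_smul, norm_neg, norm_inv, Real.norm_eq_abs]
    have hxy : ∀ y, x + c • y = (-c) • (z - y) := fun y => by
      rw [hz, smul_sub, smul_smul, neg_mul_neg, mul_inv_cancel₀ hc, one_smul, neg_smul,
        sub_neg_eq_add]
    have hne : ∀ᵐ y : EuclideanSpace ℝ (Fin n), y ≠ z := compl_mem_ae_iff.2 (measure_singleton z)
    have key : ∀ᵐ y ∂(volume.restrict (Metric.closedBall (0 : EuclideanSpace ℝ (Fin n))
        (‖x‖ / L))ᶜ), ‖φ (x + c • y)‖ₑ * ENNReal.ofReal (‖y‖ ^ (-σ - n)) ≤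
        ENNReal.ofReal (A * |c| ^ (-b) * (‖x‖ / L) ^ (-(σ + ε))) *
          ENNReal.ofReal (‖z - y‖ ^ (n - b - n) * ‖y‖ ^ (ε - n)) := by
      filter_upwards [ae_restrict_of_ae hne,
        ae_restrict_mem Metric.isClosed_closedBall.measurableSet.compl] with y hyz hy
      have hy' : ‖x‖ / L < ‖y‖ := by simpa using hy
      have hr0 : 0 < ‖x‖ / L := by positivity
      have hyn : 0 < ‖y‖ := hr0.trans hy'
      rw [← ofReal_norm, ← ENNReal.ofReal_mul (norm_nonneg _), ← ENNReal.ofReal_mul (by positivity)]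
      refine ENNReal.ofReal_le_ofReal ?_
      have h1 : ‖φ (x + c • y)‖ ≤ A * (|c| ^ (-b) * ‖z - y‖ ^ (n - b - n)) := by
        rw [show (n : ℝ) - b - n = -b by ring, ← Real.mul_rpow hc0.le (norm_nonneg _)]
        refine (hA' _ ?_).trans (le_of_eq ?_)
        · rw [hxy]
          exact smul_ne_zero (neg_ne_zero.2 hc) (sub_ne_zero.2 hyz.symm)
        · rw [hxy, norm_smul, norm_neg, Real.norm_eq_abs]
      have h2 : ‖y‖ ^ (-σ - n) ≤ (‖x‖ / L) ^ (-(σ + ε)) * ‖y‖ ^ (ε - n) := by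
        rw [show -σ - (n : ℝ) = -(σ + ε) + (ε - n) by ring, Real.rpow_add hyn]
        gcongr ?_ * _
        exact Real.rpow_le_rpow_of_nonpos hr0 hy'.le (by linarith)
      calc _ ≤ (A * (|c| ^ (-b) * ‖z - y‖ ^ (n - b - n))) *
            ((‖x‖ / L) ^ (-(σ + ε)) * ‖y‖ ^ (ε - n)) := by gcongr
        _ = _ := by ring
    refine (lintegral_mono_ae key).trans ?_
    rw [lintegral_const_mul' _ _ ENNReal.ofReal_ne_top]
    refine (mul_le_mul' le_rfl (setLIntegral_le_lintegral _ _)).trans ?_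
    rw [hcomp z hz0, ← ENNReal.ofReal_mul (by positivity)]
    refine ENNReal.ofReal_le_ofReal (le_of_eq ?_)
    rw [hzn, Real.mul_rpow (by positivity) hxn.le, show (n : ℝ) - b + ε - n = ε - b by ring,
      Real.div_rpow hxn.le hL.le, Real.rpow_neg hL.le (σ + ε),
      show -b - σ = -(σ + ε) + (ε - b) by ring, Real.rpow_add hxn]
    field_simp

/-- The hypersingular integral of a symbol of order `-b` converges absolutely away from the origin
and is of size `|x|^{-b-σ}`. -/
lemma IsSymbol.exists_lintegral_centralDiff_mul_le (h : IsSymbol (-b) φ) (hb : 0 < b) (hbn : b < n)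
    (hσ : 0 < σ) {l : ℕ} (hl : σ < 2 * l) :
    ∃ C : ℝ, 0 ≤ C ∧ ∀ x : EuclideanSpace ℝ (Fin n), x ≠ 0 →
      ∫⁻ y, ‖centralDiff l y φ x‖ₑ * ENNReal.ofReal (‖y‖ ^ (-σ - n)) ≤
        ENNReal.ofReal (C * ‖x‖ ^ (-b - σ)) := by
  have hl0 : (0 : ℝ) < 2 * l := hσ.trans hl
  obtain ⟨B, hB, hB'⟩ := h.exists_norm_centralDiff_le l
  obtain ⟨D, hD, hD'⟩ := exists_setLIntegral_closedBall_rpow_norm_le (n := n) (t := 2 * l - σ)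
    (by linarith)
  -- small steps: the difference is bounded by derivatives; large steps: term by term
  choose C hC hC' using fun k : ℕ =>
    h.exists_setLIntegral_compl_ball_le hb hbn hσ hl0 ((k : ℝ) - l)
  refine ⟨B * D * (2 * l) ^ (σ - 2 * l) +
    ∑ k ∈ Finset.range (2 * l + 1), ((2 * l).choose k : ℝ) * C k, ?_, fun x hx => ?_⟩
  · have := fun k (_ : k ∈ Finset.range (2 * l + 1)) =>
      mul_nonneg (Nat.cast_nonneg (α := ℝ) ((2 * l).choose k)) (hC k)
    have := Finset.sum_nonneg this
    positivity
  have hxn : 0 < ‖x‖ := norm_pos_iff.2 hx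
  set r : ℝ := ‖x‖ / (2 * l) with hr
  have hr0 : 0 < r := by positivity
  have hsum : 0 ≤ ∑ k ∈ Finset.range (2 * l + 1), ((2 * l).choose k : ℝ) * C k :=
    Finset.sum_nonneg fun k _ => mul_nonneg (Nat.cast_nonneg _) (hC k)
  have hne : ∀ᵐ y : EuclideanSpace ℝ (Fin n), y ≠ 0 := compl_mem_ae_iff.2 (measure_singleton 0)
  rw [← lintegral_add_compl _ (Metric.isClosed_closedBall.measurableSet :
    MeasurableSet (Metric.closedBall (0 : EuclideanSpace ℝ (Fin n)) r)), add_mul,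
    ENNReal.ofReal_add (by positivity) (by positivity)]
  refine add_le_add ?_ ?_
  · have key : ∀ᵐ y ∂(volume.restrict (Metric.closedBall (0 : EuclideanSpace ℝ (Fin n)) r)),
        ‖centralDiff l y φ x‖ₑ * ENNReal.ofReal (‖y‖ ^ (-σ - n)) ≤
        ENNReal.ofReal (B * ‖x‖ ^ (-b - (2 * l : ℕ))) *
          ENNReal.ofReal (‖y‖ ^ (2 * l - σ - n)) := by
      filter_upwards [ae_restrict_of_ae hne,
        ae_restrict_mem Metric.isClosed_closedBall.measurableSet] with y hy0 hy
      have hyn : 0 < ‖y‖ := norm_pos_iff.2 hy0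
      have hy' : ‖y‖ ≤ r := by simpa using hy
      rw [← ofReal_norm, ← ENNReal.ofReal_mul (norm_nonneg _), ← ENNReal.ofReal_mul (by positivity)]
      refine ENNReal.ofReal_le_ofReal ?_
      have h1 := hB' x y hx (by rw [hr, le_div_iff₀ hl0] at hy'; linarith)
      have h2 : ‖y‖ ^ (2 * l - σ - n) = ‖y‖ ^ (2 * l) * ‖y‖ ^ (-σ - n) := by
        rw [← Real.rpow_natCast, ← Real.rpow_add hyn]
        congr 1
        push_cast
        ring
      calc _ ≤ (B * ‖y‖ ^ (2 * l) * ‖x‖ ^ (-b - (2 * l : ℕ))) * ‖y‖ ^ (-σ - n) := by gcongr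
        _ = _ := by rw [h2]; ring
    refine (lintegral_mono_ae key).trans ?_
    rw [lintegral_const_mul' _ _ ENNReal.ofReal_ne_top]
    refine (mul_le_mul' le_rfl (hD' r hr0)).trans ?_
    rw [← ENNReal.ofReal_mul (by positivity)]
    refine ENNReal.ofReal_le_ofReal (le_of_eq ?_)
    rw [hr, Real.div_rpow hxn.le hl0.le, show σ - 2 * (l : ℝ) = -(2 * l - σ) by ring,
      Real.rpow_neg hl0.le, show -b - σ = (-b - (2 * l : ℕ)) + (2 * l - σ) by push_cast; ring,
      Real.rpow_add hxn]
    field_simp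
  · calc _ ≤ ∫⁻ y in (Metric.closedBall (0 : EuclideanSpace ℝ (Fin n)) r)ᶜ,
          ∑ k ∈ Finset.range (2 * l + 1), ((2 * l).choose k : ENNReal) *
            (‖φ (x + ((k : ℝ) - l) • y)‖ₑ * ENNReal.ofReal (‖y‖ ^ (-σ - n))) := by
          refine lintegral_mono fun y => ?_
          simp_rw [← mul_assoc]
          rw [← Finset.sum_mul]
          gcongr
          exact enorm_centralDiff_le l y x
      _ = ∑ k ∈ Finset.range (2 * l + 1), ((2 * l).choose k : ENNReal) *
          ∫⁻ y in (Metric.closedBall (0 : EuclideanSpace ℝ (Fin n)) r)ᶜ,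
            (‖φ (x + ((k : ℝ) - l) • y)‖ₑ * ENNReal.ofReal (‖y‖ ^ (-σ - n))) := by
          have hmeas : ∀ c : ℝ, AEMeasurable (fun y => ‖φ (x + c • y)‖ₑ *
              ENNReal.ofReal (‖y‖ ^ (-σ - n))) volume := by
            intro c
            have h2 : AEMeasurable (fun y : EuclideanSpace ℝ (Fin n) =>
                ENNReal.ofReal (‖y‖ ^ (-σ - n))) volume := by fun_prop
            refine AEMeasurable.mul (M := ENNReal) ?_ h2
            rcases eq_or_ne c 0 with rfl | hc
            · simp
            · refine (h.aestronglyMeasurable.comp_quasiMeasurePreserving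
                ((measurePreserving_add_left volume x).quasiMeasurePreserving.comp ?_)).enorm
              exact ⟨by fun_prop, by
                rw [Measure.map_addHaar_smul volume hc]
                exact Measure.smul_absolutelyContinuous⟩
          rw [lintegral_finsetSum' _ fun k _ => ((hmeas _).const_mul _).restrict]
          refine Finset.sum_congr rfl fun k _ => ?_
          rw [lintegral_const_mul' _ _ (by finiteness)]
      _ ≤ ∑ k ∈ Finset.range (2 * l + 1), ((2 * l).choose k : ENNReal) *
          ENNReal.ofReal (C k * ‖x‖ ^ (-b - σ)) := by
          gcongr with k
          exact hC' k x hx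
      _ = _ := by
          rw [Finset.sum_mul, ENNReal.ofReal_sum_of_nonneg fun k _ => by
            have := hC k; positivity]
          refine Finset.sum_congr rfl fun k _ => ?_
          rw [mul_assoc, ENNReal.ofReal_mul (Nat.cast_nonneg _), ENNReal.ofReal_natCast]

end

section

variable {n : ℕ} {σ : ℝ}

/-- The kernel whose integral over the step `y` is the multiplier of the hypersingular integral. -/
noncomputable def diffKernel {n : ℕ} (l : ℕ) (σ : ℝ) (y ξ : EuclideanSpace ℝ (Fin n)) : ℝ :=
  (2 * Real.sin (Real.pi * inner ℝ y ξ)) ^ (2 * l) * ‖y‖ ^ (-σ - n)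

lemma diffKernel_nonneg (l : ℕ) (y ξ : EuclideanSpace ℝ (Fin n)) : 0 ≤ diffKernel l σ y ξ :=
  mul_nonneg ((even_two_mul l).pow_nonneg _) (Real.rpow_nonneg (norm_nonneg _) _)

lemma measurable_diffKernel (l : ℕ) : Measurable fun z : EuclideanSpace ℝ (Fin n) ×
    EuclideanSpace ℝ (Fin n) => diffKernel l σ z.1 z.2 := by
  unfold diffKernel
  fun_prop

lemma integrable_diffKernel [NeZero n] (hσ : 0 < σ) {l : ℕ} (hl : σ < 2 * l)
    (ξ : EuclideanSpace ℝ (Fin n)) : Integrable fun y => diffKernel l σ y ξ := by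
  refine ⟨(Measurable.of_uncurry_right (measurable_diffKernel l)).aestronglyMeasurable, ?_⟩
  refine lintegral_lt_top_of_le_rpow_norm (C := max ((2 * Real.pi * ‖ξ‖) ^ (2 * l)) (2 ^ (2 * l)))
    (s := 2 * l - σ - n) (t := -σ - n) (by linarith) (by linarith)
    (fun y hy => ?_) fun y hy => ?_
  all_goals
    have hyn : 0 < ‖y‖ := norm_pos_iff.2 hy
    rw [← ofReal_norm, Real.norm_of_nonneg (diffKernel_nonneg l y ξ), diffKernel,
      ← (even_two_mul l).pow_abs, abs_mul, abs_two]
    refine ENNReal.ofReal_le_ofReal ?_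
  · have h1 : |Real.sin (Real.pi * inner ℝ y ξ)| ≤ Real.pi * (‖y‖ * ‖ξ‖) := by
      refine Real.abs_sin_le_abs.trans ?_
      rw [abs_mul, abs_of_pos Real.pi_pos]
      gcongr
      exact abs_real_inner_le_norm y ξ
    have h2 : ‖y‖ ^ (2 * l - σ - n) = ‖y‖ ^ (2 * l) * ‖y‖ ^ (-σ - n) := by
      rw [← Real.rpow_natCast, ← Real.rpow_add hyn]
      congr 1
      push_cast
      ring
    calc _ ≤ (2 * (Real.pi * (‖y‖ * ‖ξ‖))) ^ (2 * l) * ‖y‖ ^ (-σ - n) := by gcongr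
      _ = (2 * Real.pi * ‖ξ‖) ^ (2 * l) * ‖y‖ ^ (2 * l - σ - n) := by rw [h2]; ring
      _ ≤ _ := by gcongr; exact le_max_left _ _
  · have h1 := Real.abs_sin_le_one (Real.pi * inner ℝ y ξ)
    calc _ ≤ (2 * 1) ^ (2 * l) * ‖y‖ ^ (-σ - n) := by gcongr
      _ ≤ _ := by rw [mul_one]; gcongr; exact le_max_right _ _

lemma integral_diffKernel_smul (l : ℕ) {r : ℝ} (hr : 0 < r) (u : EuclideanSpace ℝ (Fin n)) :
    ∫ y, diffKernel l σ y (r • u) = r ^ σ * ∫ y, diffKernel l σ y u := by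
  have h1 := Measure.integral_comp_smul (volume : Measure (EuclideanSpace ℝ (Fin n)))
    (fun y => diffKernel l σ y u) r
  have h2 : ∀ y : EuclideanSpace ℝ (Fin n),
      diffKernel l σ (r • y) u = r ^ (-σ - n) * diffKernel l σ y (r • u) := fun y => by
    rw [diffKernel, diffKernel, real_inner_smul_left, real_inner_smul_right, norm_smul,
      Real.norm_of_nonneg hr.le, Real.mul_rpow hr.le (norm_nonneg _)]
    ring
  simp_rw [h2] at h1
  rw [integral_const_mul, finrank_euclideanSpace_fin, abs_of_pos (by positivity), smul_eq_mul,
    ← Real.rpow_natCast, ← Real.rpow_neg hr.le] at h1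
  have h3 : r ^ (σ + n) * r ^ (-σ - n) = 1 := by
    rw [← Real.rpow_add hr, show σ + n + (-σ - n) = 0 by ring, Real.rpow_zero]
  calc _ = r ^ (σ + n) * (r ^ (-σ - n) * ∫ y, diffKernel l σ y (r • u)) := by
        rw [← mul_assoc, h3, one_mul]
    _ = _ := by
        rw [h1, ← mul_assoc, ← Real.rpow_add hr, add_neg_cancel_right]

lemma integral_diffKernel_eq_of_norm_eq (l : ℕ) {u v : EuclideanSpace ℝ (Fin n)}
    (huv : ‖u‖ = ‖v‖) : ∫ y, diffKernel l σ y u = ∫ y, diffKernel l σ y v := by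
  set A := (Submodule.reflection (Submodule.span ℝ {u - v})ᗮ) with hA
  have hAu : A u = v := Submodule.reflection_sub huv
  rw [← A.measurePreserving.integral_comp A.toHomeomorph.measurableEmbedding
    (fun y => diffKernel l σ y v)]
  congr 1
  funext y
  rw [diffKernel, diffKernel, ← hAu, A.inner_map_map, A.norm_map]

lemma integral_diffKernel_pos [NeZero n] (hσ : 0 < σ) {l : ℕ} (hl : σ < 2 * l)
    {u : EuclideanSpace ℝ (Fin n)} (hu : u ≠ 0) : 0 < ∫ y, diffKernel l σ y u := by
  rw [integral_pos_iff_support_of_nonneg (fun y => diffKernel_nonneg l y u)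
    (integrable_diffKernel hσ hl u)]
  set U : Set (EuclideanSpace ℝ (Fin n)) := {y | Real.sin (Real.pi * inner ℝ y u) ≠ 0} with hU
  have hUo : IsOpen U := isOpen_ne_fun (by fun_prop) continuous_const
  have hun : 0 < ‖u‖ := norm_pos_iff.2 hu
  have hmem : (1 / (2 * ‖u‖ ^ 2)) • u ∈ U := by
    rw [hU, Set.mem_ofPred_eq, real_inner_smul_left, real_inner_self_eq_norm_sq,
      show Real.pi * (1 / (2 * ‖u‖ ^ 2) * ‖u‖ ^ 2) = Real.pi / 2 by field_simp,
      Real.sin_pi_div_two]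
    exact one_ne_zero
  refine (hUo.measure_pos volume ⟨_, hmem⟩).trans_le (measure_mono fun y hy => ?_)
  have hy0 : y ≠ 0 := by
    rintro rfl
    simp [hU] at hy
  have hyn : 0 < ‖y‖ := norm_pos_iff.2 hy0
  exact mul_ne_zero (pow_ne_zero _ (mul_ne_zero two_ne_zero hy)) (by positivity)

/-- By homogeneity and rotation invariance, the multiplier of the hypersingular integral is a
positive multiple of `|ξ|^σ`. -/
lemma exists_integral_diffKernel_eq [NeZero n] (hσ : 0 < σ) {l : ℕ} (hl : σ < 2 * l) :
    ∃ c : ℝ, 0 < c ∧ ∀ ξ : EuclideanSpace ℝ (Fin n),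
      ∫ y, diffKernel l σ y ξ = c * (2 * Real.pi * ‖ξ‖) ^ σ := by
  have hl0 : l ≠ 0 := by
    rintro rfl
    simp at hl
    linarith
  obtain ⟨u, hu⟩ := exists_norm_eq (EuclideanSpace ℝ (Fin n)) (zero_le_one (α := ℝ))
  have hu0 : u ≠ 0 := norm_pos_iff.1 (by rw [hu]; exact one_pos)
  have hpi : 0 < (2 * Real.pi) ^ σ := by positivity
  refine ⟨(∫ y, diffKernel l σ y u) / (2 * Real.pi) ^ σ,
    div_pos (integral_diffKernel_pos hσ hl hu0) hpi, fun ξ => ?_⟩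
  rw [Real.mul_rpow (by positivity) (norm_nonneg _), ← mul_assoc, div_mul_cancel₀ _ hpi.ne']
  rcases eq_or_ne ξ 0 with rfl | hξ
  · rw [norm_zero, Real.zero_rpow hσ.ne', mul_zero]
    simp [diffKernel, hl0]
  · have hξn : 0 < ‖ξ‖ := norm_pos_iff.2 hξ
    rw [integral_diffKernel_eq_of_norm_eq l (u := ξ) (v := ‖ξ‖ • u)
      (by rw [norm_smul, norm_norm, hu, mul_one]), integral_diffKernel_smul l hξn, mul_comm]

lemma centralDiff_fourierInv {G : EuclideanSpace ℝ (Fin n) → ℂ} (hG : Integrable G) (l : ℕ)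
    (y x : EuclideanSpace ℝ (Fin n)) :
    centralDiff l y (𝓕⁻ G) x = ∫ ξ, (Real.fourierChar (inner ℝ ξ x) : ℂ) *
      ((-1 : ℂ) ^ l * (((2 * Real.sin (Real.pi * inner ℝ y ξ)) ^ (2 * l) : ℝ) : ℂ) * G ξ) := by
  have hI : ∀ z : EuclideanSpace ℝ (Fin n),
      Integrable fun ξ => (Real.fourierChar (inner ℝ ξ z) : ℂ) * G ξ := fun z => by
    have := (Real.fourierIntegral_convergent_iff (-z)).2 hG
    simpa [Circle.smul_def] using this
  simp_rw [← sum_choose_mul_exp, centralDiff, Real.fourierInv_eq, Circle.smul_def, smul_eq_mul,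
    ← integral_const_mul, Finset.sum_mul, Finset.mul_sum]
  rw [← integral_finsetSum _ fun k _ => (hI _).const_mul _]
  refine integral_congr_ae (Filter.Eventually.of_forall fun ξ => ?_)
  refine Finset.sum_congr rfl fun k _ => ?_
  rw [inner_add_right, real_inner_smul_right, AddChar.map_add_eq_mul, Circle.coe_mul,
    real_inner_comm ξ y]
  ring

/-- The fractional Laplacian as a hypersingular integral: averaging the central differences of
`𝓕⁻ G` against `|y|^{-σ-n}` multiplies `G` by a nonzero multiple of `(2π|ξ|)^σ`. -/
lemma exists_integral_centralDiff_fourierInv (n : ℕ) [NeZero n] (hσ : 0 < σ) {l : ℕ}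
    (hl : σ < 2 * l) :
    ∃ c : ℂ, c ≠ 0 ∧ ∀ G : EuclideanSpace ℝ (Fin n) → ℂ, Integrable G →
      Integrable (fun ξ => (((2 * Real.pi * ‖ξ‖) ^ σ : ℝ) : ℂ) * G ξ) →
      ∀ x, ∫ y, ((‖y‖ ^ (-σ - n) : ℝ) : ℂ) * centralDiff l y (𝓕⁻ G) x =
        c * 𝓕⁻ (fun ξ => (((2 * Real.pi * ‖ξ‖) ^ σ : ℝ) : ℂ) * G ξ) x := by
  obtain ⟨c, hc, hc'⟩ := exists_integral_diffKernel_eq (n := n) hσ hl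
  refine ⟨(-1) ^ l * c, mul_ne_zero (pow_ne_zero _ (by norm_num)) (by exact_mod_cast hc.ne'),
    fun G hG hG' x => ?_⟩
  set F : EuclideanSpace ℝ (Fin n) → EuclideanSpace ℝ (Fin n) → ℂ := fun y ξ =>
    ((diffKernel l σ y ξ : ℝ) : ℂ) * ((-1) ^ l * ((Real.fourierChar (inner ℝ ξ x) : ℂ) * G ξ))
    with hF
  have h1 : ∀ y, ((‖y‖ ^ (-σ - n) : ℝ) : ℂ) * centralDiff l y (𝓕⁻ G) x = ∫ ξ, F y ξ := by
    intro y
    rw [centralDiff_fourierInv hG, ← integral_const_mul]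
    refine integral_congr_ae (Filter.Eventually.of_forall fun ξ => ?_)
    simp only [hF, diffKernel]
    push_cast
    ring
  have hnorm : ∀ y ξ, ‖F y ξ‖ = diffKernel l σ y ξ * ‖G ξ‖ := fun y ξ => by
    simp [hF, Circle.norm_coe, abs_of_nonneg (diffKernel_nonneg l y ξ)]
  have hFint : Integrable (Function.uncurry F) (volume.prod volume) := by
    refine (integrable_prod_iff' ?_).2 ⟨Filter.Eventually.of_forall fun ξ => ?_, ?_⟩
    · refine AEStronglyMeasurable.mul ?_ ?_
      · exact (Complex.measurable_ofReal.comp (measurable_diffKernel l)).aestronglyMeasurable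
      · refine AEStronglyMeasurable.const_mul (AEStronglyMeasurable.mul ?_ ?_) _
        · refine Continuous.aestronglyMeasurable ?_
          exact continuous_subtype_val.comp (Real.continuous_fourierChar.comp (by fun_prop))
        · exact hG.aestronglyMeasurable.comp_snd
    · change Integrable fun y => ((diffKernel l σ y ξ : ℝ) : ℂ) *
        ((-1) ^ l * ((Real.fourierChar (inner ℝ ξ x) : ℂ) * G ξ))
      exact ((integrable_diffKernel hσ hl ξ).ofReal (𝕜 := ℂ)).mul_const _
    · simp only [Function.uncurry_apply_pair, hnorm, integral_mul_const, hc']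
      have := (hG'.norm).const_mul c
      refine this.congr (Filter.Eventually.of_forall fun ξ => ?_)
      simp only
      rw [norm_mul, Complex.norm_real, Real.norm_of_nonneg (by positivity), mul_assoc c]
  simp_rw [h1]
  rw [integral_integral_swap hFint, Real.fourierInv_eq, ← integral_const_mul]
  refine integral_congr_ae (Filter.Eventually.of_forall fun ξ => ?_)
  simp only [hF, Circle.smul_def, smul_eq_mul]
  have h2 : ∫ y, ((diffKernel l σ y ξ : ℝ) : ℂ) = ((c * (2 * Real.pi * ‖ξ‖) ^ σ : ℝ) : ℂ) := by
    rw [integral_complex_ofReal, hc']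
  refine (integral_mul_const _ _).trans ?_
  rw [h2]
  push_cast
  ring

end

/-! ### Riesz potentials and the Fourier transform -/

lemma integrable_and_integral_eq_of_lintegral_ofReal_eq {X : Type*} [MeasurableSpace X]
    {μ : Measure X} {f : X → ℝ} {v : ℝ} (hf : AEStronglyMeasurable f μ) (h0 : 0 ≤ᵐ[μ] f)
    (hv : 0 ≤ v) (h : ∫⁻ t, ENNReal.ofReal (f t) ∂μ = ENNReal.ofReal v) :
    Integrable f μ ∧ ∫ t, f t ∂μ = v := by
  refine ⟨⟨hf, ?_⟩, ?_⟩
  · rw [hasFiniteIntegral_iff_ofReal h0, h]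
    exact ENNReal.ofReal_lt_top
  · rw [integral_eq_lintegral_of_nonneg_ae h0 hf, h, ENNReal.toReal_ofReal hv]

section

variable {n : ℕ}

/-- The constant of the Riesz potential: convolution with `|x|^{s-n} / rieszConst n s` is the
inverse of `(-Δ)^{s/2}`. -/
noncomputable def rieszConst (n : ℕ) (s : ℝ) : ℝ :=
  2 ^ s * Real.pi ^ ((n : ℝ) / 2) * Real.Gamma (s / 2) / Real.Gamma ((n - s) / 2)

lemma rieszConst_pos {s : ℝ} (hs : 0 < s) (hsn : s < n) : 0 < rieszConst n s := by
  have h1 := Real.Gamma_pos_of_pos (half_pos hs)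
  have h2 := Real.Gamma_pos_of_pos (show 0 < (n - s) / 2 by linarith)
  unfold rieszConst
  positivity

/-- The Fourier transform of a Gaussian, moved under the pairing with `G`. -/
lemma integral_gaussian_mul_fourierInv {G : EuclideanSpace ℝ (Fin n) → ℂ} (hG : Integrable G)
    {t : ℝ} (ht : 0 < t) (x : EuclideanSpace ℝ (Fin n)) :
    ∫ y, ((Real.exp (-(‖x - y‖ ^ 2 * t)) : ℝ) : ℂ) * 𝓕⁻ G y =
      ∫ ξ, (((Real.pi / t) ^ ((n : ℝ) / 2) * Real.exp (-(Real.pi ^ 2 * ‖ξ‖ ^ 2 / t)) : ℝ) : ℂ) *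
        ((Real.fourierChar (inner ℝ ξ x) : ℂ) * G ξ) := by
  set g : EuclideanSpace ℝ (Fin n) → ℂ := fun y => Complex.exp (-(t : ℂ) * (‖y‖ : ℂ) ^ 2) with hg
  have hgi : Integrable g := by
    have := GaussianFourier.integrable_cexp_neg_mul_sq_norm_add (V := EuclideanSpace ℝ (Fin n))
      (b := (t : ℂ)) (by simpa using ht) 0 0
    simpa [hg] using this
  have hgi' : Integrable fun y => g (x - y) := hgi.comp_sub_left x
  have h1 := VectorFourier.integral_fourierIntegral_smul_eq_flip (μ := volume) (ν := volume)
    (L := -innerₗ (EuclideanSpace ℝ (Fin n))) (f := G) (g := fun y => g (x - y))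
    Real.continuous_fourierChar (by
      simp only [LinearMap.neg_apply, innerₗ_apply_apply]
      fun_prop) hG hgi'
  have h2 : ∀ ξ, VectorFourier.fourierIntegral Real.fourierChar volume
      (-innerₗ (EuclideanSpace ℝ (Fin n))).flip (fun y => g (x - y)) ξ =
      (((Real.pi / t) ^ ((n : ℝ) / 2) * Real.exp (-(Real.pi ^ 2 * ‖ξ‖ ^ 2 / t)) : ℝ) : ℂ) *
        (Real.fourierChar (inner ℝ ξ x) : ℂ) := by
    intro ξ
    have h3 := fourier_gaussian_innerProductSpace (V := EuclideanSpace ℝ (Fin n)) (b := (t : ℂ))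
      (by simpa using ht) ξ
    rw [Real.fourier_eq] at h3
    rw [VectorFourier.fourierIntegral, ← integral_sub_left_eq_self _ volume x]
    simp only [LinearMap.flip_apply, LinearMap.neg_apply, innerₗ_apply_apply, neg_neg,
      sub_sub_cancel]
    have h4 : ∀ v, Real.fourierChar (inner ℝ ξ (x - v)) • g v =
        (Real.fourierChar (inner ℝ ξ x) : ℂ) * (Real.fourierChar (-inner ℝ v ξ) • g v) := by
      intro v
      rw [inner_sub_right, sub_eq_add_neg, AddChar.map_add_eq_mul, Circle.smul_def, Circle.smul_def,
        Circle.coe_mul, real_inner_comm ξ v, smul_eq_mul, smul_eq_mul, mul_assoc]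
    simp_rw [h4]
    rw [integral_const_mul, h3, mul_comm]
    congr 1
    rw [finrank_euclideanSpace_fin, Complex.ofReal_mul, Complex.ofReal_cpow (by positivity)]
    push_cast
    congr 2
    ring
  simp_rw [h2] at h1
  calc _ = ∫ y, VectorFourier.fourierIntegral Real.fourierChar volume
        (-innerₗ (EuclideanSpace ℝ (Fin n))) G y • g (x - y) := by
        refine integral_congr_ae (Filter.Eventually.of_forall fun y => ?_)
        simp only [hg, smul_eq_mul]
        rw [mul_comm]
        congr 1
        push_cast
        congr 1
        ring
    _ = _ := h1
    _ = _ := by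
        refine integral_congr_ae (Filter.Eventually.of_forall fun ξ => ?_)
        simp only [smul_eq_mul]
        ring

/-- The Riesz potential of `𝓕⁻ G` is `𝓕⁻ ((2π|ξ|)^{-s} G)`, as soon as both expressions converge
absolutely: the kernel is a superposition of Gaussians, whose Fourier transforms are known. -/
lemma integral_rpow_norm_sub_mul_fourierInv [NeZero n] {s : ℝ} (hs : 0 < s) (hsn : s < n)
    {G : EuclideanSpace ℝ (Fin n) → ℂ} (hG : Integrable G)
    (hG' : Integrable fun ξ => (((2 * Real.pi * ‖ξ‖) ^ (-s) : ℝ) : ℂ) * G ξ)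
    (x : EuclideanSpace ℝ (Fin n))
    (hx : Integrable fun y => ((‖x - y‖ ^ (s - n) : ℝ) : ℂ) * 𝓕⁻ G y) :
    ∫ y, ((‖x - y‖ ^ (s - n) : ℝ) : ℂ) * 𝓕⁻ G y =
      rieszConst n s * 𝓕⁻ (fun ξ => (((2 * Real.pi * ‖ξ‖) ^ (-s) : ℝ) : ℂ) * G ξ) x := by
  set A : ℝ := (n - s) / 2 with hA
  have hA0 : 0 < A := by rw [hA]; linarith
  have hGA := Real.Gamma_pos_of_pos hA0
  have hGs := Real.Gamma_pos_of_pos (half_pos hs)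
  have hcont : Continuous (𝓕⁻ G) := VectorFourier.fourierIntegral_continuous
    Real.continuous_fourierChar (by
      simp only [LinearMap.neg_apply, innerₗ_apply_apply]
      fun_prop) hG
  have hpos : ∀ {t : ℝ}, t ∈ Set.Ioi (0 : ℝ) → 0 < t := fun h => h
  -- the two superpositions of Gaussians
  have hk1 : ∀ z : EuclideanSpace ℝ (Fin n), z ≠ 0 →
      IntegrableOn (fun t : ℝ => t ^ (A - 1) * Real.exp (-(‖z‖ ^ 2 * t))) (Set.Ioi 0) ∧
      ∫ t in Set.Ioi (0 : ℝ), t ^ (A - 1) * Real.exp (-(‖z‖ ^ 2 * t)) =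
        ‖z‖ ^ (s - n) * Real.Gamma A := by
    intro z hz
    refine integrable_and_integral_eq_of_lintegral_ofReal_eq (by fun_prop) ?_ (by positivity) ?_
    · refine (ae_restrict_iff' measurableSet_Ioi).2 (Filter.Eventually.of_forall fun t ht => ?_)
      have := hpos ht
      exact mul_nonneg (Real.rpow_nonneg this.le _) (Real.exp_nonneg _)
    · rw [lintegral_rpow_mul_exp_neg_norm_sq hA0 hz, show -(2 * A) = s - n by rw [hA]; ring]
  have hk2 : ∀ z : EuclideanSpace ℝ (Fin n), z ≠ 0 →
      IntegrableOn (fun t : ℝ => t ^ (A - 1) * ((Real.pi / t) ^ ((n : ℝ) / 2) *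
        Real.exp (-(Real.pi ^ 2 * ‖z‖ ^ 2 / t)))) (Set.Ioi 0) ∧
      ∫ t in Set.Ioi (0 : ℝ), t ^ (A - 1) * ((Real.pi / t) ^ ((n : ℝ) / 2) *
        Real.exp (-(Real.pi ^ 2 * ‖z‖ ^ 2 / t))) =
        rieszConst n s * Real.Gamma A * (2 * Real.pi * ‖z‖) ^ (-s) := by
    intro z hz
    have hzn : 0 < ‖z‖ := norm_pos_iff.2 hz
    have hR := rieszConst_pos hs hsn
    refine integrable_and_integral_eq_of_lintegral_ofReal_eq
      (Measurable.aestronglyMeasurable (by fun_prop)) ?_ (by positivity) ?_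
    · refine (ae_restrict_iff' measurableSet_Ioi).2 (Filter.Eventually.of_forall fun t ht => ?_)
      have := hpos ht
      change 0 ≤ t ^ (A - 1) * ((Real.pi / t) ^ ((n : ℝ) / 2) *
        Real.exp (-(Real.pi ^ 2 * ‖z‖ ^ 2 / t)))
      positivity
    · have h1 : ∀ t ∈ Set.Ioi (0 : ℝ), ENNReal.ofReal (t ^ (A - 1) *
          ((Real.pi / t) ^ ((n : ℝ) / 2) * Real.exp (-(Real.pi ^ 2 * ‖z‖ ^ 2 / t)))) =
          ENNReal.ofReal (Real.pi ^ ((n : ℝ) / 2)) *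
          ENNReal.ofReal (t ^ (-(s / 2) - 1) * Real.exp (-((Real.pi ^ 2 * ‖z‖ ^ 2) / t))) := by
        intro t ht
        have ht := hpos ht
        rw [← ENNReal.ofReal_mul (by positivity), Real.div_rpow Real.pi_pos.le ht.le,
          show -(s / 2) - 1 = (A - 1) - (n : ℝ) / 2 by rw [hA]; ring, Real.rpow_sub ht (A - 1)]
        congr 1
        ring
      rw [setLIntegral_congr_fun measurableSet_Ioi h1, lintegral_const_mul' _ _
        ENNReal.ofReal_ne_top, lintegral_rpow_mul_exp_neg_div_Ioi (half_pos hs) (by positivity),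
        ← ENNReal.ofReal_mul (by positivity)]
      congr 1
      have h2 : (Real.pi ^ 2 * ‖z‖ ^ 2) ^ (-(s / 2)) = (Real.pi * ‖z‖) ^ (-s) := by
        rw [← mul_pow, ← Real.rpow_natCast, ← Real.rpow_mul (by positivity)]
        congr 1
        push_cast
        ring
      rw [h2, rieszConst, ← hA, mul_assoc 2 Real.pi, Real.mul_rpow (by norm_num : (0 : ℝ) ≤ 2)
        (by positivity), Real.rpow_neg (by norm_num : (0 : ℝ) ≤ 2)]
      field_simp
  have hne : ∀ z : EuclideanSpace ℝ (Fin n), ∀ᵐ y : EuclideanSpace ℝ (Fin n), y ≠ z :=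
    fun z => compl_mem_ae_iff.2 (measure_singleton z)
  set H : ℝ → EuclideanSpace ℝ (Fin n) → ℂ := fun t y =>
    ((t ^ (A - 1) * Real.exp (-(‖x - y‖ ^ 2 * t)) : ℝ) : ℂ) * 𝓕⁻ G y with hH
  set K : ℝ → EuclideanSpace ℝ (Fin n) → ℂ := fun t ξ =>
    ((t ^ (A - 1) * ((Real.pi / t) ^ ((n : ℝ) / 2) *
        Real.exp (-(Real.pi ^ 2 * ‖ξ‖ ^ 2 / t))) : ℝ) : ℂ) *
        ((Real.fourierChar (inner ℝ ξ x) : ℂ) * G ξ) with hK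
  have hHi : Integrable (Function.uncurry H) ((volume.restrict (Set.Ioi 0)).prod volume) := by
    refine (integrable_prod_iff' ?_).2 ⟨?_, ?_⟩
    · refine Measurable.aestronglyMeasurable (Measurable.mul ?_ ?_)
      · exact Complex.measurable_ofReal.comp (by fun_prop)
      · exact hcont.measurable.comp measurable_snd
    · filter_upwards [hne x] with y hy
      exact ((hk1 (x - y) (sub_ne_zero.2 hy.symm)).1.ofReal (𝕜 := ℂ)).mul_const (𝓕⁻ G y)
    · refine (hx.norm.mul_const (Real.Gamma A)).congr ?_
      filter_upwards [hne x] with y hy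
      have h1 : ∫ t in Set.Ioi (0 : ℝ), ‖H t y‖ = ∫ t in Set.Ioi (0 : ℝ),
          t ^ (A - 1) * Real.exp (-(‖x - y‖ ^ 2 * t)) * ‖𝓕⁻ G y‖ := by
        refine setIntegral_congr_fun measurableSet_Ioi fun t ht => ?_
        have := hpos ht
        simp only [hH]
        rw [norm_mul, Complex.norm_real, Real.norm_of_nonneg (by positivity)]
      rw [integral_mul_const, (hk1 (x - y) (sub_ne_zero.2 hy.symm)).2] at h1
      simp only [Function.uncurry_apply_pair]
      rw [h1, norm_mul, Complex.norm_real, Real.norm_of_nonneg (by positivity)]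
      ring
  have hKi : Integrable (Function.uncurry K) ((volume.restrict (Set.Ioi 0)).prod volume) := by
    refine (integrable_prod_iff' ?_).2 ⟨?_, ?_⟩
    · refine AEStronglyMeasurable.mul ?_ (AEStronglyMeasurable.mul ?_ ?_)
      · refine Measurable.aestronglyMeasurable (Complex.measurable_ofReal.comp ?_)
        fun_prop
      · refine Continuous.aestronglyMeasurable ?_
        exact continuous_subtype_val.comp (Real.continuous_fourierChar.comp (by fun_prop))
      · exact hG.aestronglyMeasurable.comp_snd
    · filter_upwards [hne 0] with ξ hξ
      exact ((hk2 ξ hξ).1.ofReal (𝕜 := ℂ)).mul_const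
        ((Real.fourierChar (inner ℝ ξ x) : ℂ) * G ξ)
    · refine (hG'.norm.const_mul (rieszConst n s * Real.Gamma A)).congr ?_
      filter_upwards [hne 0] with ξ hξ
      have h1 : ∫ t in Set.Ioi (0 : ℝ), ‖K t ξ‖ = ∫ t in Set.Ioi (0 : ℝ),
          t ^ (A - 1) * ((Real.pi / t) ^ ((n : ℝ) / 2) *
            Real.exp (-(Real.pi ^ 2 * ‖ξ‖ ^ 2 / t))) * ‖G ξ‖ := by
        refine setIntegral_congr_fun measurableSet_Ioi fun t ht => ?_
        have := hpos ht
        simp only [hK]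
        rw [norm_mul, norm_mul, Complex.norm_real, Real.norm_of_nonneg (by positivity),
          Circle.norm_coe, one_mul]
      rw [integral_mul_const, (hk2 ξ hξ).2] at h1
      simp only [Function.uncurry_apply_pair]
      rw [h1, norm_mul, Complex.norm_real, Real.norm_of_nonneg (by positivity)]
      ring
  have e1 : ∫ t in Set.Ioi (0 : ℝ), ∫ y, H t y = ∫ t in Set.Ioi (0 : ℝ), ∫ ξ, K t ξ := by
    refine setIntegral_congr_fun measurableSet_Ioi fun t ht => ?_
    have h1 := congrArg (fun z => ((t ^ (A - 1) : ℝ) : ℂ) * z)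
      (integral_gaussian_mul_fourierInv hG (hpos ht) x)
    rw [← integral_const_mul, ← integral_const_mul] at h1
    refine Eq.trans ?_ (h1.trans ?_)
    · refine integral_congr_ae (Filter.Eventually.of_forall fun y => ?_)
      simp only [hH]
      push_cast
      ring
    · refine integral_congr_ae (Filter.Eventually.of_forall fun y => ?_)
      simp only [hK]
      push_cast
      ring
  rw [integral_integral_swap hHi, integral_integral_swap hKi] at e1
  have e2 : ∫ y, ∫ t in Set.Ioi (0 : ℝ), H t y =
      Real.Gamma A * ∫ y, ((‖x - y‖ ^ (s - n) : ℝ) : ℂ) * 𝓕⁻ G y := by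
    rw [← integral_const_mul]
    refine integral_congr_ae ?_
    filter_upwards [hne x] with y hy
    have h1 := (hk1 (x - y) (sub_ne_zero.2 hy.symm)).2
    refine (integral_mul_const _ _).trans ?_
    rw [integral_complex_ofReal, h1]
    push_cast
    ring
  have e3 : ∫ ξ, ∫ t in Set.Ioi (0 : ℝ), K t ξ = Real.Gamma A * (rieszConst n s *
      𝓕⁻ (fun ξ => (((2 * Real.pi * ‖ξ‖) ^ (-s) : ℝ) : ℂ) * G ξ) x) := by
    rw [Real.fourierInv_eq, ← integral_const_mul, ← integral_const_mul]
    refine integral_congr_ae ?_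
    filter_upwards [hne 0] with ξ hξ
    refine (integral_mul_const _ _).trans ?_
    rw [integral_complex_ofReal, (hk2 ξ hξ).2, Circle.smul_def, smul_eq_mul]
    push_cast
    ring
  rw [e2, e3] at e1
  exact mul_left_cancel₀ (by exact_mod_cast hGA.ne') e1

end

/-! ### Schur's test and the Stein–Weiss kernel -/

/-- **Schur's test** with one weight `W`. -/
lemma lintegral_rpow_lintegral_mul_le_of_schur {X : Type*} [MeasurableSpace X] {μ : Measure X}
    [SFinite μ] {p q : ℝ} (hpq : p.HolderConjugate q) {k : X → X → ENNReal}
    (hk : Measurable (Function.uncurry k)) {W : X → ENNReal} (hW : Measurable W)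
    (hW0 : ∀ᵐ x ∂μ, W x ≠ 0) (hWt : ∀ x, W x ≠ ⊤) {C : ENNReal} (hC : C ≠ ⊤)
    (h1 : ∀ᵐ x ∂μ, ∫⁻ y, k x y * W y ^ q ∂μ ≤ C * W x ^ q)
    (h2 : ∀ᵐ y ∂μ, ∫⁻ x, k x y * W x ^ p ∂μ ≤ C * W y ^ p) {u : X → ENNReal}
    (hu : AEMeasurable u μ) :
    ∫⁻ x, (∫⁻ y, k x y * u y ∂μ) ^ p ∂μ ≤ C ^ p * ∫⁻ y, u y ^ p ∂μ := by
  have hp : 0 < p := hpq.pos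
  have hq : 0 < q := hpq.symm.pos
  have hkx : ∀ x, Measurable (k x) := fun x => hk.of_uncurry_left
  have step1 : ∀ᵐ x ∂μ, (∫⁻ y, k x y * u y ∂μ) ^ p ≤
      ∫⁻ y, C ^ (p / q) * (W x ^ p * (k x y * ((W y)⁻¹ * u y) ^ p)) ∂μ := by
    filter_upwards [h1] with x hx
    have e1 : ∫⁻ y, k x y * u y ∂μ =
        ∫⁻ y, ((fun y => k x y ^ (1 / q) * W y) * fun y => k x y ^ (1 / p) * ((W y)⁻¹ * u y)) y
          ∂μ := by
      refine lintegral_congr_ae ?_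
      filter_upwards [hW0] with y hy
      simp only [Pi.mul_apply]
      have h3 : k x y ^ (1 / q) * k x y ^ (1 / p) = k x y := by
        rw [← ENNReal.rpow_add_of_nonneg _ _ (by positivity) (by positivity), one_div, one_div,
          hpq.symm.inv_add_inv_eq_one, ENNReal.rpow_one]
      calc _ = (k x y ^ (1 / q) * k x y ^ (1 / p)) * (W y * (W y)⁻¹) * u y := by
            rw [h3, ENNReal.mul_inv_cancel hy (hWt y), mul_one]
        _ = _ := by ring
    have e2 := ENNReal.lintegral_mul_le_Lp_mul_Lq μ hpq.symm
      (f := fun y => k x y ^ (1 / q) * W y) (g := fun y => k x y ^ (1 / p) * ((W y)⁻¹ * u y))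
      (((hkx x).pow_const _).mul hW).aemeasurable
      (((hkx x).pow_const _).aemeasurable.mul (hW.inv.aemeasurable.mul hu))
    rw [← e1] at e2
    have e3 : ∀ y, (k x y ^ (1 / q) * W y) ^ q = k x y * W y ^ q := fun y => by
      rw [ENNReal.mul_rpow_of_nonneg _ _ hq.le, ← ENNReal.rpow_mul, one_div_mul_cancel hq.ne',
        ENNReal.rpow_one]
    have e4 : ∀ y, (k x y ^ (1 / p) * ((W y)⁻¹ * u y)) ^ p =
        k x y * ((W y)⁻¹ * u y) ^ p := fun y => by
      rw [ENNReal.mul_rpow_of_nonneg _ _ hp.le, ← ENNReal.rpow_mul, one_div_mul_cancel hp.ne',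
        ENNReal.rpow_one]
    simp_rw [e3, e4] at e2
    calc (∫⁻ y, k x y * u y ∂μ) ^ p
        ≤ ((C * W x ^ q) ^ (1 / q) * (∫⁻ y, k x y * ((W y)⁻¹ * u y) ^ p ∂μ) ^ (1 / p)) ^ p := by
          gcongr
          exact e2.trans (by gcongr)
      _ = C ^ (p / q) * W x ^ p * ∫⁻ y, k x y * ((W y)⁻¹ * u y) ^ p ∂μ := by
          rw [ENNReal.mul_rpow_of_nonneg _ _ hp.le, ← ENNReal.rpow_mul, ← ENNReal.rpow_mul,
            one_div_mul_cancel hp.ne', ENNReal.rpow_one, one_div_mul_eq_div,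
            ENNReal.mul_rpow_of_nonneg _ _ (by positivity), ← ENNReal.rpow_mul,
            mul_div_cancel₀ _ hq.ne']
      _ = _ := by
          rw [← lintegral_const_mul' _ _ (ENNReal.mul_ne_top
            (ENNReal.rpow_ne_top_of_nonneg (by positivity) hC)
            (ENNReal.rpow_ne_top_of_nonneg hp.le (hWt x)))]
          simp_rw [mul_assoc]
  refine (lintegral_mono_ae step1).trans ?_
  have hswap : AEMeasurable (Function.uncurry fun x y =>
      C ^ (p / q) * (W x ^ p * (k x y * ((W y)⁻¹ * u y) ^ p))) (μ.prod μ) := by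
    have hu' : AEMeasurable (fun z : X × X => ((W z.2)⁻¹ * u z.2) ^ p) (μ.prod μ) :=
      ((hW.inv.aemeasurable.mul hu).pow_const p).comp_quasiMeasurePreserving
        Measure.quasiMeasurePreserving_snd
    exact (((hW.comp measurable_fst).pow_const p).aemeasurable.mul
      (hk.aemeasurable.mul hu')).const_mul _
  rw [lintegral_lintegral_swap hswap]
  calc _ ≤ ∫⁻ y, C ^ p * u y ^ p ∂μ := by
        refine lintegral_mono_ae ?_
        filter_upwards [h2, hW0] with y hy hy0
        have hv : (W y)⁻¹ ^ p * W y ^ p = 1 := by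
          rw [← ENNReal.mul_rpow_of_nonneg _ _ hp.le, ENNReal.inv_mul_cancel hy0 (hWt y),
            ENNReal.one_rpow]
        have e5 : C ^ (p / q) * C = C ^ p := by
          conv_lhs => rw [← ENNReal.rpow_one C, ← ENNReal.rpow_mul, one_mul]
          rw [← ENNReal.rpow_add_of_nonneg _ _ (by positivity) zero_le_one]
          congr 1
          rw [hpq.div_conj_eq_sub_one, sub_add_cancel]
        calc _ = ∫⁻ x, (C ^ (p / q) * ((W y)⁻¹ * u y) ^ p) * (k x y * W x ^ p) ∂μ := by
              congr 1; funext x; ring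
          _ = (C ^ (p / q) * ((W y)⁻¹ * u y) ^ p) * ∫⁻ x, k x y * W x ^ p ∂μ :=
              lintegral_const_mul _ ((hk.of_uncurry_right).mul (hW.pow_const p))
          _ ≤ (C ^ (p / q) * ((W y)⁻¹ * u y) ^ p) * (C * W y ^ p) := by gcongr
          _ = (C ^ (p / q) * C) * ((W y)⁻¹ ^ p * W y ^ p) * u y ^ p := by
              rw [ENNReal.mul_rpow_of_nonneg _ _ hp.le]; ring
          _ = _ := by rw [e5, hv, mul_one]
    _ = _ := lintegral_const_mul' _ _ (ENNReal.rpow_ne_top_of_nonneg hp.le hC)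

section

variable {n : ℕ}

/-- A bound for the `L^p` norm of the operator with kernel `|x|^{τ-s} |x-y|^{s-n} |y|^{-τ}`. -/
noncomputable def steinWeissConst (n : ℕ) (p q s τ : ℝ) : ℝ :=
  Real.pi ^ ((n : ℝ) / 2) *
    (Real.Gamma ((n / p + τ - s) / 2) * Real.Gamma (s / 2) * Real.Gamma ((n / q - τ) / 2)) /
    (Real.Gamma ((n - s) / 2) * Real.Gamma ((n / p + τ) / 2) * Real.Gamma ((n / q - τ + s) / 2))

/-- The kernel `|x|^{τ-s} |x-y|^{s-n} |y|^{-τ}`, homogeneous of degree `-n`, satisfies Schur's test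
with the critical powers of the norm as weights. -/
lemma lintegral_rpow_lintegral_steinWeiss_le [NeZero n] {p q s τ : ℝ} (hpq : p.HolderConjugate q)
    (hs : 0 < s) (hsn : s < n) (hτ : τ < n / q) (hτs : -(n / p) < τ - s)
    {u : EuclideanSpace ℝ (Fin n) → ENNReal} (hu : AEMeasurable u volume) :
    ∫⁻ x, (∫⁻ y, ENNReal.ofReal (‖x‖ ^ (τ - s) * ‖x - y‖ ^ (s - n) * ‖y‖ ^ (-τ)) * u y) ^ p ≤
      ENNReal.ofReal (steinWeissConst n p q s τ) ^ p * ∫⁻ y, u y ^ p := by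
  have hp : 0 < p := hpq.pos
  have hq : 0 < q := hpq.symm.pos
  have hnpq : (n : ℝ) / p + n / q = n := by
    rw [div_eq_mul_inv, div_eq_mul_inv, ← mul_add, hpq.inv_add_inv_eq_one, mul_one]
  have hne : ∀ z : EuclideanSpace ℝ (Fin n), ∀ᵐ y : EuclideanSpace ℝ (Fin n), y ≠ z :=
    fun z => compl_mem_ae_iff.2 (measure_singleton z)
  have hWq : ∀ y : EuclideanSpace ℝ (Fin n), y ≠ 0 →
      ENNReal.ofReal (‖y‖ ^ (-(n : ℝ) / (p * q))) ^ q = ENNReal.ofReal (‖y‖ ^ (-(n : ℝ) / p)) := by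
    intro y hy
    have hyn : 0 < ‖y‖ := norm_pos_iff.2 hy
    rw [ENNReal.ofReal_rpow_of_pos (by positivity), ← Real.rpow_mul hyn.le]
    congr 2
    field_simp
  have hWp : ∀ y : EuclideanSpace ℝ (Fin n), y ≠ 0 →
      ENNReal.ofReal (‖y‖ ^ (-(n : ℝ) / (p * q))) ^ p = ENNReal.ofReal (‖y‖ ^ (-(n : ℝ) / q)) := by
    intro y hy
    have hyn : 0 < ‖y‖ := norm_pos_iff.2 hy
    rw [ENNReal.ofReal_rpow_of_pos (by positivity), ← Real.rpow_mul hyn.le]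
    congr 2
    field_simp
  have hK0 : 0 ≤ steinWeissConst n p q s τ := by
    have g1 := Real.Gamma_pos_of_pos (show 0 < ((n : ℝ) / p + τ - s) / 2 by linarith)
    have g2 := Real.Gamma_pos_of_pos (show 0 < s / 2 by linarith)
    have g3 := Real.Gamma_pos_of_pos (show 0 < ((n : ℝ) / q - τ) / 2 by linarith)
    have g4 := Real.Gamma_pos_of_pos (show 0 < ((n : ℝ) - s) / 2 by linarith)
    have g5 := Real.Gamma_pos_of_pos (show 0 < ((n : ℝ) / p + τ) / 2 by linarith)
    have g6 := Real.Gamma_pos_of_pos (show 0 < ((n : ℝ) / q - τ + s) / 2 by linarith)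
    unfold steinWeissConst
    positivity
  refine lintegral_rpow_lintegral_mul_le_of_schur hpq
    (k := fun x y => ENNReal.ofReal (‖x‖ ^ (τ - s) * ‖x - y‖ ^ (s - n) * ‖y‖ ^ (-τ)))
    (W := fun y => ENNReal.ofReal (‖y‖ ^ (-(n : ℝ) / (p * q))))
    (Measurable.ennreal_ofReal (by fun_prop)) (by fun_prop) ?_
    (fun x => ENNReal.ofReal_ne_top) ENNReal.ofReal_ne_top ?_ ?_ hu
  · filter_upwards [hne 0] with x hx
    have hxn : 0 < ‖x‖ := norm_pos_iff.2 hx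
    have : 0 < ‖x‖ ^ (-(n : ℝ) / (p * q)) := by positivity
    simpa using this
  · filter_upwards [hne 0] with x hx
    have hxn : 0 < ‖x‖ := norm_pos_iff.2 hx
    have e1 : ∫⁻ y, ENNReal.ofReal (‖x‖ ^ (τ - s) * ‖x - y‖ ^ (s - n) * ‖y‖ ^ (-τ)) *
        ENNReal.ofReal (‖y‖ ^ (-(n : ℝ) / (p * q))) ^ q =
        ∫⁻ y, ENNReal.ofReal (‖x‖ ^ (τ - s)) *
          ENNReal.ofReal (‖x - y‖ ^ (s - n) * ‖y‖ ^ (n / q - τ - n)) := by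
      refine lintegral_congr_ae ?_
      filter_upwards [hne 0] with y hy
      have hyn : 0 < ‖y‖ := norm_pos_iff.2 hy
      rw [hWq y hy, ← ENNReal.ofReal_mul (by positivity), ← ENNReal.ofReal_mul (by positivity),
        show (n : ℝ) / q - τ - n = -τ + -(n : ℝ) / p by rw [neg_div]; linarith, Real.rpow_add hyn]
      congr 1
      ring
    rw [e1, lintegral_const_mul' _ _ ENNReal.ofReal_ne_top,
      lintegral_rpow_norm_sub_mul_rpow_norm hs (by linarith) (by linarith) hx, hWq x hx,
      ← ENNReal.ofReal_mul (by positivity), ← ENNReal.ofReal_mul hK0]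
    refine ENNReal.ofReal_le_ofReal (le_of_eq ?_)
    rw [show -(n : ℝ) / p = (τ - s) + (s + (n / q - τ) - n) by rw [neg_div]; linarith,
      Real.rpow_add hxn, steinWeissConst,
      show (n : ℝ) - s - (n / q - τ) = n / p + τ - s by linarith,
      show (n : ℝ) - (n / q - τ) = n / p + τ by linarith, add_comm ((n : ℝ) / q - τ) s]
    ring
  · filter_upwards [hne 0] with y hy
    have hyn : 0 < ‖y‖ := norm_pos_iff.2 hy
    have e1 : ∫⁻ x, ENNReal.ofReal (‖x‖ ^ (τ - s) * ‖x - y‖ ^ (s - n) * ‖y‖ ^ (-τ)) *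
        ENNReal.ofReal (‖x‖ ^ (-(n : ℝ) / (p * q))) ^ p =
        ∫⁻ x, ENNReal.ofReal (‖y‖ ^ (-τ)) *
          ENNReal.ofReal (‖y - x‖ ^ (s - n) * ‖x‖ ^ (n / p + τ - s - n)) := by
      refine lintegral_congr_ae ?_
      filter_upwards [hne 0] with x hx
      have hxn : 0 < ‖x‖ := norm_pos_iff.2 hx
      rw [hWp x hx, ← ENNReal.ofReal_mul (by positivity), ← ENNReal.ofReal_mul (by positivity),
        show (n : ℝ) / p + τ - s - n = (τ - s) + -(n : ℝ) / q by rw [neg_div]; linarith,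
        Real.rpow_add hxn, norm_sub_rev y x]
      congr 1
      ring
    rw [e1, lintegral_const_mul' _ _ ENNReal.ofReal_ne_top,
      lintegral_rpow_norm_sub_mul_rpow_norm hs (by linarith) (by linarith) hy, hWp y hy,
      ← ENNReal.ofReal_mul (by positivity), ← ENNReal.ofReal_mul hK0]
    refine ENNReal.ofReal_le_ofReal (le_of_eq ?_)
    rw [show -(n : ℝ) / q = -τ + (s + (n / p + τ - s) - n) by rw [neg_div]; linarith,
      Real.rpow_add hyn, steinWeissConst,
      show (n : ℝ) - s - (n / p + τ - s) = n / q - τ by linarith,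
      show (n : ℝ) - (n / p + τ - s) = n / q - τ + s by linarith,
      show s + ((n : ℝ) / p + τ - s) = n / p + τ by linarith]
    ring

end

/-! ### Symmetry of the hypersingular integral -/

section

variable {n : ℕ} {b σ : ℝ} {f φ : EuclideanSpace ℝ (Fin n) → ℂ}

/-- The hypersingular integral `∫ |y|^{-σ-n} δ_y φ(x) dy` of central differences of order `2l`; up to
a constant it is `(-Δ)^{σ/2} φ`. -/
noncomputable def hypersingular {n : ℕ} (l : ℕ) (σ : ℝ) (φ : EuclideanSpace ℝ (Fin n) → ℂ)
    (x : EuclideanSpace ℝ (Fin n)) : ℂ :=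
  ∫ y, ((‖y‖ ^ (-σ - n) : ℝ) : ℂ) * centralDiff l y φ x

lemma IsSymbol.measurable {s : ℝ} (h : IsSymbol s φ) : Measurable φ :=
  measurable_of_continuousOn_compl_singleton 0 h.continuousOn

lemma measurable_centralDiff (hφ : Measurable φ) (l : ℕ) :
    Measurable fun z : EuclideanSpace ℝ (Fin n) × EuclideanSpace ℝ (Fin n) =>
      centralDiff l z.2 φ z.1 := by
  unfold centralDiff
  refine Finset.measurable_fun_sum _ fun k _ => Measurable.const_mul (hφ.comp ?_) _
  fun_prop

lemma measurable_hypersingular (hφ : Measurable φ) (l : ℕ) :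
    Measurable (hypersingular l σ φ) := by
  refine StronglyMeasurable.measurable ?_
  refine StronglyMeasurable.integral_prod_right' (f := fun z : EuclideanSpace ℝ (Fin n) ×
    EuclideanSpace ℝ (Fin n) => ((‖z.2‖ ^ (-σ - n) : ℝ) : ℂ) * centralDiff l z.2 φ z.1) ?_
  exact ((Complex.measurable_ofReal.comp (by fun_prop)).mul
    (measurable_centralDiff hφ l)).stronglyMeasurable

lemma enorm_rpow_norm (y : EuclideanSpace ℝ (Fin n)) (s : ℝ) :
    ‖((‖y‖ ^ s : ℝ) : ℂ)‖ₑ = ENNReal.ofReal (‖y‖ ^ s) := by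
  rw [← ofReal_norm, Complex.norm_real, Real.norm_of_nonneg (by positivity)]

variable [NeZero n]

lemma IsSymbol.exists_norm_hypersingular_le (h : IsSymbol (-b) φ) (hb : 0 < b) (hbn : b < n)
    (hσ : 0 < σ) {l : ℕ} (hl : σ < 2 * l) :
    ∃ C : ℝ, 0 ≤ C ∧ ∀ x : EuclideanSpace ℝ (Fin n), x ≠ 0 →
      ‖hypersingular l σ φ x‖ ≤ C * ‖x‖ ^ (-b - σ) := by
  obtain ⟨C, hC, hC'⟩ := h.exists_lintegral_centralDiff_mul_le hb hbn hσ hl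
  refine ⟨C, hC, fun x hx => ?_⟩
  rw [← ENNReal.ofReal_le_ofReal_iff (by positivity), ofReal_norm]
  refine (enorm_integral_le_lintegral_enorm _).trans (le_trans (le_of_eq ?_) (hC' x hx))
  refine lintegral_congr fun y => ?_
  rw [enorm_mul, enorm_rpow_norm, mul_comm]

/-- The pairing of `f = O(|x|^{-b})`, translated by `v`, with a decaying function is `O(|v|^{-b/2})`:
the decay `|x|^{-(n-b/2)}` makes it a convolution of two powers of the norm. -/
lemma exists_lintegral_comp_add_mul_le {A B : ℝ} (hb : 0 < b) (hbn : b < n) (hA : 0 ≤ A)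
    (hB : 0 ≤ B) (hf : ∀ x, x ≠ 0 → ‖f x‖ ≤ A * ‖x‖ ^ (-b))
    (hφ : ∀ x, x ≠ 0 → ‖φ x‖ ≤ B * ‖x‖ ^ (-(n - b / 2))) :
    ∃ C : ℝ, 0 ≤ C ∧ ∀ v : EuclideanSpace ℝ (Fin n), v ≠ 0 →
      ∫⁻ x, ‖f (x + v) * φ x‖ₑ ≤ ENNReal.ofReal (C * ‖v‖ ^ (-(b / 2))) := by
  have hne : ∀ z : EuclideanSpace ℝ (Fin n), ∀ᵐ y : EuclideanSpace ℝ (Fin n), y ≠ z :=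
    fun z => compl_mem_ae_iff.2 (measure_singleton z)
  obtain ⟨K, hK, key⟩ := exists_lintegral_rpow_norm_sub_mul_rpow_norm (n := n) (a := n - b)
    (b := b / 2) (by linarith) (by linarith) (by linarith)
  refine ⟨A * B * K, by positivity, fun v hv => ?_⟩
  have h1 := key (-v) (neg_ne_zero.2 hv)
  rw [norm_neg, show (n : ℝ) - b + b / 2 - n = -(b / 2) by ring] at h1
  rw [mul_assoc, ENNReal.ofReal_mul (by positivity), ← h1,
    ← lintegral_const_mul' _ _ ENNReal.ofReal_ne_top]
  refine lintegral_mono_ae ?_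
  filter_upwards [hne 0, hne (-v)] with x hx hxv
  rw [← ofReal_norm, norm_mul, ← ENNReal.ofReal_mul (by positivity)]
  refine ENNReal.ofReal_le_ofReal ?_
  rw [show -v - x = -(x + v) by abel, norm_neg, show (n : ℝ) - b - n = -b by ring,
    show b / 2 - (n : ℝ) = -(n - b / 2) by ring]
  calc _ ≤ (A * ‖x + v‖ ^ (-b)) * (B * ‖x‖ ^ (-(n - b / 2))) := by
        gcongr
        · exact hf _ fun h => hxv (eq_neg_of_add_eq_zero_left h)
        · exact hφ x hx
    _ = _ := by ring

lemma integrable_comp_add_mul {A : ℝ} (hfm : Measurable f) (hA : 0 ≤ A)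
    (hA' : ∀ x, x ≠ 0 → ‖f x‖ ≤ A * ‖x‖ ^ (-b)) (hb : 0 < b) (hbn : b < n)
    (hφ : ∀ c : ℝ, 0 < c → c < n → IsSymbol (-c) φ) (v : EuclideanSpace ℝ (Fin n)) :
    Integrable fun x => f (x + v) * φ x := by
  have hφm : Measurable φ := (hφ b hb hbn).measurable
  refine ⟨((hfm.comp (measurable_id.add_const v)).mul hφm).aestronglyMeasurable, ?_⟩
  have hn : (0 : ℝ) < n := hb.trans hbn
  obtain ⟨B, hB, hB'⟩ := (hφ (n - b / 2) (by linarith) (by linarith)).norm_le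
  rcases eq_or_ne v 0 with rfl | hv
  · -- without a translation the singularities coincide, and less decay is used near the origin
    obtain ⟨D, hD, hD'⟩ := (hφ ((n - b) / 2) (by linarith) (by linarith)).norm_le
    refine lintegral_lt_top_of_le_rpow_norm (C := A * max B D) (s := -b - (n - b) / 2)
      (t := -b - (n - b / 2)) (by linarith) (by linarith) (fun x hx => ?_) fun x hx => ?_
    all_goals
      have hxn : 0 < ‖x‖ := norm_pos_iff.2 hx
      simp only [add_zero]
      rw [← ofReal_norm, norm_mul, sub_eq_add_neg, Real.rpow_add hxn]
      refine ENNReal.ofReal_le_ofReal ?_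
    · calc _ ≤ (A * ‖x‖ ^ (-b)) * (D * ‖x‖ ^ (-((n - b) / 2))) := by
            gcongr
            · exact hA' x hx
            · exact hD' x hx
        _ = A * D * (‖x‖ ^ (-b) * ‖x‖ ^ (-((n - b) / 2))) := by ring
        _ ≤ _ := by gcongr; exact le_max_right _ _
    · calc _ ≤ (A * ‖x‖ ^ (-b)) * (B * ‖x‖ ^ (-(n - b / 2))) := by
            gcongr
            · exact hA' x hx
            · exact hB' x hx
        _ = A * B * (‖x‖ ^ (-b) * ‖x‖ ^ (-(n - b / 2))) := by ring
        _ ≤ _ := by gcongr; exact le_max_left _ _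
  · obtain ⟨C, _, hC⟩ := exists_lintegral_comp_add_mul_le hb hbn hA hB hA' hB'
    exact (hC v hv).trans_lt ENNReal.ofReal_lt_top

lemma integral_centralDiff_mul (hf : IsSymbol (-b) f) (hb : 0 < b) (hbn : b < n)
    (hφ : ∀ c : ℝ, 0 < c → c < n → IsSymbol (-c) φ) (l : ℕ) (y : EuclideanSpace ℝ (Fin n)) :
    ∫ x, centralDiff l y f x * φ x = ∫ x, f x * centralDiff l y φ x := by
  obtain ⟨A, hA, hA'⟩ := hf.norm_le
  have hI := integrable_comp_add_mul hf.measurable hA hA' hb hbn hφ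
  have hI' : ∀ v, Integrable fun x => f x * φ (x + v) := fun v => by
    have := (hI (-v)).comp_add_right v
    simpa using this
  have hv : ∀ v, ∫ x, f (x + v) * φ x = ∫ x, f x * φ (x + -v) := fun v => by
    rw [← integral_sub_right_eq_self _ v]
    simp [sub_eq_add_neg]
  have h1 : ∫ x, centralDiff l y f x * φ x = ∑ k ∈ Finset.range (2 * l + 1),
      ((-1 : ℂ) ^ k * ((2 * l).choose k : ℂ)) * ∫ x, f x * φ (x + -(((k : ℝ) - l) • y)) := by
    simp_rw [centralDiff, Finset.sum_mul, ← hv, ← integral_const_mul]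
    rw [← integral_finsetSum _ fun k _ => (hI _).const_mul _]
    simp_rw [mul_assoc]
  have h2 : ∫ x, f x * centralDiff l y φ x = ∑ k ∈ Finset.range (2 * l + 1),
      ((-1 : ℂ) ^ k * ((2 * l).choose k : ℂ)) * ∫ x, f x * φ (x + ((k : ℝ) - l) • y) := by
    simp_rw [centralDiff, Finset.mul_sum, ← integral_const_mul]
    rw [← integral_finsetSum _ fun k _ => (hI' _).const_mul _]
    refine integral_congr_ae (Filter.Eventually.of_forall fun x => ?_)
    refine Finset.sum_congr rfl fun k _ => ?_
    ring
  rw [h1, h2, ← Finset.sum_range_reflect]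
  refine Finset.sum_congr rfl fun k hk => ?_
  have hk : k ≤ 2 * l := Nat.lt_succ_iff.1 (Finset.mem_range.1 hk)
  have e1 : 2 * l + 1 - 1 - k = 2 * l - k := by omega
  have e2 : (-1 : ℂ) ^ (2 * l - k) = (-1) ^ k := by
    rcases Nat.even_or_odd k with h | h
    · rw [h.neg_one_pow, Even.neg_one_pow (by grind)]
    · rw [h.neg_one_pow, Odd.neg_one_pow (by grind)]
  rw [e1, e2, Nat.choose_symm hk, Nat.cast_sub hk, ← neg_smul]
  push_cast
  ring_nf

/-- The hypersingular integral is symmetric. -/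
lemma integral_hypersingular_mul (hf : IsSymbol (-b) f) (hb : 0 < b) (hσ : 0 < σ) (hbσ : b + σ < n)
    (hφ : ∀ c : ℝ, 0 < c → c < n → IsSymbol (-c) φ) {l : ℕ} (hl : σ < 2 * l) :
    Integrable (fun x => hypersingular l σ f x * φ x) ∧
    Integrable (fun x => f x * hypersingular l σ φ x) ∧
    ∫ x, hypersingular l σ f x * φ x = ∫ x, f x * hypersingular l σ φ x := by
  have hbn : b < n := by linarith
  have hφm : Measurable φ := (hφ b hb hbn).measurable
  have hfm := hf.measurable
  -- the orders of decay used near the origin and near infinity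
  set c₁ : ℝ := (n - b - σ) / 2 with hc₁
  set c₂ : ℝ := n - b / 2 with hc₂
  have hφ₁ := hφ c₁ (by rw [hc₁]; linarith) (by rw [hc₁]; linarith)
  have hφ₂ := hφ c₂ (by rw [hc₂]; linarith) (by rw [hc₂]; linarith)
  obtain ⟨A, hA, hA'⟩ := hf.exists_lintegral_centralDiff_mul_le hb hbn hσ hl
  obtain ⟨A₀, hA₀, hA₀'⟩ := hf.norm_le
  obtain ⟨B₁, hB₁, hB₁'⟩ := hφ₁.exists_lintegral_centralDiff_mul_le (by rw [hc₁]; linarith)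
    (by rw [hc₁]; linarith) hσ hl
  obtain ⟨B₂, hB₂, hB₂'⟩ := hφ₂.exists_lintegral_centralDiff_mul_le (by rw [hc₂]; linarith)
    (by rw [hc₂]; linarith) hσ hl
  obtain ⟨D₁, hD₁, hD₁'⟩ := hφ₁.norm_le
  obtain ⟨D₂, hD₂, hD₂'⟩ := hφ₂.norm_le
  set F : EuclideanSpace ℝ (Fin n) → EuclideanSpace ℝ (Fin n) → ℂ := fun x y =>
    ((‖y‖ ^ (-σ - n) : ℝ) : ℂ) * (centralDiff l y f x * φ x) with hF
  set H : EuclideanSpace ℝ (Fin n) → EuclideanSpace ℝ (Fin n) → ℂ := fun x y =>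
    ((‖y‖ ^ (-σ - n) : ℝ) : ℂ) * (f x * centralDiff l y φ x) with hH
  have hmw : Measurable fun z : EuclideanSpace ℝ (Fin n) × EuclideanSpace ℝ (Fin n) =>
      ((‖z.2‖ ^ (-σ - n) : ℝ) : ℂ) := Complex.measurable_ofReal.comp (by fun_prop)
  have hFm : Measurable (Function.uncurry F) :=
    hmw.mul ((measurable_centralDiff hfm l).mul (hφm.comp measurable_fst))
  have hHm : Measurable (Function.uncurry H) :=
    hmw.mul ((hfm.comp measurable_fst).mul (measurable_centralDiff hφm l))
  have hFi : Integrable (Function.uncurry F) (volume.prod volume) := by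
    refine ⟨hFm.aestronglyMeasurable, ?_⟩
    rw [HasFiniteIntegral, lintegral_prod _ hFm.enorm.aemeasurable]
    have h1 : ∀ x, ∫⁻ y, ‖Function.uncurry F (x, y)‖ₑ =
        (∫⁻ y, ‖centralDiff l y f x‖ₑ * ENNReal.ofReal (‖y‖ ^ (-σ - n))) * ‖φ x‖ₑ := fun x => by
      rw [← lintegral_mul_const' _ _ enorm_ne_top]
      refine lintegral_congr fun y => ?_
      simp only [Function.uncurry_apply_pair, hF]
      rw [enorm_mul, enorm_mul, enorm_rpow_norm]
      ring
    refine lintegral_lt_top_of_le_rpow_norm (C := A * max D₁ D₂) (s := -b - σ - c₁)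
      (t := -b - σ - c₂) (by rw [hc₁]; linarith) (by rw [hc₂]; linarith)
      (fun x hx => ?_) fun x hx => ?_
    all_goals
      have hxn : 0 < ‖x‖ := norm_pos_iff.2 hx
      rw [h1, sub_eq_add_neg (-b - σ), Real.rpow_add hxn]
    · calc _ ≤ ENNReal.ofReal (A * ‖x‖ ^ (-b - σ)) * ENNReal.ofReal (D₁ * ‖x‖ ^ (-c₁)) := by
            rw [← ofReal_norm]
            exact mul_le_mul' (hA' x hx) (ENNReal.ofReal_le_ofReal (hD₁' x hx))
        _ = ENNReal.ofReal (A * D₁ * (‖x‖ ^ (-b - σ) * ‖x‖ ^ (-c₁))) := by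
            rw [← ENNReal.ofReal_mul (by positivity)]; ring_nf
        _ ≤ _ := by gcongr; exact le_max_left _ _
    · calc _ ≤ ENNReal.ofReal (A * ‖x‖ ^ (-b - σ)) * ENNReal.ofReal (D₂ * ‖x‖ ^ (-c₂)) := by
            rw [← ofReal_norm]
            exact mul_le_mul' (hA' x hx) (ENNReal.ofReal_le_ofReal (hD₂' x hx))
        _ = ENNReal.ofReal (A * D₂ * (‖x‖ ^ (-b - σ) * ‖x‖ ^ (-c₂))) := by
            rw [← ENNReal.ofReal_mul (by positivity)]; ring_nf
        _ ≤ _ := by gcongr; exact le_max_right _ _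
  have hHi : Integrable (Function.uncurry H) (volume.prod volume) := by
    refine ⟨hHm.aestronglyMeasurable, ?_⟩
    rw [HasFiniteIntegral, lintegral_prod _ hHm.enorm.aemeasurable]
    have h1 : ∀ x, ∫⁻ y, ‖Function.uncurry H (x, y)‖ₑ =
        ‖f x‖ₑ * (∫⁻ y, ‖centralDiff l y φ x‖ₑ * ENNReal.ofReal (‖y‖ ^ (-σ - n))) := fun x => by
      rw [← lintegral_const_mul' _ _ enorm_ne_top]
      refine lintegral_congr fun y => ?_
      simp only [Function.uncurry_apply_pair, hH]
      rw [enorm_mul, enorm_mul, enorm_rpow_norm]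
      ring
    refine lintegral_lt_top_of_le_rpow_norm (C := A₀ * max B₁ B₂) (s := -b + (-c₁ - σ))
      (t := -b + (-c₂ - σ)) (by rw [hc₁]; linarith) (by rw [hc₂]; linarith)
      (fun x hx => ?_) fun x hx => ?_
    all_goals
      have hxn : 0 < ‖x‖ := norm_pos_iff.2 hx
      rw [h1, Real.rpow_add hxn]
    · calc _ ≤ ENNReal.ofReal (A₀ * ‖x‖ ^ (-b)) * ENNReal.ofReal (B₁ * ‖x‖ ^ (-c₁ - σ)) := by
            rw [← ofReal_norm]
            exact mul_le_mul' (ENNReal.ofReal_le_ofReal (hA₀' x hx)) (hB₁' x hx)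
        _ = ENNReal.ofReal (A₀ * B₁ * (‖x‖ ^ (-b) * ‖x‖ ^ (-c₁ - σ))) := by
            rw [← ENNReal.ofReal_mul (by positivity)]; ring_nf
        _ ≤ _ := by gcongr; exact le_max_left _ _
    · calc _ ≤ ENNReal.ofReal (A₀ * ‖x‖ ^ (-b)) * ENNReal.ofReal (B₂ * ‖x‖ ^ (-c₂ - σ)) := by
            rw [← ofReal_norm]
            exact mul_le_mul' (ENNReal.ofReal_le_ofReal (hA₀' x hx)) (hB₂' x hx)
        _ = ENNReal.ofReal (A₀ * B₂ * (‖x‖ ^ (-b) * ‖x‖ ^ (-c₂ - σ))) := by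
            rw [← ENNReal.ofReal_mul (by positivity)]; ring_nf
        _ ≤ _ := by gcongr; exact le_max_right _ _
  have e1 : ∀ x, ∫ y, F x y = hypersingular l σ f x * φ x := fun x => by
    rw [hypersingular, ← integral_mul_const]
    simp_rw [hF, mul_assoc]
  have e2 : ∀ x, ∫ y, H x y = f x * hypersingular l σ φ x := fun x => by
    rw [hypersingular, ← integral_const_mul]
    simp_rw [hH, mul_left_comm (f x)]
  refine ⟨?_, ?_, ?_⟩
  · simpa only [Function.uncurry_apply_pair, e1] using hFi.integral_prod_left
  · simpa only [Function.uncurry_apply_pair, e2] using hHi.integral_prod_left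
  · simp_rw [← e1, ← e2]
    rw [integral_integral_swap hFi, integral_integral_swap hHi]
    refine integral_congr_ae (Filter.Eventually.of_forall fun y => ?_)
    simp only [hF, hH]
    rw [integral_const_mul, integral_const_mul, integral_centralDiff_mul hf hb hbn hφ]

end

/-! ### Fractional Laplacians of Schwartz functions and of symbols -/

section

variable {n : ℕ} {s t : ℝ}

lemma IsSymbol.two_pi_rpow_mul {G : EuclideanSpace ℝ (Fin n) → ℂ} (h : IsSymbol t G) (s : ℝ) :
    IsSymbol (s + t) fun ξ => (((2 * Real.pi * ‖ξ‖) ^ s : ℝ) : ℂ) * G ξ := by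
  have := ((IsSymbol.const (n := n) (((2 * Real.pi) ^ s : ℝ) : ℂ)).mul (IsSymbol.norm_rpow s)).mul h
  rw [zero_add] at this
  convert this using 2 with ξ
  rw [Real.mul_rpow (by positivity) (norm_nonneg _)]
  push_cast
  rfl

lemma fourierInv_fourier_schwartz (φ : 𝓢(EuclideanSpace ℝ (Fin n), ℂ)) :
    𝓕⁻ (𝓕 (φ : EuclideanSpace ℝ (Fin n) → ℂ)) = φ := by
  rw [← SchwartzMap.fourier_coe, ← SchwartzMap.fourierInv_coe, FourierTransform.fourierInv_fourier_eq]

lemma integrable_fourier_schwartz (φ : 𝓢(EuclideanSpace ℝ (Fin n), ℂ)) :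
    Integrable (𝓕 (φ : EuclideanSpace ℝ (Fin n) → ℂ)) := by
  rw [← SchwartzMap.fourier_coe]
  exact (𝓕 φ).integrable

lemma isSymbol_two_pi_rpow_mul_fourier (φ : 𝓢(EuclideanSpace ℝ (Fin n), ℂ)) (s : ℝ) {c : ℝ}
    (hc : 0 ≤ c) : IsSymbol (s - c) fun ξ : EuclideanSpace ℝ (Fin n) =>
      (((2 * Real.pi * ‖ξ‖) ^ s : ℝ) : ℂ) * 𝓕 (φ : EuclideanSpace ℝ (Fin n) → ℂ) ξ := by
  rw [sub_eq_add_neg]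
  refine IsSymbol.two_pi_rpow_mul ?_ s
  rw [← SchwartzMap.fourier_coe]
  exact IsSymbol.of_schwartz _ hc

variable [NeZero n]

/-- A symbol of order `t > -n` that decays rapidly has finite moments. -/
lemma IsSymbol.integrable_pow_norm_mul_norm {G : EuclideanSpace ℝ (Fin n) → ℂ}
    (hG : ∀ c : ℝ, 0 ≤ c → IsSymbol (t - c) G) (ht : -n < t) (k : ℕ) :
    Integrable fun ξ => ‖ξ‖ ^ k * ‖G ξ‖ := by
  have hk : (0 : ℝ) ≤ k := Nat.cast_nonneg k
  have hn : (0 : ℝ) ≤ n := Nat.cast_nonneg n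
  have h0 := hG 0 le_rfl
  refine ⟨(Continuous.aestronglyMeasurable (by fun_prop)).mul h0.aestronglyMeasurable.norm, ?_⟩
  obtain ⟨A, hA, hA'⟩ := h0.norm_le
  obtain ⟨B, hB, hB'⟩ := (hG (k + |t| + n + 1) (by positivity)).norm_le
  refine lintegral_lt_top_of_le_rpow_norm (C := max A B) (s := k + (t - 0))
    (t := k + (t - (k + |t| + n + 1))) (by linarith) (by linarith [le_abs_self t])
    (fun x hx => ?_) fun x hx => ?_
  all_goals
    have hxn : 0 < ‖x‖ := norm_pos_iff.2 hx
    rw [← ofReal_norm, norm_mul, norm_norm, norm_pow, norm_norm, Real.rpow_add hxn,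
      Real.rpow_natCast]
    refine ENNReal.ofReal_le_ofReal ?_
  · calc _ ≤ ‖x‖ ^ k * (A * ‖x‖ ^ (t - 0)) := by gcongr; exact hA' x hx
      _ = A * (‖x‖ ^ k * ‖x‖ ^ (t - 0)) := by ring
      _ ≤ _ := by gcongr; exact le_max_left _ _
  · calc _ ≤ ‖x‖ ^ k * (B * ‖x‖ ^ (t - (k + |t| + n + 1))) := by gcongr; exact hB' x hx
      _ = B * (‖x‖ ^ k * ‖x‖ ^ (t - (k + |t| + n + 1))) := by ring
      _ ≤ _ := by gcongr; exact le_max_right _ _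

lemma IsSymbol.integrable {G : EuclideanSpace ℝ (Fin n) → ℂ}
    (hG : ∀ c : ℝ, 0 ≤ c → IsSymbol (t - c) G) (ht : -n < t) : Integrable G := by
  have := integrable_pow_norm_mul_norm hG ht 0
  simp only [pow_zero, one_mul] at this
  exact (integrable_norm_iff (by simpa using (hG 0 le_rfl).aestronglyMeasurable)).1 this

/-- The fractional Laplacian of order `s` of a Schwartz function decays like `|x|^{-n-s}`. -/
lemma isSymbol_fracLaplacian (φ : 𝓢(EuclideanSpace ℝ (Fin n), ℂ)) (hs : -n < s) {c : ℝ}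
    (hc : 0 ≤ c) (hc' : c ≤ n + s) : IsSymbol (-c) (fracLaplacian s φ) := by
  have h := fun c hc => isSymbol_two_pi_rpow_mul_fourier φ s (c := c) hc
  have h0 := h 0 le_rfl
  rw [sub_zero] at h0
  exact h0.fourierInv hs (IsSymbol.integrable_pow_norm_mul_norm h hs) hc hc'

/-- A function dominated by a locally integrable power of the norm is locally integrable. -/
lemma locallyIntegrable_of_norm_le_rpow {u : EuclideanSpace ℝ (Fin n) → ℂ}
    (hu : AEStronglyMeasurable u) {b C : ℝ} (hbn : b < n)
    (h : ∀ x, x ≠ 0 → ‖u x‖ ≤ C * ‖x‖ ^ (-b)) : LocallyIntegrable u := by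
  rw [locallyIntegrable_iff]
  intro K hK
  obtain ⟨R, hR⟩ := hK.isBounded.subset_closedBall 0
  obtain ⟨A, hA, hA'⟩ := exists_setLIntegral_closedBall_rpow_norm_le (n := n) (t := n - b)
    (by linarith)
  have hR' : K ⊆ Metric.closedBall 0 (max R 1) :=
    hR.trans (Metric.closedBall_subset_closedBall (le_max_left _ _))
  refine IntegrableOn.mono_set ⟨hu.restrict, ?_⟩ hR'
  have hne : ∀ᵐ x : EuclideanSpace ℝ (Fin n), x ≠ 0 :=
    compl_mem_ae_iff.2 (measure_singleton 0)
  calc _ ≤ ∫⁻ x in Metric.closedBall (0 : EuclideanSpace ℝ (Fin n)) (max R 1),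
        ENNReal.ofReal |C| * ENNReal.ofReal (‖x‖ ^ (n - b - n)) := by
        refine lintegral_mono_ae (ae_restrict_of_ae (hne.mono fun x hx => ?_))
        rw [← ENNReal.ofReal_mul (abs_nonneg _), ← ofReal_norm]
        refine ENNReal.ofReal_le_ofReal ((h x hx).trans ?_)
        rw [show n - b - n = -b by ring]
        gcongr
        exact le_abs_self C
    _ = ENNReal.ofReal |C| * ∫⁻ x in Metric.closedBall (0 : EuclideanSpace ℝ (Fin n)) (max R 1),
        ENNReal.ofReal (‖x‖ ^ (n - b - n)) := lintegral_const_mul' _ _ ENNReal.ofReal_ne_top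
    _ < ⊤ := ENNReal.mul_lt_top ENNReal.ofReal_lt_top
        ((hA' _ (lt_max_of_lt_right one_pos)).trans_lt ENNReal.ofReal_lt_top)

/-- The hypersingular integral is a nonzero multiple of the Fourier multiplier `(2π|ξ|)^σ`. -/
lemma exists_hypersingular_fourierInv (n : ℕ) [NeZero n] {σ : ℝ} (hσ : 0 < σ) {l : ℕ}
    (hl : σ < 2 * l) :
    ∃ c : ℂ, c ≠ 0 ∧ ∀ G : EuclideanSpace ℝ (Fin n) → ℂ, Integrable G →
      Integrable (fun ξ => (((2 * Real.pi * ‖ξ‖) ^ σ : ℝ) : ℂ) * G ξ) →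
      hypersingular l σ (𝓕⁻ G) =
        fun x => c * 𝓕⁻ (fun ξ => (((2 * Real.pi * ‖ξ‖) ^ σ : ℝ) : ℂ) * G ξ) x := by
  obtain ⟨c, hc, h⟩ := exists_integral_centralDiff_fourierInv n hσ hl
  exact ⟨c, hc, fun G hG hG' => funext fun x => h G hG hG' x⟩

/-- For a symbol `f` of order `-b`, with `b > 0` and `b + σ < n`, the normalized hypersingular
integral of `f` is `(-Δ)^{σ/2} f` in the distributional sense. -/
lemma IsSymbol.isFracLaplacian {f : EuclideanSpace ℝ (Fin n) → ℂ} {b σ : ℝ} (hf : IsSymbol (-b) f)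
    (hb : 0 < b) (hσ : 0 < σ) (hbσ : b + σ < n) {l : ℕ} (hl : σ < 2 * l) {c : ℂ} (hc : c ≠ 0)
    (hc' : ∀ G : EuclideanSpace ℝ (Fin n) → ℂ, Integrable G →
      Integrable (fun ξ => (((2 * Real.pi * ‖ξ‖) ^ σ : ℝ) : ℂ) * G ξ) →
      hypersingular l σ (𝓕⁻ G) =
        fun x => c * 𝓕⁻ (fun ξ => (((2 * Real.pi * ‖ξ‖) ^ σ : ℝ) : ℂ) * G ξ) x) :
    IsFracLaplacian σ f fun x => c⁻¹ * hypersingular l σ f x := by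
  have hn : (0 : ℝ) ≤ n := Nat.cast_nonneg n
  have hbn : b < n := by linarith
  have key : ∀ φ : 𝓢(EuclideanSpace ℝ (Fin n), ℂ),
      hypersingular l σ φ = fun x => c * fracLaplacian σ φ x := fun φ => by
    have := hc' _ (integrable_fourier_schwartz φ)
      (IsSymbol.integrable (fun c hc => isSymbol_two_pi_rpow_mul_fourier φ σ hc) (by linarith))
    rwa [fourierInv_fourier_schwartz] at this
  have dual := fun φ : 𝓢(EuclideanSpace ℝ (Fin n), ℂ) => integral_hypersingular_mul hf hb hσ hbσ
    (fun e he _ => IsSymbol.of_schwartz φ he.le) hl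
  obtain ⟨A, hA, hA'⟩ := hf.norm_le
  obtain ⟨B, hB, hB'⟩ := hf.exists_norm_hypersingular_le hb hbn hσ hl
  constructor
  · exact locallyIntegrable_of_norm_le_rpow hf.aestronglyMeasurable hbn hA'
  · refine locallyIntegrable_of_norm_le_rpow (b := b + σ) (C := ‖c⁻¹‖ * B)
      ((measurable_hypersingular hf.measurable l).const_mul _).aestronglyMeasurable hbσ
      fun x hx => ?_
    rw [norm_mul, mul_assoc, neg_add, ← sub_eq_add_neg]
    gcongr
    exact hB' x hx
  · intro φ
    have := (dual φ).2.1.const_mul c⁻¹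
    refine this.congr (Filter.Eventually.of_forall fun x => ?_)
    simp only [key]
    field_simp
  · intro φ
    have := (dual φ).1.const_mul c⁻¹
    simpa only [mul_assoc] using this
  · intro φ
    have h := (dual φ).2.2
    simp_rw [key, mul_left_comm _ c, integral_const_mul] at h
    simp_rw [mul_assoc, integral_const_mul]
    rw [h, inv_mul_cancel_left₀ hc]

end

/-! ### Functions annihilating rapidly decaying symbols of high order -/

section

variable {n : ℕ}

lemma norm_iteratedFDeriv_sin_comp_le (L : EuclideanSpace ℝ (Fin n) →L[ℝ] ℝ) (k : ℕ)
    (x : EuclideanSpace ℝ (Fin n)) :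
    ‖iteratedFDeriv ℝ k (fun x => ((Real.sin (L x) : ℝ) : ℂ)) x‖ ≤ ‖L‖ ^ k := by
  have h1 : ContDiff ℝ k fun x => Real.sin (L x) := Real.contDiff_sin.comp L.contDiff
  have h2 : ‖iteratedFDeriv ℝ k (fun x => ((Real.sin (L x) : ℝ) : ℂ)) x‖ =
      ‖iteratedFDeriv ℝ k (fun x => Real.sin (L x)) x‖ :=
    Complex.ofRealLI.norm_iteratedFDeriv_comp_left h1.contDiffAt le_rfl
  have h3 : iteratedFDeriv ℝ k (fun x => Real.sin (L x)) x =
      (iteratedFDeriv ℝ k Real.sin (L x)).compContinuousLinearMap fun _ => L :=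
    L.iteratedFDeriv_comp_right (Real.contDiff_sin (n := k)) x le_rfl
  rw [h2, h3]
  refine (ContinuousMultilinearMap.norm_compContinuousLinearMap_le _ _).trans ?_
  rw [norm_iteratedFDeriv_eq_norm_iteratedDeriv, Finset.prod_const, Finset.card_univ,
    Fintype.card_fin, Real.norm_eq_abs]
  exact mul_le_of_le_one_left (by positivity) (Real.abs_iteratedDeriv_sin_le_one k _)

/-- Multiplication by the sine of a linear functional raises the order of a rapidly decaying symbol by one. -/
lemma IsSymbol.sin_mul {χ : EuclideanSpace ℝ (Fin n) → ℂ} {m : ℝ}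
    (h : ∀ c : ℝ, 0 ≤ c → IsSymbol (m - c) χ) (L : EuclideanSpace ℝ (Fin n) →L[ℝ] ℝ)
    {c : ℝ} (hc : 0 ≤ c) :
    IsSymbol (m + 1 - c) fun ξ => ((Real.sin (L ξ) : ℝ) : ℂ) * χ ξ := by
  have hD : ContDiff ℝ (⊤ : ℕ∞) fun ξ => ((Real.sin (L ξ) : ℝ) : ℂ) :=
    Complex.ofRealCLM.contDiff.comp (Real.contDiff_sin.comp L.contDiff)
  have h0 := h 0 le_rfl
  refine ⟨hD.contDiffOn.mul h0.contDiffOn, fun k => ?_⟩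
  have key : ∀ i, i ≤ k → ∃ C : ℝ, 0 ≤ C ∧ ∀ x, x ≠ 0 →
      ‖iteratedFDerivWithin ℝ i (fun ξ => ((Real.sin (L ξ) : ℝ) : ℂ)) {0}ᶜ x‖ *
        ‖iteratedFDerivWithin ℝ (k - i) χ {0}ᶜ x‖ ≤ C * ‖x‖ ^ (m + 1 - c - k) := by
    intro i hik
    rcases i with _ | i
    · obtain ⟨B, hB, hB'⟩ := (h c hc).bound k
      refine ⟨‖L‖ * B, by positivity, fun x hx => ?_⟩
      have hxn : 0 < ‖x‖ := norm_pos_iff.2 hx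
      rw [norm_iteratedFDerivWithin_zero, Complex.norm_real, Real.norm_eq_abs]
      calc _ ≤ (‖L‖ * ‖x‖) * (B * ‖x‖ ^ (m - c - k)) := by
            gcongr
            · exact Real.abs_sin_le_abs.trans (L.le_opNorm x)
            · exact hB' x hx
        _ = ‖L‖ * B * (‖x‖ ^ (1 : ℝ) * ‖x‖ ^ (m - c - k)) := by rw [Real.rpow_one]; ring
        _ = _ := by rw [← Real.rpow_add hxn]; ring_nf
    · -- derivatives of the sine are merely bounded; the decay of `χ` makes up for it
      obtain ⟨B, hB, hB'⟩ := (h (c + i) (by positivity)).bound (k - (i + 1))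
      refine ⟨‖L‖ ^ (i + 1) * B, by positivity, fun x hx => ?_⟩
      rw [iteratedFDerivWithin_of_isOpen _ isOpen_compl_singleton hx]
      calc _ ≤ ‖L‖ ^ (i + 1) * (B * ‖x‖ ^ (m - (c + i) - (k - (i + 1) : ℕ))) := by
            gcongr
            · exact norm_iteratedFDeriv_sin_comp_le L _ x
            · exact hB' x hx
        _ = _ := by
            rw [Nat.cast_sub hik]
            push_cast
            ring_nf
  choose! C hC hC' using key
  refine ⟨∑ i ∈ Finset.range (k + 1), (k.choose i : ℝ) * C i, Finset.sum_nonneg fun i hi =>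
    mul_nonneg (Nat.cast_nonneg _) (hC i (Nat.lt_succ_iff.1 (Finset.mem_range.1 hi))),
    fun x hx => ?_⟩
  refine (norm_iteratedFDerivWithin_mul_le hD.contDiffOn h0.contDiffOn
    isOpen_compl_singleton.uniqueDiffOn hx (n := k) (by exact_mod_cast le_top)).trans ?_
  rw [Finset.sum_mul]
  refine Finset.sum_le_sum fun i hi => ?_
  rw [mul_assoc, mul_assoc]
  refine mul_le_mul_of_nonneg_left ?_ (Nat.cast_nonneg _)
  exact hC' i (Nat.lt_succ_iff.1 (Finset.mem_range.1 hi)) x hx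

lemma IsSymbol.sin_pow_mul {χ : EuclideanSpace ℝ (Fin n) → ℂ}
    (h : ∀ c : ℝ, 0 ≤ c → IsSymbol (-c) χ) (L : EuclideanSpace ℝ (Fin n) →L[ℝ] ℝ) (k : ℕ) :
    ∀ c : ℝ, 0 ≤ c → IsSymbol (k - c) fun ξ => ((Real.sin (L ξ) : ℝ) : ℂ) ^ k * χ ξ := by
  induction k with
  | zero => simpa using h
  | succ k ih =>
    intro c hc
    have := IsSymbol.sin_mul ih L hc
    simp_rw [← mul_assoc, ← pow_succ'] at this
    rw [Nat.cast_succ]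
    exact this

variable [NeZero n]

/-- A locally integrable function bounded by `|x|^{-b}` that annihilates the inverse Fourier
transforms of all rapidly decaying symbols of order `2l` vanishes almost everywhere. The central
differences of a Schwartz function are among these; letting the step of the difference tend to
infinity isolates its central term. -/
lemma ae_eq_zero_of_integral_mul_fourierInv_eq_zero {u : EuclideanSpace ℝ (Fin n) → ℂ}
    (hum : Measurable u) {A b : ℝ} (hA : 0 ≤ A) (hb : 0 < b) (hbn : b < n)
    (hu : ∀ x, x ≠ 0 → ‖u x‖ ≤ A * ‖x‖ ^ (-b)) {l : ℕ}
    (h : ∀ F : EuclideanSpace ℝ (Fin n) → ℂ,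
      (∀ c : ℝ, 0 ≤ c → IsSymbol ((2 * l : ℕ) - c) F) → ∫ x, u x * 𝓕⁻ F x = 0) :
    u =ᵐ[volume] 0 := by
  obtain ⟨v, hv⟩ := exists_norm_eq (EuclideanSpace ℝ (Fin n)) (zero_le_one (α := ℝ))
  have hv0 : v ≠ 0 := norm_pos_iff.1 (by rw [hv]; exact one_pos)
  have main : ∀ θ : 𝓢(EuclideanSpace ℝ (Fin n), ℂ), ∫ x, u x * θ x = 0 := by
    intro θ
    have hθ : ∀ c : ℝ, 0 < c → c < n → IsSymbol (-c) θ :=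
      fun c hc _ => IsSymbol.of_schwartz θ hc.le
    have hI := integrable_comp_add_mul hum hA hu hb hbn hθ
    have hI' : ∀ z, Integrable fun x => u x * θ (x + z) := fun z => by
      simpa using (hI (-z)).comp_add_right z
    have hz : ∀ z, ∫ x, u x * θ (x + z) = ∫ x, u (x + -z) * θ x := fun z => by
      rw [← integral_sub_right_eq_self _ z]
      simp [sub_eq_add_neg]
    obtain ⟨B, hB, hB'⟩ := (hθ (n - b / 2) (by linarith) (by linarith)).norm_le
    obtain ⟨C, hC, hC'⟩ := exists_lintegral_comp_add_mul_le hb hbn hA hB hu hB'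
    have hbound : ∀ z : EuclideanSpace ℝ (Fin n), z ≠ 0 →
        ‖∫ x, u x * θ (x + z)‖ ≤ C * ‖z‖ ^ (-(b / 2)) := fun z hz0 => by
      rw [← ENNReal.ofReal_le_ofReal_iff (by positivity), ofReal_norm, hz, ← norm_neg z]
      exact (enorm_integral_le_lintegral_enorm _).trans (hC' _ (neg_ne_zero.2 hz0))
    have hdiff : ∀ w, ∫ x, u x * centralDiff l w θ x = 0 := by
      intro w
      set F : EuclideanSpace ℝ (Fin n) → ℂ := fun ξ => (((Real.sin ((Real.pi • innerSL ℝ w) ξ) : ℝ)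
        : ℂ)) ^ (2 * l) * 𝓕 (θ : EuclideanSpace ℝ (Fin n) → ℂ) ξ with hF
      have hF' := h F (IsSymbol.sin_pow_mul (fun c hc => by
        rw [← SchwartzMap.fourier_coe]
        exact IsSymbol.of_schwartz _ hc) _ (2 * l))
      have hd : ∀ x, centralDiff l w θ x = ((-1) ^ l * 2 ^ (2 * l)) * 𝓕⁻ F x := fun x => by
        conv_lhs => rw [← fourierInv_fourier_schwartz θ]
        rw [centralDiff_fourierInv (integrable_fourier_schwartz θ), Real.fourierInv_eq,
          ← integral_const_mul]
        refine integral_congr_ae (Filter.Eventually.of_forall fun ξ => ?_)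
        simp only [hF, Circle.smul_def, smul_eq_mul, smul_apply,
          innerSL_apply_apply]
        push_cast
        ring
      simp_rw [hd, mul_left_comm (u _), integral_const_mul, hF', mul_zero]
    have hsum : ∀ t : ℝ, ∑ k ∈ Finset.range (2 * l + 1), ((-1 : ℂ) ^ k * ((2 * l).choose k : ℂ)) *
        ∫ x, u x * θ (x + ((k : ℝ) - l) • t • v) = 0 := fun t => by
      rw [← hdiff (t • v)]
      simp_rw [centralDiff, Finset.mul_sum, ← integral_const_mul]
      rw [← integral_finsetSum _ fun k _ => (hI' _).const_mul _]
      refine integral_congr_ae (Filter.Eventually.of_forall fun x => ?_)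
      refine Finset.sum_congr rfl fun k _ => ?_
      ring
    have hlim : Filter.Tendsto (fun t : ℝ => ∑ k ∈ Finset.range (2 * l + 1),
        ((-1 : ℂ) ^ k * ((2 * l).choose k : ℂ)) * ∫ x, u x * θ (x + ((k : ℝ) - l) • t • v))
        Filter.atTop (nhds (∑ k ∈ Finset.range (2 * l + 1),
          ((-1 : ℂ) ^ k * ((2 * l).choose k : ℂ)) * if k = l then ∫ x, u x * θ x else 0)) := by
      refine tendsto_finsetSum _ fun k _ => Filter.Tendsto.const_mul _ ?_
      rcases eq_or_ne k l with rfl | hk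
      · simp
      · rw [if_neg hk]
        have hkl : (0 : ℝ) < |(k : ℝ) - l| := by
          rw [abs_pos, sub_ne_zero]
          exact_mod_cast hk
        have h1 : Filter.Tendsto (fun t : ℝ => C * (|(k : ℝ) - l| * t) ^ (-(b / 2))) Filter.atTop
            (nhds 0) := by
          have := ((tendsto_rpow_neg_atTop (half_pos hb)).comp
            (Filter.tendsto_id.const_mul_atTop hkl)).const_mul C
          simpa using this
        refine squeeze_zero_norm' ?_ h1
        filter_upwards [Filter.eventually_gt_atTop 0] with t ht
        refine (hbound _ ?_).trans (le_of_eq ?_)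
        · exact smul_ne_zero (abs_pos.1 hkl) (smul_ne_zero ht.ne' hv0)
        · rw [norm_smul, norm_smul, hv, mul_one, Real.norm_eq_abs, Real.norm_of_nonneg ht.le]
    simp_rw [hsum] at hlim
    have h2 := tendsto_nhds_unique hlim tendsto_const_nhds
    simp_rw [mul_ite, mul_zero, Finset.sum_ite_eq'] at h2
    rw [if_pos (by simp; omega)] at h2
    have h3 : ((2 * l).choose l : ℂ) ≠ 0 := by
      exact_mod_cast (Nat.choose_pos (by omega)).ne'
    have h4 : ((-1 : ℂ) ^ l) ≠ 0 := pow_ne_zero _ (by norm_num)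
    exact (mul_eq_zero.1 h2).resolve_left (mul_ne_zero h4 h3)
  refine ae_eq_zero_of_integral_contDiff_smul_eq_zero
    (locallyIntegrable_of_norm_le_rpow hum.aestronglyMeasurable hbn hu) fun g hg hgc => ?_
  have hgc' : HasCompactSupport fun x => (g x : ℂ) := hgc.comp_left (g := Complex.ofReal) rfl
  have := main (hgc'.toSchwartzMap (Complex.ofRealCLM.contDiff.comp hg))
  rw [← this]
  refine integral_congr_ae (Filter.Eventually.of_forall fun x => ?_)
  change (g x) • u x = u x * (g x : ℂ)
  rw [Complex.real_smul, mul_comm]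

end

/-! ### Inversion of fractional Laplacians by Riesz potentials -/

section

/-- The Riesz potential `∫ |x-y|^{s-n} T(y) dy`, without the normalizing factor
`(rieszConst n s)⁻¹`. -/
noncomputable def rieszPotential {n : ℕ} (s : ℝ) (T : EuclideanSpace ℝ (Fin n) → ℂ)
    (x : EuclideanSpace ℝ (Fin n)) : ℂ :=
  ∫ y, ((‖x - y‖ ^ (s - n) : ℝ) : ℂ) * T y

variable {n : ℕ} {T ψ : EuclideanSpace ℝ (Fin n) → ℂ} {a s : ℝ}

lemma measurable_rieszPotential (hT : Measurable T) : Measurable (rieszPotential s T) := by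
  refine StronglyMeasurable.measurable ?_
  refine StronglyMeasurable.integral_prod_right' (f := fun z : EuclideanSpace ℝ (Fin n) ×
    EuclideanSpace ℝ (Fin n) => ((‖z.1 - z.2‖ ^ (s - n) : ℝ) : ℂ) * T z.2) ?_
  exact ((Complex.measurable_ofReal.comp (by fun_prop)).mul
    (hT.comp measurable_snd)).stronglyMeasurable

variable [NeZero n]

/-- The Riesz potential of order `s` of an `O(|x|^{-a})` function, `s < a < n`, converges absolutely
off the origin and is `O(|x|^{s-a})`. -/
lemma exists_lintegral_rpow_norm_sub_mul_le {A : ℝ} (hA : 0 ≤ A)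
    (hT : ∀ x, x ≠ 0 → ‖T x‖ ≤ A * ‖x‖ ^ (-a)) (hs : 0 < s) (hsa : s < a) (han : a < n) :
    ∃ C : ℝ, 0 ≤ C ∧ ∀ x : EuclideanSpace ℝ (Fin n), x ≠ 0 →
      ∫⁻ y, ‖((‖x - y‖ ^ (s - n) : ℝ) : ℂ) * T y‖ₑ ≤ ENNReal.ofReal (C * ‖x‖ ^ (s - a)) := by
  have hne : ∀ᵐ y : EuclideanSpace ℝ (Fin n), y ≠ 0 := compl_mem_ae_iff.2 (measure_singleton 0)
  obtain ⟨K, hK, key⟩ := exists_lintegral_rpow_norm_sub_mul_rpow_norm (n := n) (a := s)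
    (b := n - a) hs (by linarith) (by linarith)
  refine ⟨A * K, by positivity, fun x hx => ?_⟩
  have h1 := key x hx
  rw [show s + (n - a) - n = s - a by ring] at h1
  rw [mul_assoc, ENNReal.ofReal_mul hA, ← h1, ← lintegral_const_mul' _ _ ENNReal.ofReal_ne_top]
  refine lintegral_mono_ae ?_
  filter_upwards [hne] with y hy
  rw [← ofReal_norm, norm_mul, ← ENNReal.ofReal_mul hA, Complex.norm_real,
    Real.norm_of_nonneg (by positivity), show n - a - n = -a by ring]
  refine ENNReal.ofReal_le_ofReal ?_
  calc _ ≤ ‖x - y‖ ^ (s - n) * (A * ‖y‖ ^ (-a)) := by gcongr; exact hT y hy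
    _ = _ := by ring

lemma integrable_rpow_norm_sub_mul {A : ℝ} (hTm : Measurable T) (hA : 0 ≤ A)
    (hT : ∀ x, x ≠ 0 → ‖T x‖ ≤ A * ‖x‖ ^ (-a)) (hs : 0 < s) (hsa : s < a) (han : a < n)
    {x : EuclideanSpace ℝ (Fin n)} (hx : x ≠ 0) :
    Integrable fun y => ((‖x - y‖ ^ (s - n) : ℝ) : ℂ) * T y := by
  obtain ⟨C, _, hC⟩ := exists_lintegral_rpow_norm_sub_mul_le hA hT hs hsa han
  exact ⟨((Complex.measurable_ofReal.comp (by fun_prop)).mul hTm).aestronglyMeasurable,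
    (hC x hx).trans_lt ENNReal.ofReal_lt_top⟩

/-- The Riesz potential is symmetric. -/
lemma integral_rieszPotential_mul {A : ℝ} (hTm : Measurable T) (hA : 0 ≤ A)
    (hT : ∀ x, x ≠ 0 → ‖T x‖ ≤ A * ‖x‖ ^ (-a)) (hs : 0 < s) (hsa : s < a) (han : a < n)
    (hψ : ∀ c : ℝ, 0 < c → c < n → IsSymbol (-c) ψ) :
    Integrable (fun x => rieszPotential s T x * ψ x) ∧
      ∫ x, rieszPotential s T x * ψ x = ∫ y, T y * rieszPotential s ψ y := by
  have hψm : Measurable ψ := (hψ a (hs.trans hsa) han).measurable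
  obtain ⟨C, hC, hC'⟩ := exists_lintegral_rpow_norm_sub_mul_le hA hT hs hsa han
  have hab : 0 < a - s := by linarith
  obtain ⟨B₁, hB₁, hB₁'⟩ := (hψ ((n - (a - s)) / 2) (by linarith) (by linarith)).norm_le
  obtain ⟨B₂, hB₂, hB₂'⟩ := (hψ (n - (a - s) / 2) (by linarith) (by linarith)).norm_le
  set F : EuclideanSpace ℝ (Fin n) → EuclideanSpace ℝ (Fin n) → ℂ := fun x y =>
    ((‖x - y‖ ^ (s - n) : ℝ) : ℂ) * T y * ψ x with hF
  have hFm : Measurable (Function.uncurry F) :=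
    ((Complex.measurable_ofReal.comp (by fun_prop)).mul (hTm.comp measurable_snd)).mul
      (hψm.comp measurable_fst)
  have hFi : Integrable (Function.uncurry F) (volume.prod volume) := by
    refine ⟨hFm.aestronglyMeasurable, ?_⟩
    rw [HasFiniteIntegral, lintegral_prod _ hFm.enorm.aemeasurable]
    have h1 : ∀ x, ∫⁻ y, ‖Function.uncurry F (x, y)‖ₑ =
        (∫⁻ y, ‖((‖x - y‖ ^ (s - n) : ℝ) : ℂ) * T y‖ₑ) * ‖ψ x‖ₑ := fun x => by
      rw [← lintegral_mul_const' _ _ enorm_ne_top]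
      exact lintegral_congr fun y => enorm_mul _ _
    refine lintegral_lt_top_of_le_rpow_norm (C := C * max B₁ B₂)
      (s := (s - a) + -((n - (a - s)) / 2)) (t := (s - a) + -(n - (a - s) / 2))
      (by linarith) (by linarith) (fun x hx => ?_) fun x hx => ?_
    all_goals
      have hxn : 0 < ‖x‖ := norm_pos_iff.2 hx
      rw [h1, Real.rpow_add hxn]
    · calc _ ≤ ENNReal.ofReal (C * ‖x‖ ^ (s - a)) *
            ENNReal.ofReal (B₁ * ‖x‖ ^ (-((n - (a - s)) / 2))) := by
            rw [← ofReal_norm (ψ x)]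
            exact mul_le_mul' (hC' x hx) (ENNReal.ofReal_le_ofReal (hB₁' x hx))
        _ = ENNReal.ofReal (C * B₁ * (‖x‖ ^ (s - a) * ‖x‖ ^ (-((n - (a - s)) / 2)))) := by
            rw [← ENNReal.ofReal_mul (by positivity)]; ring_nf
        _ ≤ _ := by gcongr; exact le_max_left _ _
    · calc _ ≤ ENNReal.ofReal (C * ‖x‖ ^ (s - a)) *
            ENNReal.ofReal (B₂ * ‖x‖ ^ (-(n - (a - s) / 2))) := by
            rw [← ofReal_norm (ψ x)]
            exact mul_le_mul' (hC' x hx) (ENNReal.ofReal_le_ofReal (hB₂' x hx))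
        _ = ENNReal.ofReal (C * B₂ * (‖x‖ ^ (s - a) * ‖x‖ ^ (-(n - (a - s) / 2)))) := by
            rw [← ENNReal.ofReal_mul (by positivity)]; ring_nf
        _ ≤ _ := by gcongr; exact le_max_right _ _
  have e1 : ∀ x, ∫ y, F x y = rieszPotential s T x * ψ x := fun x => by
    rw [rieszPotential, ← integral_mul_const]
  refine ⟨by simpa only [Function.uncurry_apply_pair, e1] using hFi.integral_prod_left, ?_⟩
  simp_rw [← e1]
  rw [integral_integral_swap hFi]
  refine integral_congr_ae (Filter.Eventually.of_forall fun y => ?_)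
  simp only [rieszPotential]
  rw [← integral_const_mul]
  refine integral_congr_ae (Filter.Eventually.of_forall fun x => ?_)
  simp only [hF]
  rw [norm_sub_rev]
  ring

/-- A symbol is recovered from its fractional Laplacian by the Riesz potential. Both sides are
bounded by a locally integrable power, and they have the same integral against the inverse Fourier
transform of a symbol that decays rapidly and vanishes at the origin to an order larger than `σ`:
for such test functions the multiplier `(2π|ξ|)^{-σ}` is harmless. -/
lemma IsSymbol.rieszPotential_hypersingular_ae_eq {f : EuclideanSpace ℝ (Fin n) → ℂ} {b σ : ℝ}
    (hf : IsSymbol (-b) f) (hb : 0 < b) (hσ : 0 < σ) (hbσ : b + σ < n) {l : ℕ} (hl : σ < 2 * l)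
    {c : ℂ} (hc : c ≠ 0)
    (hc' : ∀ G : EuclideanSpace ℝ (Fin n) → ℂ, Integrable G →
      Integrable (fun ξ => (((2 * Real.pi * ‖ξ‖) ^ σ : ℝ) : ℂ) * G ξ) →
      hypersingular l σ (𝓕⁻ G) =
        fun x => c * 𝓕⁻ (fun ξ => (((2 * Real.pi * ‖ξ‖) ^ σ : ℝ) : ℂ) * G ξ) x) :
    (fun x => (rieszConst n σ : ℂ) * f x) =ᵐ[volume]
      rieszPotential σ fun x => c⁻¹ * hypersingular l σ f x := by
  have hn : (0 : ℝ) ≤ n := Nat.cast_nonneg n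
  have hbn : b < n := by linarith
  have hσn : σ < n := by linarith
  have hne : ∀ᵐ y : EuclideanSpace ℝ (Fin n), y ≠ 0 := compl_mem_ae_iff.2 (measure_singleton 0)
  set T : EuclideanSpace ℝ (Fin n) → ℂ := fun x => c⁻¹ * hypersingular l σ f x with hTdef
  have hTm : Measurable T := (measurable_hypersingular hf.measurable l).const_mul _
  obtain ⟨A, hA, hA'⟩ := hf.norm_le
  obtain ⟨B, hB, hB'⟩ := hf.exists_norm_hypersingular_le hb hbn hσ hl
  have hT : ∀ x, x ≠ 0 → ‖T x‖ ≤ (‖c⁻¹‖ * B) * ‖x‖ ^ (-(b + σ)) := fun x hx => by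
    rw [hTdef, norm_mul, mul_assoc, neg_add, ← sub_eq_add_neg]
    gcongr
    exact hB' x hx
  have hcB : 0 ≤ ‖c⁻¹‖ * B := by positivity
  obtain ⟨D, hD, hD'⟩ := exists_lintegral_rpow_norm_sub_mul_le hcB hT hσ (by linarith) hbσ
  have hR : ∀ x, x ≠ 0 → ‖rieszPotential σ T x‖ ≤ D * ‖x‖ ^ (-b) := fun x hx => by
    rw [← ENNReal.ofReal_le_ofReal_iff (by positivity), ofReal_norm]
    refine (enorm_integral_le_lintegral_enorm _).trans ((hD' x hx).trans (le_of_eq ?_))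
    rw [show σ - (b + σ) = -b by ring]
  have hκ := rieszConst_pos hσ hσn
  have h0 := ae_eq_zero_of_integral_mul_fourierInv_eq_zero
    (u := fun x => (rieszConst n σ : ℂ) * f x - rieszPotential σ T x) (l := l)
    ((hf.measurable.const_mul _).sub (measurable_rieszPotential hTm))
    (A := rieszConst n σ * A + D) (by positivity) hb hbn (fun x hx => ?_) fun F hF => ?_
  · filter_upwards [h0] with x hx
    exact sub_eq_zero.1 hx
  · refine (norm_sub_le _ _).trans ?_
    rw [norm_mul, Complex.norm_real, Real.norm_of_nonneg hκ.le, add_mul, mul_assoc]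
    gcongr
    · exact hA' x hx
    · exact hR x hx
  · push_cast at hF
    have hl0 : (0 : ℝ) ≤ l := Nat.cast_nonneg l
    set G : EuclideanSpace ℝ (Fin n) → ℂ := fun ξ => (((2 * Real.pi * ‖ξ‖) ^ (-σ) : ℝ) : ℂ) * F ξ
      with hG
    have hGs : ∀ e : ℝ, 0 ≤ e → IsSymbol (2 * l - σ - e) G := fun e he => by
      have := (hF e he).two_pi_rpow_mul (-σ)
      rwa [show -σ + (2 * l - e) = 2 * l - σ - e by ring] at this
    have hFi : Integrable F := IsSymbol.integrable hF (by linarith)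
    have hGi : Integrable G := IsSymbol.integrable hGs (by linarith)
    have hGF : (fun ξ => (((2 * Real.pi * ‖ξ‖) ^ σ : ℝ) : ℂ) * G ξ) =ᵐ[volume] F := by
      filter_upwards [hne] with ξ hξ
      have hξn : 0 < ‖ξ‖ := norm_pos_iff.2 hξ
      rw [hG, ← mul_assoc, ← Complex.ofReal_mul, ← Real.rpow_add (by positivity), add_neg_cancel,
        Real.rpow_zero, Complex.ofReal_one, one_mul]
    have hψs : ∀ e : ℝ, 0 < e → e < n → IsSymbol (-e) (𝓕⁻ F) := fun e he hen => by
      have h1 := hF 0 le_rfl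
      rw [sub_zero] at h1
      exact h1.fourierInv (by linarith) (IsSymbol.integrable_pow_norm_mul_norm hF (by linarith))
        he.le (by linarith)
    have hφs : ∀ e : ℝ, 0 < e → e < n → IsSymbol (-e) (𝓕⁻ G) := fun e he hen => by
      have h1 := hGs 0 le_rfl
      rw [sub_zero] at h1
      exact h1.fourierInv (by linarith) (IsSymbol.integrable_pow_norm_mul_norm hGs (by linarith))
        he.le (by linarith)
    have hhyp : hypersingular l σ (𝓕⁻ G) = fun x => c * 𝓕⁻ F x := by
      rw [hc' G hGi (hFi.congr hGF.symm)]
      funext x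
      rw [Real.fourierInv_eq, Real.fourierInv_eq]
      congr 1
      refine integral_congr_ae (hGF.mono fun ξ hξ => ?_)
      simp only at hξ ⊢
      rw [hξ]
    obtain ⟨-, d2, d3⟩ := integral_hypersingular_mul hf hb hσ hbσ hφs hl
    rw [hhyp] at d2 d3
    have hTφ : ∫ x, T x * 𝓕⁻ G x = ∫ x, f x * 𝓕⁻ F x := by
      simp_rw [hTdef, mul_assoc, integral_const_mul, d3, mul_left_comm _ c, integral_const_mul]
      rw [inv_mul_cancel_left₀ hc]
    have hfψ : Integrable fun x => f x * 𝓕⁻ F x := by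
      refine (d2.const_mul c⁻¹).congr (Filter.Eventually.of_forall fun x => ?_)
      simp only
      field_simp
    obtain ⟨r1, r2⟩ := integral_rieszPotential_mul hTm hcB hT hσ (by linarith) hbσ hψs
    obtain ⟨E, hE, hE'⟩ := (hψs ((σ + n) / 2) (by linarith) (by linarith)).norm_le
    have hRψ : ∀ x, x ≠ 0 → rieszPotential σ (𝓕⁻ F) x = rieszConst n σ * 𝓕⁻ G x := fun x hx =>
      integral_rpow_norm_sub_mul_fourierInv hσ hσn hFi hGi x
        (integrable_rpow_norm_sub_mul (hψs b hb hbn).measurable hE hE' hσ (by linarith)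
          (by linarith) hx)
    simp_rw [sub_mul, mul_assoc]
    rw [integral_sub (hfψ.const_mul _) r1, r2, integral_const_mul, ← hTφ, ← integral_const_mul,
      sub_eq_zero]
    refine integral_congr_ae (hne.mono fun x hx => ?_)
    simp only
    rw [hRψ x hx]
    ring

/-- A Schwartz function is the Riesz potential of its fractional Laplacian. -/
lemma rieszPotential_fracLaplacian (h : 𝓢(EuclideanSpace ℝ (Fin n), ℂ)) {α : ℝ} (hα : 0 < α)
    (hαn : α < n) {x : EuclideanSpace ℝ (Fin n)} (hx : x ≠ 0) :
    rieszPotential α (fracLaplacian α h) x = rieszConst n α * h x := by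
  have hne : ∀ᵐ y : EuclideanSpace ℝ (Fin n), y ≠ 0 := compl_mem_ae_iff.2 (measure_singleton 0)
  set G : EuclideanSpace ℝ (Fin n) → ℂ := fun ξ => (((2 * Real.pi * ‖ξ‖) ^ α : ℝ) : ℂ) *
    𝓕 (h : EuclideanSpace ℝ (Fin n) → ℂ) ξ with hG
  have hGi : Integrable G := IsSymbol.integrable
    (fun c hc => isSymbol_two_pi_rpow_mul_fourier h α hc) (by linarith)
  have hGF : (fun ξ => (((2 * Real.pi * ‖ξ‖) ^ (-α) : ℝ) : ℂ) * G ξ) =ᵐ[volume]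
      𝓕 (h : EuclideanSpace ℝ (Fin n) → ℂ) := by
    filter_upwards [hne] with ξ hξ
    have hξn : 0 < ‖ξ‖ := norm_pos_iff.2 hξ
    rw [hG, ← mul_assoc, ← Complex.ofReal_mul, ← Real.rpow_add (by positivity), neg_add_cancel,
      Real.rpow_zero, Complex.ofReal_one, one_mul]
  have hs := isSymbol_fracLaplacian h (s := α) (by linarith) (c := (α + n) / 2) (by linarith)
    (by linarith)
  obtain ⟨E, hE, hE'⟩ := hs.norm_le
  have := integral_rpow_norm_sub_mul_fourierInv hα hαn hGi
    ((integrable_fourier_schwartz h).congr hGF.symm) x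
    (integrable_rpow_norm_sub_mul hs.measurable hE hE' hα (by linarith) (by linarith) hx)
  refine this.trans ?_
  conv_rhs => rw [← fourierInv_fourier_schwartz h]
  rw [Real.fourierInv_eq, Real.fourierInv_eq]
  congr 1
  refine integral_congr_ae (hGF.mono fun ξ hξ => ?_)
  simp only at hξ ⊢
  rw [hξ]

end

/-! ### The Stein–Weiss inequality for Riesz potentials -/

section

variable {n : ℕ}

/-- The fractional Laplacian of a function is determined almost everywhere. -/
lemma IsFracLaplacian.ae_eq {s : ℝ} {g T T' : EuclideanSpace ℝ (Fin n) → ℂ}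
    (h : IsFracLaplacian s g T) (h' : IsFracLaplacian s g T') : T =ᵐ[volume] T' := by
  refine ae_eq_of_integral_contDiff_smul_eq h.locallyIntegrable_right h'.locallyIntegrable_right
    fun η hη hηc => ?_
  have hc : HasCompactSupport fun x => (η x : ℂ) := hηc.comp_left (g := Complex.ofReal) rfl
  set θ := hc.toSchwartzMap (Complex.ofRealCLM.contDiff.comp hη) with hθ
  have e : ∀ (S : EuclideanSpace ℝ (Fin n) → ℂ) x, η x • S x = S x * θ x := fun S x => by
    change η x • S x = S x * (η x : ℂ)
    rw [Complex.real_smul, mul_comm]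
  simp_rw [e]
  rw [h.integral_eq, h'.integral_eq]

lemma measurable_powerWeight {u : EuclideanSpace ℝ (Fin n) → ℂ} (hu : Measurable u) (a : ℝ) :
    Measurable (powerWeight a u) :=
  (Complex.measurable_ofReal.comp (by fun_prop)).mul hu

lemma IsSymbol.powerWeight {s : ℝ} {u : EuclideanSpace ℝ (Fin n) → ℂ} (hu : IsSymbol s u) (a : ℝ) :
    IsSymbol (a + s) (powerWeight a u) :=
  (IsSymbol.norm_rpow a).mul hu

lemma steinWeissConst_div_rieszConst {p q s τ : ℝ} (hs : 0 < s) (hsn : s < n) :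
    steinWeissConst n p q s τ / rieszConst n s =
      2 ^ (-s) * (Real.Gamma ((n / p + τ - s) / 2) * Real.Gamma ((n / q - τ) / 2)) /
        (Real.Gamma ((n / p + τ) / 2) * Real.Gamma ((n / q - τ + s) / 2)) := by
  have h1 := (Real.Gamma_pos_of_pos (half_pos hs)).ne'
  have h2 := (Real.Gamma_pos_of_pos (show 0 < (n - s) / 2 by linarith)).ne'
  have h3 : Real.pi ^ ((n : ℝ) / 2) ≠ 0 := by positivity
  have h4 : (2 : ℝ) ^ s ≠ 0 := by positivity
  rw [steinWeissConst, rieszConst, Real.rpow_neg (by norm_num)]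
  field_simp

variable [NeZero n]

/-- The Stein–Weiss inequality for the unnormalized Riesz potential of a function. -/
lemma eLpNorm_powerWeight_rieszPotential_le {p q s τ : ℝ} (hpq : p.HolderConjugate q) (hs : 0 < s)
    (hsn : s < n) (hτ : τ < n / q) (hτs : -(n / p) < τ - s) {T : EuclideanSpace ℝ (Fin n) → ℂ}
    (hT : Measurable T) :
    eLpNorm (powerWeight (τ - s) (rieszPotential s T)) (ENNReal.ofReal p) volume ≤
      ENNReal.ofReal (steinWeissConst n p q s τ) *
        eLpNorm (powerWeight τ T) (ENNReal.ofReal p) volume := by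
  have hp : 0 < p := hpq.pos
  have hne : ∀ᵐ y : EuclideanSpace ℝ (Fin n), y ≠ 0 := compl_mem_ae_iff.2 (measure_singleton 0)
  have hp0 : ENNReal.ofReal p ≠ 0 := by simpa using hp
  rw [eLpNorm_eq_lintegral_rpow_enorm_toReal hp0 ENNReal.ofReal_ne_top,
    eLpNorm_eq_lintegral_rpow_enorm_toReal hp0 ENNReal.ofReal_ne_top, ENNReal.toReal_ofReal hp.le]
  have key := lintegral_rpow_lintegral_steinWeiss_le (n := n) hpq hs hsn hτ hτs
    (u := fun y => ‖powerWeight τ T y‖ₑ) (measurable_powerWeight hT τ).enorm.aemeasurable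
  have hle : ∫⁻ x, ‖powerWeight (τ - s) (rieszPotential s T) x‖ₑ ^ p ≤
      ∫⁻ x, (∫⁻ y, ENNReal.ofReal (‖x‖ ^ (τ - s) * ‖x - y‖ ^ (s - n) * ‖y‖ ^ (-τ)) *
        ‖powerWeight τ T y‖ₑ) ^ p := by
    refine lintegral_mono fun x => ENNReal.rpow_le_rpow ?_ hp.le
    rw [powerWeight, enorm_mul, enorm_rpow_norm]
    refine (mul_le_mul' le_rfl (enorm_integral_le_lintegral_enorm _)).trans (le_of_eq ?_)
    rw [← lintegral_const_mul' _ _ ENNReal.ofReal_ne_top]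
    refine lintegral_congr_ae (hne.mono fun y hy => ?_)
    have hyn : 0 < ‖y‖ := norm_pos_iff.2 hy
    simp only [powerWeight]
    rw [enorm_mul, enorm_mul, enorm_rpow_norm, enorm_rpow_norm, ← mul_assoc, ← mul_assoc,
      ← ENNReal.ofReal_mul (by positivity), ← ENNReal.ofReal_mul (by positivity), mul_assoc _ _
      (‖y‖ ^ τ), ← Real.rpow_add hyn, neg_add_cancel, Real.rpow_zero, mul_one]
  refine (ENNReal.rpow_le_rpow (hle.trans key) (by positivity)).trans (le_of_eq ?_)
  rw [ENNReal.mul_rpow_of_nonneg _ _ (by positivity), ← ENNReal.rpow_mul, mul_one_div_cancel hp.ne',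
    ENNReal.rpow_one]

/-- A function `f` whose multiple by `rieszConst n s` is the Riesz potential of `T` satisfies the
Stein–Weiss inequality with the constant of the normalized potential. -/
lemma eLpNorm_powerWeight_le_of_rieszPotential_ae_eq {p q s τ : ℝ} (hpq : p.HolderConjugate q)
    (hs : 0 < s) (hsn : s < n) (hτ : τ < n / q) (hτs : -(n / p) < τ - s)
    {f T : EuclideanSpace ℝ (Fin n) → ℂ} (hT : Measurable T)
    (h : (fun x => (rieszConst n s : ℂ) * f x) =ᵐ[volume] rieszPotential s T) :
    eLpNorm (powerWeight (τ - s) f) (ENNReal.ofReal p) volume ≤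
      ENNReal.ofReal (2 ^ (-s) * (Real.Gamma ((n / p + τ - s) / 2) * Real.Gamma ((n / q - τ) / 2)) /
        (Real.Gamma ((n / p + τ) / 2) * Real.Gamma ((n / q - τ + s) / 2))) *
        eLpNorm (powerWeight τ T) (ENNReal.ofReal p) volume := by
  have hκ := rieszConst_pos hs hsn
  have hκ' : (rieszConst n s : ℂ) ≠ 0 := by exact_mod_cast hκ.ne'
  have h1 : powerWeight (τ - s) f =ᵐ[volume]
      (rieszConst n s : ℂ)⁻¹ • powerWeight (τ - s) (rieszPotential s T) := by
    filter_upwards [h] with x hx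
    simp only [powerWeight, Pi.smul_apply, smul_eq_mul]
    rw [← hx]
    field_simp
  rw [eLpNorm_congr_ae h1, eLpNorm_const_smul, ← steinWeissConst_div_rieszConst hs hsn,
    div_eq_inv_mul, ENNReal.ofReal_mul (by positivity), mul_assoc]
  refine mul_le_mul' (le_of_eq ?_)
    (eLpNorm_powerWeight_rieszPotential_le hpq hs hsn hτ hτs hT)
  rw [← ofReal_norm, norm_inv, Complex.norm_real, Real.norm_of_nonneg hκ.le]

/-- A symbol of order `-b` has a fractional Laplacian of order `σ`, which is inverted by the Riesz
potential and gains `σ` orders of decay for every order of `f` as a symbol. -/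
lemma IsSymbol.exists_isFracLaplacian {f : EuclideanSpace ℝ (Fin n) → ℂ} {b σ : ℝ}
    (hf : IsSymbol (-b) f) (hb : 0 < b) (hσ : 0 < σ) (hbσ : b + σ < n) :
    ∃ T : EuclideanSpace ℝ (Fin n) → ℂ, Measurable T ∧ IsFracLaplacian σ f T ∧
      (fun x => (rieszConst n σ : ℂ) * f x) =ᵐ[volume] rieszPotential σ T ∧
      ∀ b' : ℝ, 0 < b' → b' < n → IsSymbol (-b') f →
        ∃ C : ℝ, 0 ≤ C ∧ ∀ x, x ≠ 0 → ‖T x‖ ≤ C * ‖x‖ ^ (-b' - σ) := by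
  obtain ⟨l, hl'⟩ := exists_nat_gt σ
  have hl : σ < 2 * l := by linarith
  obtain ⟨c, hc, hc'⟩ := exists_hypersingular_fourierInv n hσ hl
  refine ⟨_, (measurable_hypersingular hf.measurable l).const_mul _,
    hf.isFracLaplacian hb hσ hbσ hl hc hc',
    hf.rieszPotential_hypersingular_ae_eq hb hσ hbσ hl hc hc', fun b' hb' hbn' hf' => ?_⟩
  obtain ⟨B, hB, hB'⟩ := hf'.exists_norm_hypersingular_le hb' hbn' hσ hl
  refine ⟨‖c⁻¹‖ * B, by positivity, fun x hx => ?_⟩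
  rw [norm_mul, mul_assoc]
  gcongr
  exact hB' x hx

/-- Bounds by powers on both sides of the critical one give membership in a weighted `L^p` space. -/
lemma memLp_powerWeight_of_norm_le {T : EuclideanSpace ℝ (Fin n) → ℂ} (hT : Measurable T)
    {p ρ b ε C D : ℝ} (hp : 0 < p) (hε : 0 < ε) (hb : ρ - b = -(n / p))
    (hC : ∀ x, x ≠ 0 → ‖T x‖ ≤ C * ‖x‖ ^ (-(b - ε)))
    (hD : ∀ x, x ≠ 0 → ‖T x‖ ≤ D * ‖x‖ ^ (-(b + ε))) :
    MemLp (powerWeight ρ T) (ENNReal.ofReal p) volume := by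
  have hp0 : ENNReal.ofReal p ≠ 0 := by simpa using hp
  refine ⟨(measurable_powerWeight hT ρ).aestronglyMeasurable, ?_⟩
  rw [eLpNorm_lt_top_iff_lintegral_rpow_enorm_lt_top hp0 ENNReal.ofReal_ne_top,
    ENNReal.toReal_ofReal hp.le]
  have hpε : 0 < p * ε := mul_pos hp hε
  have hpn : p * (n / p) = n := by field_simp
  refine lintegral_lt_top_of_le_rpow_norm (C := max |C| |D| ^ p) (s := p * (-(n / p) + ε))
    (t := p * (-(n / p) - ε)) (by linarith) (by linarith) (fun x hx => ?_) fun x hx => ?_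
  all_goals
    have hxn : 0 < ‖x‖ := norm_pos_iff.2 hx
    rw [← ofReal_norm, ENNReal.ofReal_rpow_of_nonneg (norm_nonneg _) hp.le, powerWeight, norm_mul,
      Complex.norm_real, Real.norm_of_nonneg (by positivity), mul_comm p, Real.rpow_mul hxn.le,
      ← Real.mul_rpow (by positivity) (by positivity)]
    refine ENNReal.ofReal_le_ofReal (Real.rpow_le_rpow (by positivity) ?_ hp.le)
  · calc _ ≤ ‖x‖ ^ ρ * (|C| * ‖x‖ ^ (-(b - ε))) := by
          gcongr
          exact (hC x hx).trans (by gcongr; exact le_abs_self C)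
      _ = |C| * ‖x‖ ^ (ρ + -(b - ε)) := by rw [Real.rpow_add hxn]; ring
      _ ≤ _ := by
          rw [show ρ + -(b - ε) = -(n / p) + ε by linarith]
          gcongr
          exact le_max_left _ _
  · calc _ ≤ ‖x‖ ^ ρ * (|D| * ‖x‖ ^ (-(b + ε))) := by
          gcongr
          exact (hD x hx).trans (by gcongr; exact le_abs_self D)
      _ = |D| * ‖x‖ ^ (ρ + -(b + ε)) := by rw [Real.rpow_add hxn]; ring
      _ ≤ _ := by
          rw [show ρ + -(b + ε) = -(n / p) - ε by linarith]
          gcongr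
          exact le_max_right _ _

end

theorem mainTheorem8 (n : ℕ) (p p' α β σ ρ : ℝ)
    (hp : 1 < p) (hpn : p < n) (hpp' : 1 / p + 1 / p' = 1)
    (hsum : α + σ = β + ρ)
    (hα : 0 < α) (hαn : α < n / p')
    (hσ : 0 < σ) (hσn : σ < n)
    (hρσ : -(n / p) < ρ - σ) (hρ : ρ < n / p')
    (h : 𝓢(EuclideanSpace ℝ (Fin n), ℂ)) :
    (∃ T : EuclideanSpace ℝ (Fin n) → ℂ,
      IsFracLaplacian σ (powerWeight β (fracLaplacian α h)) T ∧
      MemLp (powerWeight ρ T) (ENNReal.ofReal p) volume) ∧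
    ∀ T : EuclideanSpace ℝ (Fin n) → ℂ,
      IsFracLaplacian σ (powerWeight β (fracLaplacian α h)) T →
      eLpNorm (h : EuclideanSpace ℝ (Fin n) → ℂ) (ENNReal.ofReal p) volume ≤
        ENNReal.ofReal ((2 : ℝ) ^ (-(α + σ)) *
          ((Real.Gamma (n / (2 * p)) * Real.Gamma (n / (2 * p') - α / 2) *
              Real.Gamma (n / (2 * p') - ρ / 2) * Real.Gamma (n / (2 * p) + ρ / 2 - σ / 2)) /
            (Real.Gamma (n / (2 * p')) * Real.Gamma (n / (2 * p) + α / 2) *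
              Real.Gamma (n / (2 * p) + ρ / 2) *
              Real.Gamma (n / (2 * p') - ρ / 2 + σ / 2)))) *
        eLpNorm (powerWeight ρ T) (ENNReal.ofReal p) volume := by
  have hp0 : 0 < p := by linarith
  have hn : (0 : ℝ) < n := by linarith
  have : NeZero n := ⟨by rintro rfl; simp at hn⟩
  have hpq : p.HolderConjugate p' := Real.holderConjugate_iff.2 ⟨hp, by simpa using hpp'⟩
  have hnp : 0 < n / p := by positivity
  have hnq : (n : ℝ) / p + n / p' = n := by
    rw [div_eq_mul_one_div, div_eq_mul_one_div (n : ℝ) p', ← mul_add, hpp', mul_one]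
  have hαn' : α < n := by linarith
  -- for `f = O(|x|^{-b})` one has `|x|^ρ T = O(|x|^{-n/p})`, the critical decay for `L^p`
  set b : ℝ := ρ - σ + n / p with hb
  have hb0 : 0 < b := by linarith
  have hsym : ∀ e, 0 ≤ β + e → β + e ≤ n + α →
      IsSymbol (-e) (powerWeight β (fracLaplacian α h)) := fun e h1 h2 => by
    have := (isSymbol_fracLaplacian h (s := α) (by linarith) h1 h2).powerWeight β
    rwa [show β + -(β + e) = -e by ring] at this
  obtain ⟨T, hTm, hT, hTR, hTb⟩ := (hsym b (by linarith) (by linarith)).exists_isFracLaplacian hb0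
    hσ (by linarith)
  constructor
  · refine ⟨T, hT, ?_⟩
    -- room for moving `b` by `ε` in both directions
    obtain ⟨ε, hε, h1, h2, h3, h4⟩ : ∃ ε : ℝ, 0 < ε ∧ ε < b ∧ ε < n - σ - b ∧ ε ≤ α + n / p ∧
        ε ≤ n - n / p := by
      set m : ℝ := min (min b (n - σ - b)) (min (α + n / p) (n - n / p)) with hm
      have hm0 : 0 < m := lt_min (lt_min hb0 (by linarith)) (lt_min (by linarith) (by linarith))
      have hm1 : m ≤ b := (min_le_left _ _).trans (min_le_left _ _)
      have hm2 : m ≤ n - σ - b := (min_le_left _ _).trans (min_le_right _ _)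
      have hm3 : m ≤ α + n / p := (min_le_right _ _).trans (min_le_left _ _)
      have hm4 : m ≤ n - n / p := (min_le_right _ _).trans (min_le_right _ _)
      exact ⟨m / 2, by linarith, by linarith, by linarith, by linarith, by linarith⟩
    obtain ⟨C, -, hC⟩ := hTb (b - ε) (by linarith) (by linarith)
      (hsym _ (by linarith) (by linarith))
    obtain ⟨D, -, hD⟩ := hTb (b + ε) (by linarith) (by linarith)
      (hsym _ (by linarith) (by linarith))
    refine memLp_powerWeight_of_norm_le hTm (b := b + σ) (C := C) (D := D) hp0 hε (by linarith)
      (fun x hx => ?_) fun x hx => ?_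
    · rw [show -(b + σ - ε) = -(b - ε) - σ by ring]
      exact hC x hx
    · rw [show -(b + σ + ε) = -(b + ε) - σ by ring]
      exact hD x hx
  · intro T' hT'
    have hne : ∀ᵐ y : EuclideanSpace ℝ (Fin n), y ≠ 0 := compl_mem_ae_iff.2 (measure_singleton 0)
    have e1 : powerWeight ρ T' =ᵐ[volume] powerWeight ρ T := by
      filter_upwards [hT'.ae_eq hT] with x hx
      simp only [powerWeight, hx]
    have hgm : Measurable (fracLaplacian α h) :=
      (isSymbol_fracLaplacian h (s := α) (by linarith) le_rfl (by linarith)).measurable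
    have i1 := eLpNorm_powerWeight_le_of_rieszPotential_ae_eq (τ := α) hpq hα hαn' hαn
      (by linarith) hgm (f := h) (hne.mono fun x hx => (rieszPotential_fracLaplacian h hα hαn' hx).symm)
    have i2 := eLpNorm_powerWeight_le_of_rieszPotential_ae_eq (τ := ρ) hpq hσ hσn hρ hρσ hTm hTR
    have e2 : powerWeight (α - α) (h : EuclideanSpace ℝ (Fin n) → ℂ) = h := by
      funext x
      simp [powerWeight]
    have e3 : powerWeight α (fracLaplacian α h) =ᵐ[volume]
        powerWeight (ρ - σ) (powerWeight β (fracLaplacian α h)) := by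
      filter_upwards [hne] with x hx
      simp only [powerWeight]
      rw [← mul_assoc, ← Complex.ofReal_mul, ← Real.rpow_add (norm_pos_iff.2 hx),
        show ρ - σ + β = α by linarith]
    rw [e2, eLpNorm_congr_ae e3] at i1
    rw [eLpNorm_congr_ae e1]
    refine i1.trans ((mul_le_mul' le_rfl i2).trans (le_of_eq ?_))
    have hΓ1 := Real.Gamma_pos_of_pos (show 0 < (n / p + α - α) / 2 by linarith)
    have hΓ2 := Real.Gamma_pos_of_pos (show 0 < (n / p' - α) / 2 by linarith)
    have hΓ3 := Real.Gamma_pos_of_pos (show 0 < (n / p + α) / 2 by linarith)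
    have hΓ4 := Real.Gamma_pos_of_pos (show 0 < (n / p' - α + α) / 2 by linarith)
    rw [← mul_assoc, ← ENNReal.ofReal_mul (by positivity), neg_add, Real.rpow_add two_pos,
      show (n : ℝ) / (2 * p) = n / p / 2 by rw [div_div, mul_comm],
      show (n : ℝ) / (2 * p') = n / p' / 2 by rw [div_div, mul_comm]]
    congr 2
    rw [show (n / p + α - α) / 2 = n / p / 2 by ring, show (n / p' - α + α) / 2 = n / p' / 2 by ring,
      show (n / p' - α) / 2 = n / p' / 2 - α / 2 by ring,
      show (n / p + α) / 2 = n / p / 2 + α / 2 by ring,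
      show (n / p + ρ - σ) / 2 = n / p / 2 + ρ / 2 - σ / 2 by ring,
      show (n / p' - ρ) / 2 = n / p' / 2 - ρ / 2 by ring,
      show (n / p + ρ) / 2 = n / p / 2 + ρ / 2 by ring,
      show (n / p' - ρ + σ) / 2 = n / p' / 2 - ρ / 2 + σ / 2 by ring, div_mul_div_comm,
      ← mul_div_assoc]
    congr 1 <;> ring
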